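/- Let $M$ be a compact PL $2$-manifold without boundary (possibly disconnected), given as a finite polytopal complex: $M$ is a Hausdorff space decomposed into finitely many cells, each parametrized by a convex polytope, such that faces of cells are cells, two cells are disjoint or meet in a common face, the identifications of faces are affine, and every point of $M$ lies in a PL chart, i.e. has an open neighbourhood with a homeomorphism onto an open part of $\mathbb{R}^2$ that is piecewise linear on each cell. Let $f\colon M\to\mathbb{R}$ be a generic PL function, i.e. $f$ is affine on each cell and $f(v)\neq f(w)$ for any two distinct vertices $v,w$. Let $\mathbb{F}$ be any field and $H_*$ singular homology with coefficients in $\mathbb{F}$. For a vertex $v$ put $a=f(v)$ and $f_a=\{x\in M: f(x)\le a\}$. The multiplicity of $v$ restricted to the index $k$ is $\operatorname{rk} H_k(f_a,f_a\setminus\{v\};\mathbb{F})$, and the total multiplicity is the total rank of $H_*(f_a,f_a\setminus\{v\};\mathbb{F})$. The vertex $v$ is H-critical of index $k$ if $H_k(f_a,f_a\setminus\{v\};\mathbb{F})\ne 0$, H-critical if it is so for some $k$, and H-regular if $H_*(f_a,f_a\setminus\{v\};\mathbb{F})=0$. A saddle point is an H-critical vertex that is neither a local minimum nor a local maximum of $f$.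 The link $lk(v)$ is the union of the cells that do not contain $v$ but are contained in a cell containing $v$, and $lk^-(v)=\{x\in lk(v): f(x)\le f(v)\}$. The vertex $v$ is strongly regular if there is a PL chart $(x_1,x_2)$ centred at $v$ in which $f=f(v)+x_i$ for one of the coordinates $x_i$. It is non-degenerate critical of index $k\in\{0,1,2\}$ if there is a PL chart $(x_1,x_2)$ centred at $v$ in which $f=f(v)-\sum_{i\le k}|x_i|+\sum_{i>k}|x_i|$. The function $f$ is a PL Morse function if every vertex is non-degenerate critical (of some index) or strongly regular. Then: (1) Every H-critical vertex $v$ is of one of the following types: (a) a local minimum, H-critical of index $0$ and of no other index, with multiplicity $1$; (b) a local maximum, H-critical of index $2$ and of no other index, with multiplicity $1$; (c) a saddle point, H-critical of index $1$ and of no other index, with multiplicity $r-1$, where $r\ge 2$ is the (otherwise unrestricted) number of connected components of $lk^-(v)$. (2) Every H-regular vertex is strongly regular. (3) Every saddle point of total multiplicity $1$ is non-degenerate critical of index $1$. (4) $f$ is a PL Morse function if and only if every saddle point has total multiplicity $1$. -/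

import Mathlib

open CategoryTheory AlgebraicTopology Set Topology DirectSum

universe u

noncomputable section

/-! ### Polytopes and piecewise linear maps -/

/-- A convex polytope in `ℝⁿ`: the convex hull of a finite set (the empty polytope is allowed). -/
def IsPolytope {n : ℕ} (P : Set (Fin n → ℝ)) : Prop :=
  ∃ s : Finset (Fin n → ℝ), P = convexHull ℝ (s : Set (Fin n → ℝ))

/-- `g` is piecewise linear on `S`: every point of `S` has a neighbourhood in `S` that is covered
by finitely many convex polytopes on each of which `g` agrees with an affine map.
(As the polytopes are closed, such a `g` is automatically continuous on `S`.) -/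
def IsPLOn {n m : ℕ} (g : (Fin n → ℝ) → (Fin m → ℝ)) (S : Set (Fin n → ℝ)) : Prop :=
  ∀ x ∈ S, ∃ U ∈ 𝓝 x, ∃ (N : ℕ) (Q : Fin N → Set (Fin n → ℝ))
    (A : Fin N → ((Fin n → ℝ) →ᵃ[ℝ] (Fin m → ℝ))),
    (∀ i, IsPolytope (Q i)) ∧ S ∩ U ⊆ ⋃ i, Q i ∧ ∀ i, EqOn g (A i) (S ∩ U ∩ Q i)

/-! ### Finite polytopal complexes -/

/-- The structure of a finite (abstract) polytopal complex on the space `M`: finitely many nonempty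
cells, each of which is a homeomorphic image of a convex polytope in some `ℝⁿ` (one `n` large enough
for all the cells), such that every nonempty face of a cell is a cell, and two cells are disjoint or
meet in a common face, the identifications of faces being affine.

`IsExposed ℝ P F` says that `F` is a face of the polytope `P`, `P` itself included. -/
structure PolytopalComplex (M : Type u) [TopologicalSpace M] where
  /-- the index set of the cells -/
  Cell : Type
  finite_cell : Finite Cell
  /-- dimension of the ambient space of the polytopes -/
  n : ℕ
  /-- the polytope that parametrizes a cell -/
  polytope : Cell → Set (Fin n → ℝ)
  isPolytope : ∀ c, IsPolytope (polytope c)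
  nonempty : ∀ c, (polytope c).Nonempty
  /-- the parametrization of a cell; only its values on the polytope matter -/
  param : Cell → (Fin n → ℝ) → M
  continuousOn_param : ∀ c, ContinuousOn (param c) (polytope c)
  injOn_param : ∀ c, InjOn (param c) (polytope c)
  cover : ⋃ c, param c '' polytope c = univ
  cell_injective : ∀ c c', param c '' polytope c = param c' '' polytope c' → c = c'
  exists_face : ∀ c F, IsExposed ℝ (polytope c) F → F.Nonempty →
    ∃ (c' : Cell) (A : (Fin n → ℝ) →ᵃ[ℝ] (Fin n → ℝ)),
      A '' polytope c' = F ∧ ∀ x ∈ polytope c', param c (A x) = param c' x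
  inter_face : ∀ c₁ c₂, (param c₁ '' polytope c₁ ∩ param c₂ '' polytope c₂).Nonempty →
    ∃ c, param c '' polytope c = param c₁ '' polytope c₁ ∩ param c₂ '' polytope c₂ ∧
      (∃ A : (Fin n → ℝ) →ᵃ[ℝ] (Fin n → ℝ), IsExposed ℝ (polytope c₁) (A '' polytope c) ∧
        ∀ x ∈ polytope c, param c₁ (A x) = param c x) ∧
      (∃ A : (Fin n → ℝ) →ᵃ[ℝ] (Fin n → ℝ), IsExposed ℝ (polytope c₂) (A '' polytope c) ∧
        ∀ x ∈ polytope c, param c₂ (A x) = param c x)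

namespace PolytopalComplex

variable {M : Type u} [TopologicalSpace M] (K : PolytopalComplex M)

/-- The closed cell of `M` with index `c`. -/
def cell (c : K.Cell) : Set M := K.param c '' K.polytope c

/-- The vertices: the points of `M` that form a cell. -/
def vertices : Set M := {v | ∃ c, K.cell c = {v}}

/-- The link of a vertex: the union of the cells that do not contain `v` but are contained in
a cell that does. -/
def link (v : M) : Set M :=
  {x | ∃ c c', v ∈ K.cell c' ∧ K.cell c ⊆ K.cell c' ∧ v ∉ K.cell c ∧ x ∈ K.cell c}

/-- `lk⁻(v)`, the part of the link where `f ≤ f v`. -/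
def lowerLink (f : M → ℝ) (v : M) : Set M := {x ∈ K.link v | f x ≤ f v}

/-- A generic PL function: affine on each cell, with distinct values at distinct vertices. -/
def IsGenericPL (f : M → ℝ) : Prop :=
  (∀ c, ∃ A : (Fin K.n → ℝ) →ᵃ[ℝ] ℝ, ∀ x ∈ K.polytope c, f (K.param c x) = A x) ∧
    InjOn f K.vertices

/-- A PL chart: a homeomorphism of an open part of `M` onto an open part of `ℝᵈ` that is piecewise
linear on each cell. -/
def IsPLChart {d : ℕ} (e : OpenPartialHomeomorph M (Fin d → ℝ)) : Prop :=
  ∀ c, IsPLOn (fun x => e (K.param c x)) (K.polytope c ∩ K.param c ⁻¹' e.source)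

/-- `M` with the piecewise linear structure given by `K` is a PL `d`-manifold (without boundary):
the PL charts cover `M`. -/
def IsPLManifold (d : ℕ) : Prop :=
  ∀ p : M, ∃ e : OpenPartialHomeomorph M (Fin d → ℝ), K.IsPLChart e ∧ p ∈ e.source

/-- `p` is strongly regular for `f`: in some PL chart centred at `p`, `f` is, up to the additive
constant `f p`, one of the coordinates. -/
def IsStronglyRegular (d : ℕ) (f : M → ℝ) (p : M) : Prop :=
  ∃ e : OpenPartialHomeomorph M (Fin d → ℝ), K.IsPLChart e ∧ p ∈ e.source ∧ e p = 0 ∧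
    ∃ i : Fin d, ∀ y ∈ e.source, f y = f p + e y i

/-- `v` is non-degenerate critical of index `k` for `f`: in some PL chart centred at `v`,
`f = f v - |x₁| - ⋯ - |x_k| + |x_{k+1}| + ⋯ + |x_d|`. -/
def IsNondegenerateCritical (d : ℕ) (f : M → ℝ) (v : M) (k : ℕ) : Prop :=
  k ≤ d ∧ ∃ e : OpenPartialHomeomorph M (Fin d → ℝ), K.IsPLChart e ∧ v ∈ e.source ∧ e v = 0 ∧
    ∀ y ∈ e.source, f y = f v + ∑ i : Fin d, if (i : ℕ) < k then -|e y i| else |e y i|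

/-- A generic PL function is a PL Morse function if each vertex is non-degenerate critical
or strongly regular. -/
def IsPLMorse (d : ℕ) (f : M → ℝ) : Prop :=
  K.IsGenericPL f ∧ ∀ v ∈ K.vertices,
    (∃ k, K.IsNondegenerateCritical d f v k) ∨ K.IsStronglyRegular d f v

end PolytopalComplex

/-! ### Homological criticality -/

/-- The relative singular homology `H_k(X, A; 𝔽)`: the homology of the quotient of the singular
chain complex of `X` by the one of `A`. -/
def relativeHomology (𝔽 : Type u) [Field 𝔽] (X : Type u) [TopologicalSpace X] (A : Set X) (k : ℕ) :
    ModuleCat.{u} 𝔽 :=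
  (Limits.cokernel
    (((singularChainComplexFunctor (ModuleCat.{u} 𝔽)).obj (ModuleCat.of 𝔽 𝔽)).map
      (TopCat.ofHom ⟨((↑) : A → X), continuous_subtype_val⟩))).homology k

section Critical

variable (𝔽 : Type u) [Field 𝔽] {M : Type u} [TopologicalSpace M]

/-- `H_k(f_a, f_a ∖ {v}; 𝔽)` where `a = f v` and `f_a = {x | f x ≤ a}`. -/
def levelHomology (f : M → ℝ) (v : M) (k : ℕ) : ModuleCat.{u} 𝔽 :=
  relativeHomology 𝔽 {x : M // f x ≤ f v} {x | (x : M) ≠ v} k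

/-- `v` is H-critical of index `k`: `H_k(f_a, f_a ∖ {v}; 𝔽) ≠ 0`. -/
def IsHCriticalOfIndex (f : M → ℝ) (v : M) (k : ℕ) : Prop :=
  Nontrivial (levelHomology 𝔽 f v k)

/-- `v` is H-critical: `H_*(f_a, f_a ∖ {v}; 𝔽) ≠ 0`. -/
def IsHCritical (f : M → ℝ) (v : M) : Prop :=
  ∃ k, IsHCriticalOfIndex 𝔽 f v k

/-- `v` is H-regular with respect to `𝔽`: `H_*(f_a, f_a ∖ {v}; 𝔽) = 0`. -/
def IsHRegular (f : M → ℝ) (v : M) : Prop :=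
  ∀ k, Subsingleton (levelHomology 𝔽 f v k)

/-- The multiplicity of `v` restricted to the index `k`: the rank of `H_k(f_a, f_a ∖ {v}; 𝔽)`. -/
def criticalMultiplicity (f : M → ℝ) (v : M) (k : ℕ) : ℕ∞ :=
  Cardinal.toENat (Module.rank 𝔽 (levelHomology 𝔽 f v k))

/-- The total multiplicity of `v`: the total rank of `H_*(f_a, f_a ∖ {v}; 𝔽)`. -/
def totalMultiplicity (f : M → ℝ) (v : M) : ℕ∞ :=
  Cardinal.toENat (Module.rank 𝔽 (⨁ k : ℕ, levelHomology 𝔽 f v k))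

/-- A saddle point: an H-critical point that is neither a local minimum nor a local maximum. -/
def IsSaddle (f : M → ℝ) (v : M) : Prop :=
  IsHCritical 𝔽 f v ∧ ¬ IsLocalMin f v ∧ ¬ IsLocalMax f v

end Critical

end

/-! In a piecewise linear chart centred at a vertex `v`, the function equals `f v + h` near `v`,
where `h` is continuous, positively homogeneous of degree one and affine on finitely many convex
pieces around the origin. All local data at `v` can therefore be read off from `h` on the `ℓ¹`
circle, which is a polygon and so admits a piecewise linear parametrization `dia` by `[0, 4]`. The
star of `v` embeds conically into the plane, and radial projection then identifies the lower link
with the part of the circle where `h ≤ 0`.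

The distinctness of the vertex values enters at one place only, `mem_closure_of_link`: the smallest
cell around a link point at level `f v` has a vertex at another level, so `f - f v` takes both signs
arbitrarily near that point. Consequently there are three cases. Either `h > 0` off the origin, or
`h < 0` off the origin, or the set `h ≤ 0` on the circle consists of `r ≥ 1` disjoint nondegenerate
arcs, with zeros at their ends and negative values inside.

For the homology, excision replaces `(f_a, f_a ∖ {v})` by a sublevel cone and the cone without its
apex. The cone is contractible, and the punctured cone is homotopy equivalent to its base, which is
empty, a circle, or `r` points up to homotopy. The long exact sequence gives rank one in degree 0,
rank one in degree 2, or rank `r - 1` in degree 1. This needs excision, proved by barycentric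
subdivision, and the homology of the circle, obtained from the chain complexes of its universal
covering.

For the normal forms, the sign pattern of `h` around the circle determines `h` up to a piecewise
linear homeomorphism (`exists_normalForm`): rays go to rays by an order isomorphism matching the
zeros, each ray is rescaled by the quotient of the two functions, and the map is extended linearly
over sectors. So `r = 1` gives a coordinate function, `r = 2` the standard saddle, and the definite
cases give plus or minus the `ℓ¹` norm.

`vertex_trichotomy` collects both halves. The four claims then amount to comparing `r` with 1 and 2,
except that one direction of the Morse criterion also needs the homology computed from the given
normal forms. -/

noncomputable section

/-! ### Bases of the singular chain modules -/

section SingularChains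

open Simplicial

variable (𝔽 : Type u) [Field 𝔽]

/-- The singular chain complex of `X` with coefficients in `𝔽`. -/
abbrev singC (X : Type u) [TopologicalSpace X] : ChainComplex (ModuleCat.{u} 𝔽) ℕ :=
  ((singularChainComplexFunctor (ModuleCat.{u} 𝔽)).obj (ModuleCat.of 𝔽 𝔽)).obj (TopCat.of X)

/-- The chain map induced by a continuous map. -/
abbrev singMap {X Y : Type u} [TopologicalSpace X] [TopologicalSpace Y] (g : C(X, Y)) :
    singC 𝔽 X ⟶ singC 𝔽 Y :=
  ((singularChainComplexFunctor (ModuleCat.{u} 𝔽)).obj (ModuleCat.of 𝔽 𝔽)).map (TopCat.ofHom g)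

/-- The type of singular `n`-simplices of `X`. -/
abbrev Simp (X : Type u) [TopologicalSpace X] (n : ℕ) : Type u :=
  C(stdSimplex ℝ (Fin (n + 1)), X)

/-- Singular simplices as elements of the singular simplicial set. -/
def toSS {X : Type u} [TopologicalSpace X] {n : ℕ} : Simp X n ≃ (TopCat.toSSet.obj (TopCat.of X)) _⦋n⦌ :=
  (TopCat.toSSetObjEquiv (TopCat.of X) (Opposite.op ⦋n⦌)).symm

/-- The element of a simplicial chain module given by a simplex. -/
def ssetGen (S : SSet.{u}) {n : ℕ} (s : S _⦋n⦌) : (S.chainComplex (ModuleCat.of 𝔽 𝔽)).X n :=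
  (S.ιChainComplex (R := ModuleCat.of 𝔽 𝔽) s).hom (1 : 𝔽)

/-- The coordinates of a simplicial chain. -/
def ssetRepr (S : SSet.{u}) (n : ℕ) :
    (S.chainComplex (ModuleCat.of 𝔽 𝔽)).X n ⟶ ModuleCat.of 𝔽 ((S _⦋n⦌) →₀ 𝔽) :=
  (S.isColimitChainComplexXCofan (ModuleCat.of 𝔽 𝔽) n).desc
    (Limits.Cofan.mk (ModuleCat.of 𝔽 ((S _⦋n⦌) →₀ 𝔽)) fun s => ModuleCat.ofHom (Finsupp.lsingle s))

lemma ι_ssetRepr (S : SSet.{u}) {n : ℕ} (s : S _⦋n⦌) :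
    S.ιChainComplex (R := ModuleCat.of 𝔽 𝔽) s ≫ ssetRepr 𝔽 S n =
      ModuleCat.ofHom (Finsupp.lsingle s) :=
  (S.isColimitChainComplexXCofan (ModuleCat.of 𝔽 𝔽) n).fac
    (Limits.Cofan.mk (ModuleCat.of 𝔽 ((S _⦋n⦌) →₀ 𝔽))
      fun s => ModuleCat.ofHom (Finsupp.lsingle s)) ⟨s⟩

lemma ssetRepr_gen (S : SSet.{u}) {n : ℕ} (s : S _⦋n⦌) :
    (ssetRepr 𝔽 S n).hom (ssetGen 𝔽 S s) = Finsupp.single s 1 :=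
  congr($(ι_ssetRepr 𝔽 S s).hom (1 : 𝔽))

lemma ssetChain_hom_ext (S : SSet.{u}) {n : ℕ} {V : ModuleCat.{u} 𝔽}
    {f g : (S.chainComplex (ModuleCat.of 𝔽 𝔽)).X n ⟶ V}
    (h : ∀ s, f.hom (ssetGen 𝔽 S s) = g.hom (ssetGen 𝔽 S s)) : f = g := by
  refine SSet.chainComplex_hom_ext fun s => ModuleCat.hom_ext (LinearMap.ext_ring (h s))

/-- The basis of a simplicial chain module consisting of the simplices. -/
def ssetBasis (S : SSet.{u}) (n : ℕ) :
    Module.Basis (S _⦋n⦌) 𝔽 ((S.chainComplex (ModuleCat.of 𝔽 𝔽)).X n) :=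
  .ofRepr (LinearEquiv.ofLinearMap (ssetRepr 𝔽 S n).hom
    (Finsupp.linearCombination 𝔽 fun s => ssetGen 𝔽 S s)
    (by
      refine Finsupp.lhom_ext' fun s => LinearMap.ext_ring ?_
      simpa using ssetRepr_gen 𝔽 S s)
    (by
      have key : ssetRepr 𝔽 S n ≫ ModuleCat.ofHom
          (Finsupp.linearCombination 𝔽 fun s => ssetGen 𝔽 S s) = 𝟙 _ := by
        refine ssetChain_hom_ext 𝔽 S fun s => ?_
        refine (congrArg (Finsupp.linearCombination 𝔽 fun s => ssetGen 𝔽 S s)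
          (ssetRepr_gen 𝔽 S s)).trans ?_
        simp
      exact congr($(key).hom)))

lemma ssetBasis_apply (S : SSet.{u}) (n : ℕ) (s : S _⦋n⦌) :
    ssetBasis 𝔽 S n s = ssetGen 𝔽 S s := by
  change Finsupp.linearCombination 𝔽 _ (Finsupp.single s 1) = _
  simp

/-- The basis of the singular chain module consisting of the singular simplices. -/
def chB (X : Type u) [TopologicalSpace X] (n : ℕ) :
    Module.Basis (Simp X n) 𝔽 ((singC 𝔽 X).X n) :=
  (ssetBasis 𝔽 (TopCat.toSSet.obj (TopCat.of X)) n).reindex toSS.symm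

variable {X Y : Type u} [TopologicalSpace X] [TopologicalSpace Y]

lemma chB_apply {n : ℕ} (s : Simp X n) :
    chB 𝔽 X n s = ssetGen 𝔽 (TopCat.toSSet.obj (TopCat.of X)) (toSS s) :=
  ((ssetBasis 𝔽 (TopCat.toSSet.obj (TopCat.of X)) n).reindex_apply _ _).trans
    (ssetBasis_apply 𝔽 _ _ _)

/-- The `i`-th face of the standard simplex. -/
def faceMap {n : ℕ} (i : Fin (n + 2)) :
    C(stdSimplex ℝ (Fin (n + 1)), stdSimplex ℝ (Fin (n + 2))) :=
  ⟨stdSimplex.map (Fin.succAbove i), stdSimplex.continuous_map _⟩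

lemma chB_map (g : C(X, Y)) {n : ℕ} (s : Simp X n) :
    ((singMap 𝔽 g).f n).hom (chB 𝔽 X n s) = chB 𝔽 Y n (g.comp s) := by
  rw [chB_apply, chB_apply]
  exact congr($(SSet.ι_chainComplexMap_f (R := ModuleCat.of 𝔽 𝔽) _ _
    (f := TopCat.toSSet.map (TopCat.ofHom g)) (n := n) (toSS s)).hom (1 : 𝔽))

/-- Together with `chB_map` this makes the categorically defined complex computable: chain maps and
differentials are evaluated on the basis of simplices from here on. -/
lemma chB_d {n : ℕ} (s : Simp X (n + 1)) :
    ((singC 𝔽 X).d (n + 1) n).hom (chB 𝔽 X (n + 1) s) =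
      ∑ i : Fin (n + 2), (-1 : ℤ) ^ i.val • chB 𝔽 X n (s.comp (faceMap i)) := by
  simp only [chB_apply]
  have h := congr($(SSet.ιChainComplex_d (TopCat.toSSet.obj (TopCat.of X)) (ModuleCat.of 𝔽 𝔽)
    (toSS s)).hom (1 : 𝔽))
  refine h.trans ?_
  rw [ModuleCat.hom_sum, LinearMap.sum_apply]
  exact Finset.sum_congr rfl fun i _ => by rw [ModuleCat.hom_zsmul]; rfl

end SingularChains
end

noncomputable section

/-! ### Barycentric subdivision of formal chains of tuples -/

section Tuples

variable (𝔽 : Type u) [Field 𝔽] {P Q : Type*}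

/-- Formal chains of `(k+1)`-tuples of elements of `P`. -/
abbrev TupleChain (P : Type*) (k : ℕ) := (Fin (k + 1) → P) →₀ 𝔽

namespace TupleChain

/-- The boundary of formal chains. -/
def bd (k : ℕ) : TupleChain 𝔽 P (k + 1) →ₗ[𝔽] TupleChain 𝔽 P k :=
  Finsupp.linearCombination 𝔽 fun w =>
    ∑ i : Fin (k + 2), (-1 : ℤ) ^ i.val • Finsupp.single (w ∘ i.succAbove) (1 : 𝔽)

lemma bd_single {k : ℕ} (w : Fin (k + 2) → P) : bd 𝔽 k (Finsupp.single w 1) =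
    ∑ i : Fin (k + 2), (-1 : ℤ) ^ i.val • Finsupp.single (w ∘ i.succAbove) (1 : 𝔽) := by
  simp [bd]

/-- The augmentation of formal chains. -/
def aug : TupleChain 𝔽 P 0 →ₗ[𝔽] 𝔽 := Finsupp.linearCombination 𝔽 fun _ => 1

/-- The cone of a formal chain with apex `b`. -/
def cone (b : P) (k : ℕ) : TupleChain 𝔽 P k →ₗ[𝔽] TupleChain 𝔽 P (k + 1) :=
  Finsupp.lmapDomain 𝔽 𝔽 (fun w => (Fin.cons b w : Fin (k + 2) → P))

lemma cone_single (b : P) {k : ℕ} (w : Fin (k + 1) → P) :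
    cone 𝔽 b k (Finsupp.single w 1) = Finsupp.single (Fin.cons b w) 1 := by
  simp [cone]

lemma aug_bd (c : TupleChain 𝔽 P 1) : aug 𝔽 (bd 𝔽 0 c) = 0 := by
  suffices h : aug 𝔽 ∘ₗ bd 𝔽 0 = (0 : TupleChain 𝔽 P 1 →ₗ[𝔽] 𝔽) from congr($h c)
  refine Finsupp.lhom_ext' fun w => LinearMap.ext_ring ?_
  simp [bd_single, aug, Fin.sum_univ_two]

lemma cons_comp_succAbove_succ (b : P) {k : ℕ} (w : Fin (k + 2) → P) (i : Fin (k + 2)) :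
    (Fin.cons b w : Fin (k + 3) → P) ∘ i.succ.succAbove = Fin.cons b (w ∘ i.succAbove) := by
  funext j
  refine Fin.cases ?_ (fun j => ?_) j <;> simp

/-- The face opposite to the apex is the base itself, and the other faces are cones over the faces
of the base, with the sign shifted by one. -/
lemma bd_cone (b : P) {k : ℕ} (c : TupleChain 𝔽 P (k + 1)) :
    bd 𝔽 (k + 1) (cone 𝔽 b (k + 1) c) = c - cone 𝔽 b k (bd 𝔽 k c) := by
  suffices h : bd 𝔽 (k + 1) ∘ₗ cone 𝔽 b (k + 1) = LinearMap.id - cone 𝔽 b k ∘ₗ bd 𝔽 k from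
    congr($h c)
  refine Finsupp.lhom_ext' fun w => LinearMap.ext_ring ?_
  simp only [LinearMap.comp_apply, Finsupp.lsingle_apply, LinearMap.sub_apply, LinearMap.id_apply,
    cone_single, bd_single, map_sum, map_zsmul]
  rw [Fin.sum_univ_succ]
  simp only [cons_comp_succAbove_succ, Fin.val_succ, pow_succ]
  have : (Fin.cons b w : Fin (k + 3) → P) ∘ (0 : Fin (k + 3)).succAbove = w := by
    funext j; simp
  rw [this]
  simp [Finset.sum_neg_distrib, sub_eq_add_neg]

/-- A point has no faces to cone over. The second end of each segment is the apex, which is counted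
by the augmentation. -/
lemma bd_cone_zero (b : P) (c : TupleChain 𝔽 P 0) :
    bd 𝔽 0 (cone 𝔽 b 0 c) = c - aug 𝔽 c • Finsupp.single (fun _ => b) 1 := by
  suffices h : bd 𝔽 0 ∘ₗ cone 𝔽 b 0 =
      LinearMap.id - (aug 𝔽).smulRight (Finsupp.single (fun _ => b) 1) from congr($h c)
  refine Finsupp.lhom_ext' fun w => LinearMap.ext_ring ?_
  have h1 : (Fin.cons b w : Fin 2 → P) ∘ (1 : Fin 2).succAbove = fun _ => b := by
    funext j; fin_cases j; rfl
  simp [cone_single, bd_single, Fin.sum_univ_two, h1, aug, sub_eq_add_neg]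

/-- Every tuple is the cone over its tail with its first entry as apex, so the cone formula reduces
the claim to one degree less. -/
lemma bd_bd {k : ℕ} (c : TupleChain 𝔽 P (k + 2)) : bd 𝔽 k (bd 𝔽 (k + 1) c) = 0 := by
  suffices h : bd 𝔽 k ∘ₗ bd 𝔽 (k + 1) = (0 : TupleChain 𝔽 P (k + 2) →ₗ[𝔽] _) from congr($h c)
  clear c
  induction k with
  | zero =>
    refine Finsupp.lhom_ext' fun w => LinearMap.ext_ring ?_
    have : Finsupp.single w (1 : 𝔽) = cone 𝔽 (w 0) 1 (Finsupp.single (Fin.tail w) 1) := by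
      simp [cone_single]
    simp [this, bd_cone, bd_cone_zero, aug_bd]
  | succ k ih =>
    refine Finsupp.lhom_ext' fun w => LinearMap.ext_ring ?_
    have : Finsupp.single w (1 : 𝔽) = cone 𝔽 (w 0) (k + 2) (Finsupp.single (Fin.tail w) 1) := by
      simp [cone_single]
    have h2 := congr($ih (Finsupp.single (Fin.tail w) 1))
    simp only [LinearMap.comp_apply, LinearMap.zero_apply] at h2
    simp [this, bd_cone, h2]

variable (β : ∀ k : ℕ, (Fin (k + 1) → P) → P)

/-- The subdivision operator on formal chains, `β` choosing the centres. -/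
def sd : ∀ k, TupleChain 𝔽 P k →ₗ[𝔽] TupleChain 𝔽 P k
  | 0 => LinearMap.id
  | k + 1 => Finsupp.linearCombination 𝔽 fun w =>
      cone 𝔽 (β (k + 1) w) k (sd k (bd 𝔽 k (Finsupp.single w 1)))

/-- The chain homotopy between the identity and the subdivision operator. -/
def sdH : ∀ k, TupleChain 𝔽 P k →ₗ[𝔽] TupleChain 𝔽 P (k + 1)
  | 0 => 0
  | k + 1 => Finsupp.linearCombination 𝔽 fun w =>
      cone 𝔽 (β (k + 1) w) (k + 1)
        (Finsupp.single w 1 - sdH k (bd 𝔽 k (Finsupp.single w 1)))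

lemma sd_single {k : ℕ} (w : Fin (k + 2) → P) : sd 𝔽 β (k + 1) (Finsupp.single w 1) =
    cone 𝔽 (β (k + 1) w) k (sd 𝔽 β k (bd 𝔽 k (Finsupp.single w 1))) := by
  simp [sd]

lemma sdH_single {k : ℕ} (w : Fin (k + 2) → P) : sdH 𝔽 β (k + 1) (Finsupp.single w 1) =
    cone 𝔽 (β (k + 1) w) (k + 1)
        (Finsupp.single w 1 - sdH 𝔽 β k (bd 𝔽 k (Finsupp.single w 1))) := by
  simp [sdH]

/-- The boundary of the cone over the subdivided boundary is that subdivided boundary minus a cone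
over its own boundary. The latter vanishes by induction and `bd_bd`, and in the lowest degree by
`aug_bd`. -/
lemma bd_sd {k : ℕ} (c : TupleChain 𝔽 P (k + 1)) :
    bd 𝔽 k (sd 𝔽 β (k + 1) c) = sd 𝔽 β k (bd 𝔽 k c) := by
  suffices h : bd 𝔽 k ∘ₗ sd 𝔽 β (k + 1) = sd 𝔽 β k ∘ₗ bd 𝔽 k from congr($h c)
  clear c
  induction k with
  | zero =>
    refine Finsupp.lhom_ext' fun w => LinearMap.ext_ring ?_
    simp only [LinearMap.comp_apply, Finsupp.lsingle_apply, sd_single, bd_cone_zero]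
    simp [sd, aug_bd]
  | succ k ih =>
    refine Finsupp.lhom_ext' fun w => LinearMap.ext_ring ?_
    have h2 := congr($ih (bd 𝔽 (k + 1) (Finsupp.single w 1)))
    simp only [LinearMap.comp_apply] at h2
    simp only [LinearMap.comp_apply, Finsupp.lsingle_apply, sd_single, bd_cone]
    simp [h2, bd_bd]

/-- With `S`, `H` for subdivision and homotopy, `H w` is the cone over `w - H ∂w`. By induction the
boundary of `w - H ∂w` is `S ∂w`, and the cone over this is `S w`. -/
lemma bd_sdH {k : ℕ} (c : TupleChain 𝔽 P (k + 1)) :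
    bd 𝔽 (k + 1) (sdH 𝔽 β (k + 1) c) =
      c - sd 𝔽 β (k + 1) c - sdH 𝔽 β k (bd 𝔽 k c) := by
  suffices h : bd 𝔽 (k + 1) ∘ₗ sdH 𝔽 β (k + 1) =
      LinearMap.id - sd 𝔽 β (k + 1) - sdH 𝔽 β k ∘ₗ bd 𝔽 k from congr($h c)
  clear c
  induction k with
  | zero =>
    refine Finsupp.lhom_ext' fun w => LinearMap.ext_ring ?_
    simp only [LinearMap.comp_apply, Finsupp.lsingle_apply, sdH_single, bd_cone, LinearMap.sub_apply,
      sd_single, LinearMap.id_apply]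
    simp [sd, sdH]
  | succ k ih =>
    refine Finsupp.lhom_ext' fun w => LinearMap.ext_ring ?_
    have h2 := congr($ih (bd 𝔽 (k + 1) (Finsupp.single w 1)))
    simp only [LinearMap.comp_apply, LinearMap.sub_apply, LinearMap.id_apply, bd_bd, map_zero,
      sub_zero] at h2
    simp only [LinearMap.comp_apply, Finsupp.lsingle_apply, sdH_single, bd_cone, LinearMap.sub_apply,
      sd_single, LinearMap.id_apply, map_sub, h2]
    abel

section Naturality

variable {𝔽}

/-- The map of formal chains induced by a map of points. -/
def push (g : P → Q) (k : ℕ) : TupleChain 𝔽 P k →ₗ[𝔽] TupleChain 𝔽 Q k :=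
  Finsupp.lmapDomain 𝔽 𝔽 (fun w => g ∘ w)

lemma push_single (g : P → Q) {k : ℕ} (w : Fin (k + 1) → P) :
    push (𝔽 := 𝔽) g k (Finsupp.single w 1) = Finsupp.single (g ∘ w) 1 := by
  simp [push]

lemma push_bd (g : P → Q) {k : ℕ} (c : TupleChain 𝔽 P (k + 1)) :
    push g k (bd 𝔽 k c) = bd 𝔽 k (push g (k + 1) c) := by
  suffices h : push g k ∘ₗ bd 𝔽 k = bd 𝔽 k ∘ₗ push g (k + 1) from congr($h c)
  refine Finsupp.lhom_ext' fun w => LinearMap.ext_ring ?_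
  simp only [LinearMap.comp_apply, Finsupp.lsingle_apply, push_single, bd_single, map_sum,
    map_zsmul, Function.comp_assoc]

lemma push_cone (g : P → Q) (b : P) {k : ℕ} (c : TupleChain 𝔽 P k) :
    push g (k + 1) (cone 𝔽 b k c) = cone 𝔽 (g b) k (push g k c) := by
  suffices h : push g (k + 1) ∘ₗ cone 𝔽 b k = cone 𝔽 (g b) k ∘ₗ push g k from congr($h c)
  refine Finsupp.lhom_ext' fun w => LinearMap.ext_ring ?_
  simp only [LinearMap.comp_apply, Finsupp.lsingle_apply, cone_single, push_single]
  congr 1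
  funext j
  refine Fin.cases ?_ (fun j => ?_) j <;> simp

variable {β} {β' : ∀ k : ℕ, (Fin (k + 1) → Q) → Q} {g : P → Q}

/-- This will be applied to affine maps of simplices, which preserve barycentres. -/
lemma push_sd (hg : ∀ k w, g (β k w) = β' k (g ∘ w)) {k : ℕ} (c : TupleChain 𝔽 P k) :
    push g k (sd 𝔽 β k c) = sd 𝔽 β' k (push g k c) := by
  suffices h : push g k ∘ₗ sd 𝔽 β k = sd 𝔽 β' k ∘ₗ push g k from congr($h c)
  clear c
  induction k with
  | zero => rfl
  | succ k ih =>
    refine Finsupp.lhom_ext' fun w => LinearMap.ext_ring ?_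
    have h2 := congr($ih (bd 𝔽 k (Finsupp.single w 1)))
    simp only [LinearMap.comp_apply] at h2
    simp only [LinearMap.comp_apply, Finsupp.lsingle_apply, sd_single, push_cone, h2, push_bd,
      push_single, hg]

lemma push_sdH (hg : ∀ k w, g (β k w) = β' k (g ∘ w)) {k : ℕ} (c : TupleChain 𝔽 P k) :
    push g (k + 1) (sdH 𝔽 β k c) = sdH 𝔽 β' k (push g k c) := by
  suffices h : push g (k + 1) ∘ₗ sdH 𝔽 β k = sdH 𝔽 β' k ∘ₗ push g k from congr($h c)
  clear c
  induction k with
  | zero => simp [sdH]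
  | succ k ih =>
    refine Finsupp.lhom_ext' fun w => LinearMap.ext_ring ?_
    have h2 := congr($ih (bd 𝔽 k (Finsupp.single w 1)))
    simp only [LinearMap.comp_apply] at h2
    simp only [LinearMap.comp_apply, Finsupp.lsingle_apply, sdH_single, push_cone, map_sub, h2,
      push_bd, push_single, hg]

end Naturality

section Support

variable {𝔽}

lemma map_supported {V : Type*} [AddCommGroup V] [Module 𝔽 V] {k : ℕ}
    (L : TupleChain 𝔽 P k →ₗ[𝔽] V) {s : Set (Fin (k + 1) → P)} {W : Submodule 𝔽 V}
    (h : ∀ w ∈ s, L (Finsupp.single w 1) ∈ W) {c : TupleChain 𝔽 P k}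
    (hc : c ∈ Finsupp.supported 𝔽 𝔽 s) : L c ∈ W := by
  rw [Finsupp.supported_eq_span_single] at hc
  have : Submodule.span 𝔽 ((fun i => Finsupp.single i (1 : 𝔽)) '' s) ≤ W.comap L := by
    rw [Submodule.span_le]
    rintro _ ⟨w, hw, rfl⟩
    exact h w hw
  exact this hc

lemma bd_supported {k : ℕ} {s : Set (Fin (k + 2) → P)} {s' : Set (Fin (k + 1) → P)}
    (h : ∀ w ∈ s, ∀ i : Fin (k + 2), w ∘ i.succAbove ∈ s') {c : TupleChain 𝔽 P (k + 1)}
    (hc : c ∈ Finsupp.supported 𝔽 𝔽 s) : bd 𝔽 k c ∈ Finsupp.supported 𝔽 𝔽 s' := by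
  refine map_supported _ (fun w hw => ?_) hc
  rw [bd_single]
  exact Submodule.sum_mem _ fun i _ => zsmul_mem (Finsupp.single_mem_supported 𝔽 1 (h w hw i)) _

lemma bd_supported_forall {k : ℕ} {B : Set P} {c : TupleChain 𝔽 P (k + 1)}
    (hc : c ∈ Finsupp.supported 𝔽 𝔽 {w | ∀ j, w j ∈ B}) :
    bd 𝔽 k c ∈ Finsupp.supported 𝔽 𝔽 {w | ∀ j, w j ∈ B} :=
  bd_supported (s := {w | ∀ j, w j ∈ B}) (s' := {w | ∀ j, w j ∈ B})
    (fun _ hw _ _ => hw _) hc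

lemma cone_supported {k : ℕ} {b : P} {s : Set (Fin (k + 1) → P)} {s' : Set (Fin (k + 2) → P)}
    (h : ∀ w ∈ s, (Fin.cons b w : Fin (k + 2) → P) ∈ s') {c : TupleChain 𝔽 P k}
    (hc : c ∈ Finsupp.supported 𝔽 𝔽 s) : cone 𝔽 b k c ∈ Finsupp.supported 𝔽 𝔽 s' := by
  refine map_supported _ (fun w hw => ?_) hc
  rw [cone_single]
  exact Finsupp.single_mem_supported 𝔽 1 (h w hw)

variable {β}

/-- In the shrinking estimate `B` is a ball about the centre of the simplex being subdivided. -/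
lemma sd_supported {B : Set P} (hB : ∀ k w, (∀ j, w j ∈ B) → β k w ∈ B) {k : ℕ}
    {c : TupleChain 𝔽 P k} (hc : c ∈ Finsupp.supported 𝔽 𝔽 {w | ∀ j, w j ∈ B}) :
    sd 𝔽 β k c ∈ Finsupp.supported 𝔽 𝔽 {w | ∀ j, w j ∈ B} := by
  induction k with
  | zero => exact hc
  | succ k ih =>
    refine map_supported _ (fun w hw => ?_) hc
    rw [sd_single]
    refine cone_supported (fun u hu => ?_) (ih (bd_supported_forall
      (Finsupp.single_mem_supported 𝔽 1 hw)))
    refine Fin.cases ?_ fun j => ?_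
    · simpa using hB _ _ hw
    · simpa using hu j

/-- The subdivision operator shrinks tuples, if the centres `β` are barycentre-like. -/
lemma sd_shrink [PseudoMetricSpace P]
    (hβ : ∀ k (w : Fin (k + 1) → P) (z : P) (r : ℝ), (∀ j, dist (w j) z ≤ r) → dist (β k w) z ≤ r)
    (hβ' : ∀ k (w : Fin (k + 1) → P) (D : ℝ), (∀ i j, dist (w i) (w j) ≤ D) →
      ∀ j, dist (w j) (β k w) ≤ (k / (k + 1) : ℝ) * D) {k : ℕ} {D : ℝ}
    {c : TupleChain 𝔽 P k} (hc : c ∈ Finsupp.supported 𝔽 𝔽 {w | ∀ i j, dist (w i) (w j) ≤ D}) :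
    sd 𝔽 β k c ∈ Finsupp.supported 𝔽 𝔽 {w | ∀ i j, dist (w i) (w j) ≤ (k / (k + 1) : ℝ) * D} := by
  induction k with
  | zero =>
    refine map_supported _ (fun w hw => Finsupp.single_mem_supported 𝔽 1 fun i j => ?_) hc
    rw [show i = j from Fin.ext (by omega)]; simp
  | succ k ih =>
    refine map_supported _ (fun v hv => ?_) hc
    have hD : 0 ≤ D := dist_nonneg.trans (hv 0 0)
    rw [sd_single]
    -- A tuple of the subdivision of `v` is the centre of `v` followed by a tuple from the
    -- subdivided boundary. Distances inside the latter are controlled by induction (`h1`), and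
    -- those to the centre by the ball around it (`h2`). The factor `k / (k + 1)` grows with `k`, so
    -- the bound for the top degree suffices.
    have h1 := ih (bd_supported (s := {w | ∀ i j, dist (w i) (w j) ≤ D})
      (s' := {w | ∀ i j, dist (w i) (w j) ≤ D}) (fun w hw i j l => hw _ _)
      (Finsupp.single_mem_supported 𝔽 1 hv))
    have h2 := sd_supported (𝔽 := 𝔽) (β := β) (k := k)
      (B := {x | dist x (β (k + 1) v) ≤ ((k + 1 : ℕ) / ((k + 1 : ℕ) + 1) : ℝ) * D})
      (fun k w h => hβ _ _ _ _ h) (bd_supported_forall (Finsupp.single_mem_supported 𝔽 1 (hβ' (k + 1) v D hv)))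
    have h3 := Submodule.mem_inf.2 ⟨h1, h2⟩
    rw [← Finsupp.supported_inter] at h3
    refine cone_supported (fun u hu i j => ?_) h3
    have hmono : (k / (k + 1) : ℝ) * D ≤ ((k + 1 : ℕ) / ((k + 1 : ℕ) + 1) : ℝ) * D := by
      refine mul_le_mul_of_nonneg_right ?_ hD
      push_cast
      rw [div_le_div_iff₀ (by positivity) (by positivity)]
      nlinarith
    refine Fin.cases ?_ (fun i => ?_) i <;> refine Fin.cases ?_ (fun j => ?_) j
    · simp only [Fin.cons_zero, dist_self]; positivity
    · simpa [dist_comm] using hu.2 j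
    · simpa using hu.2 i
    · simpa using (hu.1 i j).trans hmono

end Support

end TupleChain

end Tuples

end

noncomputable section

/-! ### Subdivision of singular chains -/

section Affine

/-- The affine map of standard simplices with prescribed values at the vertices. -/
def affSimp {k n : ℕ} (w : Fin (k + 1) → stdSimplex ℝ (Fin (n + 1))) :
    C(stdSimplex ℝ (Fin (k + 1)), stdSimplex ℝ (Fin (n + 1))) where
  toFun t := ⟨∑ i, t.1 i • (w i).1, (convex_stdSimplex ℝ _).sum_mem (fun i _ => t.2.1 i) t.2.2
    fun i _ => (w i).2⟩
  continuous_toFun := by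
    refine Continuous.subtype_mk ?_ _
    refine continuous_finsetSum _ fun i _ => ?_
    exact ((continuous_apply i).comp continuous_subtype_val).smul continuous_const

lemma affSimp_coe {k n : ℕ} (w : Fin (k + 1) → stdSimplex ℝ (Fin (n + 1))) (t) :
    (affSimp w t).1 = ∑ i, t.1 i • (w i).1 := rfl

/-- The vertices of the standard simplex. -/
def vtx (n : ℕ) (i : Fin (n + 1)) : stdSimplex ℝ (Fin (n + 1)) :=
  ⟨Pi.single i 1, single_mem_stdSimplex ℝ i⟩

lemma affSimp_vtx {k n : ℕ} (w : Fin (k + 1) → stdSimplex ℝ (Fin (n + 1))) (i) :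
    affSimp w (vtx k i) = w i := by
  apply Subtype.ext
  rw [affSimp_coe]
  simp [vtx, Pi.single_apply, ite_smul]

lemma affSimp_affSimp {k n m : ℕ} (w : Fin (k + 1) → stdSimplex ℝ (Fin (n + 1)))
    (u : Fin (m + 1) → stdSimplex ℝ (Fin (k + 1))) (t) :
    affSimp w (affSimp u t) = affSimp (fun i => affSimp w (u i)) t := by
  apply Subtype.ext
  simp only [affSimp_coe, Finset.sum_apply, Pi.smul_apply, smul_eq_mul, Finset.sum_smul,
    Finset.smul_sum, mul_smul]
  rw [Finset.sum_comm]

lemma affSimp_comp {k n m : ℕ} (w : Fin (k + 1) → stdSimplex ℝ (Fin (n + 1)))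
    (u : Fin (m + 1) → stdSimplex ℝ (Fin (k + 1))) :
    (affSimp w).comp (affSimp u) = affSimp (affSimp w ∘ u) :=
  ContinuousMap.ext fun t => affSimp_affSimp w u t

lemma affSimp_vtx_eq_id (n : ℕ) : affSimp (vtx n) = ContinuousMap.id _ := by
  ext t j
  change (affSimp (vtx n) t).1 j = t.1 j
  rw [affSimp_coe]
  simp [vtx, Pi.single_apply]

lemma faceMap_eq {n : ℕ} (i : Fin (n + 2)) : faceMap i = affSimp (vtx (n + 1) ∘ i.succAbove) := by
  ext t j
  change (stdSimplex.map i.succAbove t).1 j = (affSimp (vtx (n + 1) ∘ i.succAbove) t).1 j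
  rw [affSimp_coe]
  have : (stdSimplex.map i.succAbove t).1 = FunOnFinite.linearMap ℝ ℝ i.succAbove t.1 := rfl
  rw [this, FunOnFinite.linearMap_apply_apply]
  simp [vtx, Pi.single_apply, Finset.sum_filter, eq_comm]

/-- The barycentre of a tuple of points. -/
def bary {n : ℕ} (k : ℕ) (w : Fin (k + 1) → stdSimplex ℝ (Fin (n + 1))) :
    stdSimplex ℝ (Fin (n + 1)) := affSimp w stdSimplex.barycenter

lemma affSimp_bary {m n : ℕ} (g : Fin (m + 1) → stdSimplex ℝ (Fin (n + 1))) (k : ℕ)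
    (w : Fin (k + 1) → stdSimplex ℝ (Fin (m + 1))) :
    affSimp g (bary k w) = bary k (affSimp g ∘ w) := affSimp_affSimp _ _ _

lemma dist_affSimp_le {k n : ℕ} {w : Fin (k + 1) → stdSimplex ℝ (Fin (n + 1))}
    {z : stdSimplex ℝ (Fin (n + 1))} {r : ℝ} (h : ∀ j, dist (w j) z ≤ r) (t) :
    dist (affSimp w t) z ≤ r := by
  have := (convex_closedBall z.1 r).sum_mem (fun i _ => t.2.1 i) t.2.2 (t := Finset.univ)
    (z := fun i => (w i).1) (fun i _ => h i)
  exact this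

/-- The vector from the barycentre to a vertex is the mean of the `k + 1` vectors to it from all
vertices. One of these is zero, which yields the contraction factor `k / (k + 1) < 1`. -/
lemma dist_bary_le {n : ℕ} (k : ℕ) (w : Fin (k + 1) → stdSimplex ℝ (Fin (n + 1))) (D : ℝ)
    (h : ∀ i j, dist (w i) (w j) ≤ D) (j) :
    dist (w j) (bary k w) ≤ (k / (k + 1) : ℝ) * D := by
  have e : (w j).1 - (bary k w).1 = ∑ i, (1 / (k + 1) : ℝ) • ((w j).1 - (w i).1) := by
    rw [bary, affSimp_coe]
    simp only [smul_sub, Finset.sum_sub_distrib]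
    congr 1
    · rw [Finset.sum_const, Finset.card_univ, Fintype.card_fin, ← Nat.cast_smul_eq_nsmul ℝ, smul_smul]
      rw [show ((k + 1 : ℕ) : ℝ) * (1 / (k + 1)) = 1 by push_cast; field_simp, one_smul]
    · refine Finset.sum_congr rfl fun i _ => ?_
      congr 1
      exact (stdSimplex.barycenter_apply (𝕜 := ℝ) i).trans (by simp)
  have h1 : dist (w j) (bary k w) = ‖(w j).1 - (bary k w).1‖ := by
    rw [Subtype.dist_eq, dist_eq_norm]
  rw [h1, e, ← Finset.add_sum_erase _ _ (Finset.mem_univ j), sub_self, smul_zero, zero_add]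
  refine (norm_sum_le _ _).trans ?_
  refine (Finset.sum_le_card_nsmul _ _ ((1 / (k + 1) : ℝ) * D) fun i _ => ?_).trans ?_
  · rw [norm_smul, Real.norm_of_nonneg (by positivity)]
    refine mul_le_mul_of_nonneg_left ?_ (by positivity)
    have := h j i
    rwa [Subtype.dist_eq, dist_eq_norm] at this
  · rw [Finset.card_erase_of_mem (Finset.mem_univ j), Finset.card_univ, Fintype.card_fin,
      Nat.add_sub_cancel, nsmul_eq_mul]
    apply le_of_eq; ring

end Affine

section Subdivision

variable (𝔽 : Type u) [Field 𝔽] {X Y : Type u} [TopologicalSpace X] [TopologicalSpace Y]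

open TupleChain

/-- The singular chain given by a simplex `s` and a formal chain of tuples in its domain. -/
def realize {n : ℕ} (s : Simp X n) (k : ℕ) :
    TupleChain 𝔽 (stdSimplex ℝ (Fin (n + 1))) k →ₗ[𝔽] (singC 𝔽 X).X k :=
  Finsupp.linearCombination 𝔽 fun w => chB 𝔽 X k (s.comp (affSimp w))

variable {𝔽}

lemma realize_single {n : ℕ} (s : Simp X n) {k : ℕ}
    (w : Fin (k + 1) → stdSimplex ℝ (Fin (n + 1))) :
    realize 𝔽 s k (Finsupp.single w 1) = chB 𝔽 X k (s.comp (affSimp w)) := by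
  simp [realize]

lemma realize_vtx {n : ℕ} (s : Simp X n) :
    realize 𝔽 s n (Finsupp.single (vtx n) 1) = chB 𝔽 X n s := by
  rw [realize_single, affSimp_vtx_eq_id, ContinuousMap.comp_id]

lemma d_realize {n : ℕ} (s : Simp X n) {k : ℕ}
    (c : TupleChain 𝔽 (stdSimplex ℝ (Fin (n + 1))) (k + 1)) :
    ((singC 𝔽 X).d (k + 1) k).hom (realize 𝔽 s (k + 1) c) = realize 𝔽 s k (bd 𝔽 k c) := by
  suffices h : ((singC 𝔽 X).d (k + 1) k).hom ∘ₗ realize 𝔽 s (k + 1) = realize 𝔽 s k ∘ₗ bd 𝔽 k from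
    congr($h c)
  refine Finsupp.lhom_ext' fun w => LinearMap.ext_ring ?_
  simp only [LinearMap.comp_apply, Finsupp.lsingle_apply, realize_single, bd_single, map_sum,
    map_zsmul, chB_d]
  refine Finset.sum_congr rfl fun i _ => ?_
  rw [ContinuousMap.comp_assoc, faceMap_eq, affSimp_comp]
  congr 4
  funext j
  exact affSimp_vtx _ _

lemma realize_push {n m : ℕ} (s : Simp X n) (g : Fin (m + 1) → stdSimplex ℝ (Fin (n + 1))) {k : ℕ}
    (c : TupleChain 𝔽 (stdSimplex ℝ (Fin (m + 1))) k) :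
    realize 𝔽 s k (push (affSimp g) k c) = realize 𝔽 (s.comp (affSimp g)) k c := by
  suffices h : realize 𝔽 s k ∘ₗ push (affSimp g) k = realize 𝔽 (s.comp (affSimp g)) k from
    congr($h c)
  refine Finsupp.lhom_ext' fun w => LinearMap.ext_ring ?_
  simp only [LinearMap.comp_apply, Finsupp.lsingle_apply, realize_single, push_single,
    ContinuousMap.comp_assoc, affSimp_comp]

variable (𝔽 X)

/-- Barycentric subdivision of singular chains. -/
def singSd (k : ℕ) : (singC 𝔽 X).X k →ₗ[𝔽] (singC 𝔽 X).X k :=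
  (chB 𝔽 X k).constr 𝔽 fun s => realize 𝔽 s k (sd 𝔽 bary k (Finsupp.single (vtx k) 1))

/-- The chain homotopy between the identity and barycentric subdivision. -/
def singSdH (k : ℕ) : (singC 𝔽 X).X k →ₗ[𝔽] (singC 𝔽 X).X (k + 1) :=
  (chB 𝔽 X k).constr 𝔽 fun s => realize 𝔽 s (k + 1) (sdH 𝔽 bary k (Finsupp.single (vtx k) 1))

variable {𝔽 X}

/-- `singSd` is defined through the tuple of vertices of the standard simplex only. By naturality it
acts on every realized formal chain as formal subdivision, so that the identities for singular
chains follow from those for tuples. -/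
lemma singSd_realize {n : ℕ} (s : Simp X n) {k : ℕ}
    (c : TupleChain 𝔽 (stdSimplex ℝ (Fin (n + 1))) k) :
    singSd 𝔽 X k (realize 𝔽 s k c) = realize 𝔽 s k (sd 𝔽 bary k c) := by
  suffices h : singSd 𝔽 X k ∘ₗ realize 𝔽 s k = realize 𝔽 s k ∘ₗ sd 𝔽 bary k from congr($h c)
  refine Finsupp.lhom_ext' fun w => LinearMap.ext_ring ?_
  simp only [LinearMap.comp_apply, Finsupp.lsingle_apply, realize_single, singSd,
    Module.Basis.constr_basis]
  rw [← realize_push, push_sd (β' := bary) (fun k w => affSimp_bary _ _ _), push_single]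
  congr 3
  funext j
  exact affSimp_vtx _ _

lemma singSdH_realize {n : ℕ} (s : Simp X n) {k : ℕ}
    (c : TupleChain 𝔽 (stdSimplex ℝ (Fin (n + 1))) k) :
    singSdH 𝔽 X k (realize 𝔽 s k c) = realize 𝔽 s (k + 1) (sdH 𝔽 bary k c) := by
  suffices h : singSdH 𝔽 X k ∘ₗ realize 𝔽 s k = realize 𝔽 s (k + 1) ∘ₗ sdH 𝔽 bary k from
    congr($h c)
  refine Finsupp.lhom_ext' fun w => LinearMap.ext_ring ?_
  simp only [LinearMap.comp_apply, Finsupp.lsingle_apply, realize_single, singSdH,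
    Module.Basis.constr_basis]
  rw [← realize_push, push_sdH (β' := bary) (fun k w => affSimp_bary _ _ _), push_single]
  congr 3
  funext j
  exact affSimp_vtx _ _

lemma d_singSd {k : ℕ} (c : (singC 𝔽 X).X (k + 1)) :
    ((singC 𝔽 X).d (k + 1) k).hom (singSd 𝔽 X (k + 1) c) =
      singSd 𝔽 X k (((singC 𝔽 X).d (k + 1) k).hom c) := by
  suffices h : ((singC 𝔽 X).d (k + 1) k).hom ∘ₗ singSd 𝔽 X (k + 1) =
      singSd 𝔽 X k ∘ₗ ((singC 𝔽 X).d (k + 1) k).hom from congr($h c)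
  refine (chB 𝔽 X (k + 1)).ext fun s => ?_
  simp only [LinearMap.comp_apply]
  rw [← realize_vtx, singSd_realize, d_realize, bd_sd, d_realize, singSd_realize]

lemma d_singSdH {k : ℕ} (c : (singC 𝔽 X).X (k + 1)) :
    ((singC 𝔽 X).d (k + 2) (k + 1)).hom (singSdH 𝔽 X (k + 1) c) =
      c - singSd 𝔽 X (k + 1) c - singSdH 𝔽 X k (((singC 𝔽 X).d (k + 1) k).hom c) := by
  suffices h : ((singC 𝔽 X).d (k + 2) (k + 1)).hom ∘ₗ singSdH 𝔽 X (k + 1) =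
      LinearMap.id - singSd 𝔽 X (k + 1) -
        singSdH 𝔽 X k ∘ₗ ((singC 𝔽 X).d (k + 1) k).hom from congr($h c)
  refine (chB 𝔽 X (k + 1)).ext fun s => ?_
  simp only [LinearMap.comp_apply, LinearMap.sub_apply, LinearMap.id_apply]
  rw [← realize_vtx, singSd_realize, singSdH_realize, d_realize, bd_sdH, d_realize,
    singSdH_realize, map_sub, map_sub]

end Subdivision

/-! ### Subdividing chains until all their simplices are small -/

section Small

variable (𝔽 : Type u) [Field 𝔽] {X : Type u} [TopologicalSpace X]

open TupleChain

/-- The span of the simplices satisfying `G`. -/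
def goodChains (G : ∀ n, Simp X n → Prop) (n : ℕ) : Submodule 𝔽 ((singC 𝔽 X).X n) :=
  Submodule.span 𝔽 (chB 𝔽 X n '' {s | G n s})

variable {𝔽} {G : ∀ n, Simp X n → Prop}

lemma chB_mem_goodChains {n : ℕ} {s : Simp X n} (h : G n s) : chB 𝔽 X n s ∈ goodChains 𝔽 G n :=
  Submodule.subset_span ⟨s, h, rfl⟩

lemma goodChains_map {n : ℕ} {V : Type*} [AddCommGroup V] [Module 𝔽 V]
    {L : (singC 𝔽 X).X n →ₗ[𝔽] V} {W : Submodule 𝔽 V} (h : ∀ s, G n s → L (chB 𝔽 X n s) ∈ W)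
    {c} (hc : c ∈ goodChains 𝔽 G n) : L c ∈ W := by
  have : goodChains 𝔽 G n ≤ W.comap L := by
    rw [goodChains, Submodule.span_le]
    rintro _ ⟨s, hs, rfl⟩
    exact h s hs
  exact this hc

variable (hG : ∀ n m (s : Simp X n) (φ : C(stdSimplex ℝ (Fin (m + 1)), stdSimplex ℝ (Fin (n + 1)))),
  G n s → G m (s.comp φ))

include hG in
lemma realize_mem_goodChains {n : ℕ} {s : Simp X n} (hs : G n s) {k : ℕ}
    (c : TupleChain 𝔽 (stdSimplex ℝ (Fin (n + 1))) k) : realize 𝔽 s k c ∈ goodChains 𝔽 G k := by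
  rw [realize, Finsupp.linearCombination_apply]
  exact Submodule.sum_mem _ fun w _ => Submodule.smul_mem _ _ (chB_mem_goodChains (hG _ _ _ _ hs))

include hG in
lemma singSd_mem_goodChains {n : ℕ} {c} (hc : c ∈ goodChains 𝔽 G n) :
    singSd 𝔽 X n c ∈ goodChains 𝔽 G n := by
  refine goodChains_map (fun s hs => ?_) hc
  rw [← realize_vtx, singSd_realize]
  exact realize_mem_goodChains hG hs _

include hG in
lemma singSdH_mem_goodChains {n : ℕ} {c} (hc : c ∈ goodChains 𝔽 G n) :
    singSdH 𝔽 X n c ∈ goodChains 𝔽 G (n + 1) := by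
  refine goodChains_map (fun s hs => ?_) hc
  rw [← realize_vtx, singSdH_realize]
  exact realize_mem_goodChains hG hs _

variable (hsmall : ∀ n (s : Simp X n), ∃ δ > 0, ∀ k (w : Fin (k + 1) → stdSimplex ℝ (Fin (n + 1))),
  (∀ i j, dist (w i) (w j) ≤ δ) → G k (s.comp (affSimp w)))

lemma sd_iterate_shrink {n k : ℕ} {D : ℝ} {c : TupleChain 𝔽 (stdSimplex ℝ (Fin (n + 1))) k}
    (hc : c ∈ Finsupp.supported 𝔽 𝔽 {w | ∀ i j, dist (w i) (w j) ≤ D}) (m : ℕ) :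
    (sd 𝔽 bary k)^[m] c ∈
      Finsupp.supported 𝔽 𝔽 {w | ∀ i j, dist (w i) (w j) ≤ (k / (k + 1) : ℝ) ^ m * D} := by
  induction m with
  | zero => simpa using hc
  | succ m ih =>
    rw [Function.iterate_succ_apply', pow_succ', mul_assoc]
    exact sd_shrink (fun k w z r h => dist_affSimp_le h _) dist_bary_le ih

include hG hsmall in
-- For a single simplex the tuples of the `m`-th subdivision have diameter at most `(n / (n + 1)) ^
-- m * D`, which tends to zero. For a sum the larger number of subdivisions works for both terms,
-- since subdividing a good chain keeps it good.
lemma exists_iterate_singSd_mem (n : ℕ) (c : (singC 𝔽 X).X n) :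
    ∃ m, (singSd 𝔽 X n)^[m] c ∈ goodChains 𝔽 G n := by
  have mono : ∀ c m m', m ≤ m' → (singSd 𝔽 X n)^[m] c ∈ goodChains 𝔽 G n →
      (singSd 𝔽 X n)^[m'] c ∈ goodChains 𝔽 G n := by
    intro c m m' h hm
    induction h with
    | refl => exact hm
    | step h ih =>
      rw [Function.iterate_succ_apply']
      exact singSd_mem_goodChains hG ih
  have hpow : ∀ m, ∃ L : (singC 𝔽 X).X n →ₗ[𝔽] (singC 𝔽 X).X n, ∀ c,
      (singSd 𝔽 X n)^[m] c = L c := fun m => ⟨(singSd 𝔽 X n) ^ m, fun c => by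
        rw [Module.End.pow_apply]⟩
  have hc : c ∈ Submodule.span 𝔽 (Set.range (chB 𝔽 X n)) := by
    rw [(chB 𝔽 X n).span_eq]; trivial
  induction hc using Submodule.span_induction with
  | mem x hx =>
    obtain ⟨s, rfl⟩ := hx
    obtain ⟨δ, hδ, hs⟩ := hsmall n s
    have hlt : (n / (n + 1) : ℝ) < 1 := by rw [div_lt_one (by positivity)]; linarith
    obtain ⟨D, hD⟩ : ∃ D : ℝ, ∀ i j, dist (vtx n i) (vtx n j) ≤ D :=
      ⟨Metric.diam (Set.univ : Set (stdSimplex ℝ (Fin (n + 1)))), fun i j =>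
        Metric.dist_le_diam_of_mem isCompact_univ.isBounded trivial trivial⟩
    have hlim : Filter.Tendsto (fun m => (n / (n + 1) : ℝ) ^ m * D) Filter.atTop (𝓝 0) := by
      simpa using (tendsto_pow_atTop_nhds_zero_of_lt_one (by positivity) hlt).mul_const D
    obtain ⟨m, hm⟩ := (hlim.eventually (ge_mem_nhds hδ)).exists
    refine ⟨m, ?_⟩
    have key : ∀ m c, (singSd 𝔽 X n)^[m] (realize 𝔽 s n c) =
        realize 𝔽 s n ((sd 𝔽 bary n)^[m] c) := by
      intro m
      induction m with
      | zero => intro c; rfl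
      | succ m ih =>
        intro c
        rw [Function.iterate_succ_apply, Function.iterate_succ_apply, singSd_realize, ih]
    rw [← realize_vtx, key]
    refine map_supported _ (fun w hw => ?_)
      (sd_iterate_shrink (Finsupp.single_mem_supported 𝔽 1 hD) m)
    rw [realize_single]
    exact chB_mem_goodChains (hs n w fun i j => (hw i j).trans hm)
  | zero => exact ⟨0, Submodule.zero_mem _⟩
  | add x y _ _ hx hy =>
    obtain ⟨m, hm⟩ := hx
    obtain ⟨m', hm'⟩ := hy
    refine ⟨max m m', ?_⟩
    obtain ⟨L, hL⟩ := hpow (max m m')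
    have h1 := mono x _ _ (le_max_left m m') hm
    have h2 := mono y _ _ (le_max_right m m') hm'
    rw [hL] at *
    rw [map_add]
    exact Submodule.add_mem _ h1 h2
  | smul a x _ hx =>
    obtain ⟨m, hm⟩ := hx
    obtain ⟨L, hL⟩ := hpow m
    refine ⟨m, ?_⟩
    rw [hL] at *
    rw [map_smul]
    exact Submodule.smul_mem _ _ hm

include hG hsmall in
/-- Chains with small boundary are homologous to small chains. -/
lemma exists_sub_d_mem_goodChains (n : ℕ) (z : (singC 𝔽 X).X (n + 1))
    (hz : ((singC 𝔽 X).d (n + 1) n).hom z ∈ goodChains 𝔽 G n) :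
    ∃ y, z - ((singC 𝔽 X).d (n + 2) (n + 1)).hom y ∈ goodChains 𝔽 G (n + 1) := by
  obtain ⟨m, hm⟩ := exists_iterate_singSd_mem hG hsmall (n + 1) z
  induction m generalizing z with
  | zero => exact ⟨0, by simpa using hm⟩
  | succ m ih =>
    -- One subdivision can be traded for a boundary: `z` minus its subdivision is the boundary of
    -- `singSdH z` plus `singSdH` of the boundary of `z`, and the last chain is good because the
    -- boundary of `z` is.
    obtain ⟨y, hy⟩ := ih (singSd 𝔽 X (n + 1) z)
      (by rw [d_singSd]; exact singSd_mem_goodChains hG hz) (by simpa using hm)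
    refine ⟨y + singSdH 𝔽 X (n + 1) z, ?_⟩
    rw [map_add, d_singSdH]
    have := Submodule.add_mem _ hy (singSdH_mem_goodChains hG hz)
    convert this using 1
    abel

include hsmall in
-- The vertex tuple of a 0-simplex has diameter zero, so it is small for any bound.
lemma goodChains_zero : goodChains 𝔽 G 0 = ⊤ := by
  rw [eq_top_iff, ← (chB 𝔽 X 0).span_eq]
  refine Submodule.span_le.2 ?_
  rintro _ ⟨s, rfl⟩
  obtain ⟨δ, hδ, hs⟩ := hsmall 0 s
  have := hs 0 (vtx 0) fun i j => by rw [show i = j from Fin.ext (by omega), dist_self]; exact hδ.le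
  rw [affSimp_vtx_eq_id, ContinuousMap.comp_id] at this
  exact chB_mem_goodChains this

end Small

end

noncomputable section

/-! ### Excision -/

section ChainComplexes

variable {R : Type u} [Ring R] {K L : ChainComplex (ModuleCat.{u} R) ℕ} (g : K ⟶ L)

/-- The short exact sequence of a monomorphism of complexes and its cokernel. -/
def cokerSeq : ShortComplex (ChainComplex (ModuleCat.{u} R) ℕ) :=
  ShortComplex.mk g (Limits.cokernel.π g) (Limits.cokernel.condition g)

lemma cokerSeq_shortExact [Mono g] : (cokerSeq g).ShortExact where
  exact := ShortComplex.exact_cokernel g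
  mono_f := by dsimp [cokerSeq]; infer_instance
  epi_g := by dsimp [cokerSeq]; infer_instance

lemma coker_π_surjective (n : ℕ) : Function.Surjective ((Limits.cokernel.π g).f n).hom := by
  rw [← ModuleCat.epi_iff_surjective]
  infer_instance

lemma coker_π_eq_zero_iff [Mono g] (n : ℕ) (x : L.X n) :
    ((Limits.cokernel.π g).f n).hom x = 0 ↔ ∃ y, (g.f n).hom y = x := by
  have h := (cokerSeq_shortExact g).map_of_exact (HomologicalComplex.eval _ _ n)
  have h2 := (ShortComplex.moduleCat_exact_iff _).1 h.exact
  refine ⟨fun hx => h2 x hx, ?_⟩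
  rintro ⟨y, rfl⟩
  exact congr($(Limits.cokernel.condition g).f n |>.hom y)

lemma isIso_homologyMap_of_acyclic_coker [Mono g]
    (h : ∀ n, (Limits.cokernel g).ExactAt n) (n : ℕ) :
    IsIso (HomologicalComplex.homologyMap g n) := by
  have hS := cokerSeq_shortExact g
  have e1 : Epi (HomologicalComplex.homologyMap g n) :=
    (hS.homology_exact₂ n).epi_f ((h n).isZero_homology.eq_of_tgt _ _)
  have e2 : Mono (HomologicalComplex.homologyMap g n) :=
    (hS.homology_exact₁ (n + 1) n rfl).mono_g ((h (n + 1)).isZero_homology.eq_of_src _ _)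
  exact isIso_of_mono_of_epi _

lemma exactAt_succ_of_forall (n : ℕ)
    (h : ∀ x : K.X (n + 1), (K.d (n + 1) n).hom x = 0 →
      ∃ y, (K.d (n + 2) (n + 1)).hom y = x) : K.ExactAt (n + 1) := by
  rw [HomologicalComplex.exactAt_iff' K (n + 2) (n + 1) n (by simp) (by simp)]
  exact (ShortComplex.moduleCat_exact_iff _).2 h

end ChainComplexes

/-! ### Relative chains and the excision map -/

section Relative

variable (𝔽 : Type u) [Field 𝔽] {X : Type u} [TopologicalSpace X]

/-- The inclusion of a subspace. -/
abbrev inclMap (A : Set X) : C(A, X) := ⟨((↑) : A → X), continuous_subtype_val⟩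

/-- The relative singular chain complex. -/
abbrev relC (X : Type u) [TopologicalSpace X] (A : Set X) : ChainComplex (ModuleCat.{u} 𝔽) ℕ :=
  Limits.cokernel (singMap 𝔽 (inclMap A))

/-- The projection onto the relative singular chain complex. -/
abbrev relπ (A : Set X) : singC 𝔽 X ⟶ relC 𝔽 X A :=
  Limits.cokernel.π (singMap 𝔽 (inclMap A))

instance mono_singMap_inclMap (A : Set X) : Mono (singMap 𝔽 (inclMap A)) := by
  have : Mono (TopCat.ofHom (inclMap A)) := by
    rw [TopCat.mono_iff_injective]
    exact Subtype.val_injective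
  infer_instance

variable {𝔽}

lemma range_singMap_incl (A : Set X) (n : ℕ) (x : (singC 𝔽 X).X n) :
    (∃ y, ((singMap 𝔽 (inclMap A)).f n).hom y = x) ↔
      x ∈ goodChains 𝔽 (fun _ s => ∀ t, s t ∈ A) n := by
  constructor
  · rintro ⟨y, rfl⟩
    have : y ∈ goodChains 𝔽 (fun _ _ => True) n := by
      simp [goodChains, (chB 𝔽 A n).span_eq]
    refine goodChains_map (fun s _ => ?_) this
    rw [chB_map]
    exact chB_mem_goodChains fun t => (s t).2
  · intro hx
    change x ∈ LinearMap.range ((singMap 𝔽 (inclMap A)).f n).hom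
    have : goodChains 𝔽 (fun _ s => ∀ t, s t ∈ A) n ≤
        LinearMap.range ((singMap 𝔽 (inclMap A)).f n).hom := by
      rw [goodChains, Submodule.span_le]
      rintro _ ⟨s, hs, rfl⟩
      refine ⟨chB 𝔽 A n ⟨fun t => ⟨s t, hs t⟩, by fun_prop⟩, ?_⟩
      rw [chB_map]
      rfl
    exact this hx

lemma relC_π_eq_zero_iff (A : Set X) (n : ℕ) (x : (singC 𝔽 X).X n) :
    ((relπ 𝔽 A).f n).hom x = 0 ↔
      x ∈ goodChains 𝔽 (fun _ s => ∀ t, s t ∈ A) n :=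
  (coker_π_eq_zero_iff _ n x).trans (range_singMap_incl A n x)

variable (𝔽) (U A : Set X)

/-- The restriction of the inclusion of `U` to the preimage of `A`. -/
abbrev exMap : C((Subtype.val ⁻¹' A : Set U), A) :=
  ⟨fun x => ⟨x.1.1, x.2⟩, by fun_prop⟩

lemma singMap_comp {X Y Z : Type u} [TopologicalSpace X] [TopologicalSpace Y] [TopologicalSpace Z]
    (g : C(X, Y)) (h : C(Y, Z)) : singMap 𝔽 g ≫ singMap 𝔽 h = singMap 𝔽 (h.comp g) :=
  (Functor.map_comp _ _ _).symm

/-- The excision chain map. -/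
def exciseMap : relC 𝔽 U (Subtype.val ⁻¹' A) ⟶ relC 𝔽 X A :=
  Limits.cokernel.map _ _ (singMap 𝔽 (exMap U A)) (singMap 𝔽 (inclMap U)) (by
    rw [singMap_comp, singMap_comp])

variable {𝔽}

lemma π_exciseMap : relπ 𝔽 (Subtype.val ⁻¹' A : Set U) ≫
    exciseMap 𝔽 U A = singMap 𝔽 (inclMap U) ≫ relπ 𝔽 A :=
  Limits.cokernel.π_desc _ _ _

lemma exciseMap_π (n : ℕ) (x : (singC 𝔽 U).X n) :
    ((exciseMap 𝔽 U A).f n).hom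
      (((relπ 𝔽 (Subtype.val ⁻¹' A : Set U)).f n).hom x) =
    ((relπ 𝔽 A).f n).hom
      (((singMap 𝔽 (inclMap U)).f n).hom x) :=
  congr(($(π_exciseMap U A).f n).hom x)

lemma goodChains_eq_supported (G : ∀ n, Simp X n → Prop) (n : ℕ) (x : (singC 𝔽 X).X n) :
    x ∈ goodChains 𝔽 G n ↔ ∀ s ∈ ((chB 𝔽 X n).repr x).support, G n s := by
  rw [goodChains, Module.Basis.mem_span_image]
  rfl

/-- Distinct simplices of `U` stay distinct in `X`, so no coefficients merge or cancel under the
inclusion. This is the injectivity of the excision map on chains. -/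
lemma mem_goodChains_of_map {x : (singC 𝔽 U).X n}
    (h : ((singMap 𝔽 (inclMap U)).f n).hom x ∈ goodChains 𝔽 (fun _ s => ∀ t, s t ∈ A) n) :
    x ∈ goodChains 𝔽 (fun _ s => ∀ t, s t ∈ (Subtype.val ⁻¹' A : Set U)) n := by
  have inj : Function.Injective (fun s : Simp U n => (inclMap U).comp s) := fun s s' h =>
    ContinuousMap.ext fun t => Subtype.ext congr($h t)
  have hr : (chB 𝔽 X n).repr (((singMap 𝔽 (inclMap U)).f n).hom x) =
      Finsupp.mapDomain (fun s : Simp U n => (inclMap U).comp s) ((chB 𝔽 U n).repr x) := by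
    suffices e : (chB 𝔽 X n).repr.toLinearMap ∘ₗ ((singMap 𝔽 (inclMap U)).f n).hom =
        Finsupp.lmapDomain 𝔽 𝔽 (fun s : Simp U n => (inclMap U).comp s) ∘ₗ
          (chB 𝔽 U n).repr.toLinearMap from congr($e x)
    refine (chB 𝔽 U n).ext fun s => ?_
    simp [chB_map]
  rw [goodChains_eq_supported] at h ⊢
  rw [hr] at h
  intro s hs t
  refine h ((inclMap U).comp s) ?_ t
  rw [Finsupp.mem_support_iff, Finsupp.mapDomain_apply inj]
  exact Finsupp.mem_support_iff.1 hs

instance mono_exciseMap : Mono (exciseMap 𝔽 U A) := by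
  refine HomologicalComplex.mono_of_mono_f _ fun n => ?_
  rw [ModuleCat.mono_iff_injective, injective_iff_map_eq_zero]
  intro z hz
  obtain ⟨x, rfl⟩ := coker_π_surjective _ n z
  erw [exciseMap_π, relC_π_eq_zero_iff] at hz
  rw [relC_π_eq_zero_iff]
  exact mem_goodChains_of_map U A hz

/-- The cokernel of the excision map is the quotient of the chains of `X` by sums of chains of `U`
and of `A`. Its acyclicity is therefore a statement about replacing chains by small ones. -/
lemma coker_exciseMap_eq_zero_iff (n : ℕ) (x : (singC 𝔽 X).X n) :
    ((Limits.cokernel.π (exciseMap 𝔽 U A)).f n).hom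
      (((relπ 𝔽 A).f n).hom x) = 0 ↔
      x ∈ goodChains 𝔽 (fun _ s => (∀ t, s t ∈ U) ∨ ∀ t, s t ∈ A) n := by
  have mono : ∀ B : Set X, (B = U ∨ B = A) → goodChains 𝔽 (fun _ s => ∀ t, s t ∈ B) n ≤
      goodChains 𝔽 (fun _ (s : Simp X _) => (∀ t, s t ∈ U) ∨ ∀ t, s t ∈ A) n := by
    intro B hB
    refine Submodule.span_mono (Set.image_mono fun s hs => ?_)
    rcases hB with rfl | rfl
    exacts [Or.inl hs, Or.inr hs]
  rw [coker_π_eq_zero_iff]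
  constructor
  · rintro ⟨y, hy⟩
    obtain ⟨u, rfl⟩ := coker_π_surjective _ n y
    erw [exciseMap_π] at hy
    rw [← sub_eq_zero, ← map_sub, relC_π_eq_zero_iff] at hy
    have h1 := (range_singMap_incl U n _).1 ⟨u, rfl⟩
    have := Submodule.sub_mem _ (mono U (.inl rfl) h1) (mono A (.inr rfl) hy)
    simpa using this
  · intro hx
    change _ ∈ LinearMap.range ((exciseMap 𝔽 U A).f n).hom
    refine goodChains_map (L := ((relπ 𝔽 A).f n).hom)
      (fun s hs => ?_) hx
    rcases hs with hs | hs
    · obtain ⟨u, hu⟩ := (range_singMap_incl (𝔽 := 𝔽) U n _).2 (chB_mem_goodChains hs)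
      exact ⟨_, (exciseMap_π U A n u).trans (by rw [hu])⟩
    · rw [(relC_π_eq_zero_iff A n _).2 (chB_mem_goodChains hs)]
      exact Submodule.zero_mem _

lemma small_of_open_cover (hU : IsOpen U) (hA : IsOpen A) (hUA : U ∪ A = univ) (n : ℕ)
    (s : Simp X n) : ∃ δ > 0, ∀ k (w : Fin (k + 1) → stdSimplex ℝ (Fin (n + 1))),
      (∀ i j, dist (w i) (w j) ≤ δ) →
        (∀ t, s.comp (affSimp w) t ∈ U) ∨ ∀ t, s.comp (affSimp w) t ∈ A := by
  obtain ⟨δ, hδ, h⟩ := lebesgue_number_lemma_of_metric (s := (univ : Set (stdSimplex ℝ (Fin (n + 1)))))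
    (c := fun b : Bool => s ⁻¹' (if b then U else A)) isCompact_univ
    (by rintro (_ | _)
        · exact hA.preimage s.continuous
        · exact hU.preimage s.continuous)
    (fun x _ => by
      have : s x ∈ U ∪ A := hUA ▸ trivial
      rcases this with h | h
      · exact mem_iUnion.2 ⟨true, by simpa using h⟩
      · exact mem_iUnion.2 ⟨false, by simpa using h⟩)
  -- Half of the Lebesgue number, since a non-strict distance bound has to give membership in an
  -- open ball.
  refine ⟨δ / 2, by positivity, fun k w hw => ?_⟩
  obtain ⟨b, hb⟩ := h (w 0) trivial
  have hall : ∀ t, affSimp w t ∈ Metric.ball (w 0) δ := fun t =>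
    (dist_affSimp_le (fun j => hw j 0) t).trans_lt (by linarith)
  cases b
  · exact .inr fun t => by simpa using hb (hall t)
  · exact .inl fun t => by simpa using hb (hall t)

/-- A cycle of the cokernel is represented by a chain with small boundary, and
`exists_sub_d_mem_goodChains` makes that chain small up to a boundary. So the cokernel is acyclic,
and the long exact sequence gives the isomorphism. -/
theorem isIso_homologyMap_exciseMap (hU : IsOpen U) (hA : IsOpen A) (hUA : U ∪ A = univ) (n : ℕ) :
    IsIso (HomologicalComplex.homologyMap (exciseMap 𝔽 U A) n) := by
  refine isIso_homologyMap_of_acyclic_coker _ (fun n => ?_) n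
  have hsmall := small_of_open_cover U A hU hA hUA
  cases n with
  | zero =>
    refine ShortComplex.exact_of_isZero_X₂ _ ?_
    refine (ModuleCat.isZero_of_iff_subsingleton).2 ?_
    refine ⟨fun a b => ?_⟩
    suffices h : ∀ a : (Limits.cokernel (exciseMap 𝔽 U A)).X 0, a = 0 from (h a).trans (h b).symm
    intro a
    obtain ⟨a, rfl⟩ := coker_π_surjective _ 0 a
    obtain ⟨a, rfl⟩ := coker_π_surjective _ 0 a
    erw [coker_exciseMap_eq_zero_iff]
    rw [goodChains_zero hsmall]
    trivial
  | succ n =>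
    refine exactAt_succ_of_forall n fun x hx => ?_
    obtain ⟨x, rfl⟩ := coker_π_surjective _ _ x
    obtain ⟨x, rfl⟩ := coker_π_surjective _ _ x
    have comm : ∀ m (y : (singC 𝔽 X).X (m + 1)),
        ((Limits.cokernel (exciseMap 𝔽 U A)).d (m + 1) m).hom
          (((Limits.cokernel.π (exciseMap 𝔽 U A)).f (m + 1)).hom
            (((relπ 𝔽 A).f (m + 1)).hom y)) =
        ((Limits.cokernel.π (exciseMap 𝔽 U A)).f m).hom
            (((relπ 𝔽 A).f m).hom
              (((singC 𝔽 X).d (m + 1) m).hom y)) := by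
      intro m y
      have := (relπ 𝔽 A ≫
        Limits.cokernel.π (exciseMap 𝔽 U A)).comm (m + 1) m
      exact congr($(this).hom y)
    erw [comm, coker_exciseMap_eq_zero_iff] at hx
    obtain ⟨y, hy⟩ := exists_sub_d_mem_goodChains
      (G := fun _ s => (∀ t, s t ∈ U) ∨ ∀ t, s t ∈ A)
      (fun n m s φ h => h.imp (fun h t => h _) (fun h t => h _)) hsmall n x hx
    refine ⟨_, (comm (n + 1) y).trans ?_⟩
    rw [← coker_exciseMap_eq_zero_iff, map_sub, map_sub, sub_eq_zero] at hy
    exact hy.symm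

/-- Excision for open covers by two sets. -/
def exciseIso (hU : IsOpen U) (hA : IsOpen A) (hUA : U ∪ A = univ) (n : ℕ) :
    relativeHomology 𝔽 U (Subtype.val ⁻¹' A) n ≅ relativeHomology 𝔽 X A n :=
  have := isIso_homologyMap_exciseMap (𝔽 := 𝔽) U A hU hA hUA n
  @asIso _ _ _ _ (HomologicalComplex.homologyMap (exciseMap 𝔽 U A) n) this

end Relative

end

noncomputable section

/-! ### Ranks of homology groups -/

section Ranks

variable (𝔽 : Type u) [Field 𝔽]

/-- The singular homology of `X`. -/
abbrev singH (X : Type u) [TopologicalSpace X] (k : ℕ) : ModuleCat.{u} 𝔽 := (singC 𝔽 X).homology k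

/-- The map in singular homology induced by a continuous map. -/
abbrev singHMap {X Y : Type u} [TopologicalSpace X] [TopologicalSpace Y] (g : C(X, Y)) (k : ℕ) :
    singH 𝔽 X k ⟶ singH 𝔽 Y k := HomologicalComplex.homologyMap (singMap 𝔽 g) k

variable {𝔽}

lemma rank_eq_of_iso {V W : ModuleCat.{u} 𝔽} (e : V ≅ W) : Module.rank 𝔽 V = Module.rank 𝔽 W :=
  e.toLinearEquiv.rank_eq

lemma rank_eq_zero_iff_isZero {V : ModuleCat.{u} 𝔽} :
    Module.rank 𝔽 V = 0 ↔ Limits.IsZero V := by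
  rw [rank_zero_iff, ModuleCat.isZero_of_iff_subsingleton]

variable {X Y Z : Type u} [TopologicalSpace X] [TopologicalSpace Y] [TopologicalSpace Z]

lemma singHMap_comp (g : C(X, Y)) (h : C(Y, Z)) (k : ℕ) :
    singHMap 𝔽 g k ≫ singHMap 𝔽 h k = singHMap 𝔽 (h.comp g) k := by
  rw [singHMap, singHMap, ← HomologicalComplex.homologyMap_comp, singMap_comp]

lemma singHMap_id (k : ℕ) : singHMap 𝔽 (ContinuousMap.id X) k = 𝟙 _ := by
  have : singMap 𝔽 (ContinuousMap.id X) = 𝟙 _ := CategoryTheory.Functor.map_id _ _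
  rw [singHMap, this, HomologicalComplex.homologyMap_id]

lemma singHMap_eq_of_homotopic {g h : C(X, Y)} (H : g.Homotopic h) (k : ℕ) :
    singHMap 𝔽 g k = singHMap 𝔽 h k :=
  TopCat.Homotopy.congr_homologyMap_singularChainComplexFunctor
    (f := TopCat.ofHom g) (g := TopCat.ofHom h) H.some _ k

open scoped ContinuousMap in
/-- Homotopy equivalent spaces have isomorphic homology. -/
def singHIso (e : X ≃ₕ Y) (k : ℕ) : singH 𝔽 X k ≅ singH 𝔽 Y k where
  hom := singHMap 𝔽 e.toFun k
  inv := singHMap 𝔽 e.invFun k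
  hom_inv_id := by
    rw [singHMap_comp, singHMap_eq_of_homotopic e.left_inv, singHMap_id]
  inv_hom_id := by
    rw [singHMap_comp, singHMap_eq_of_homotopic e.right_inv, singHMap_id]

lemma rank_singH_discrete (D : Type u) [TopologicalSpace D] [DiscreteTopology D] (k : ℕ) :
    Module.rank 𝔽 (singH 𝔽 D k) = if k = 0 then Cardinal.mk D else 0 := by
  classical
  split_ifs with hk
  · subst hk
    refine (rank_eq_of_iso ((singularHomologyFunctorZeroOfTotallyDisconnectedSpace
      (ModuleCat.{u} 𝔽) (ModuleCat.of 𝔽 𝔽) (TopCat.of D)) ≪≫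
        ModuleCat.coprodIsoDirectSum _)).trans ?_
    refine (rank_directSum (R := 𝔽) (fun _ : D => 𝔽)).trans ?_
    simp
  · rw [rank_eq_zero_iff_isZero]
    exact isZero_singularHomologyFunctor_of_totallyDisconnectedSpace (ModuleCat.{u} 𝔽) k
      (ModuleCat.of 𝔽 𝔽) (TopCat.of D) hk

lemma rank_singH_contractible [ContractibleSpace X] (k : ℕ) :
    Module.rank 𝔽 (singH 𝔽 X k) = if k = 0 then 1 else 0 := by
  have e := (ContractibleSpace.hequiv (X := X) (Y := PUnit.{u + 1})).some
  rw [rank_eq_of_iso (singHIso e k), rank_singH_discrete]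
  simp

lemma isZero_singH_contractible [ContractibleSpace X] (k : ℕ) :
    Limits.IsZero (singH 𝔽 X (k + 1)) := by
  rw [← rank_eq_zero_iff_isZero, rank_singH_contractible]
  simp

/-- The chain complex of the empty space vanishes, hence so do its terms in the long exact sequence.
In degree zero, where that sequence ends, surjectivity comes from surjectivity on chains. -/
lemma rank_relativeHomology_empty {A : Set X} (hA : A = ∅) (k : ℕ) :
    Module.rank 𝔽 (relativeHomology 𝔽 X A k) = Module.rank 𝔽 (singH 𝔽 X k) := by
  have : IsEmpty A := by subst hA; infer_instance
  have hz : ∀ n, Limits.IsZero ((singC 𝔽 A).X n) := fun n => by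
    rw [ModuleCat.isZero_of_iff_subsingleton]
    have : IsEmpty (Simp A n) := ⟨fun s => IsEmpty.false (s (vtx n 0))⟩
    exact (chB 𝔽 A n).repr.subsingleton
  have hex : ∀ n, (singC 𝔽 A).ExactAt n := fun n => ShortComplex.exact_of_isZero_X₂ _ (hz n)
  have hS := cokerSeq_shortExact (singMap 𝔽 (inclMap A))
  have e1 : Mono (HomologicalComplex.homologyMap (relπ 𝔽 A) k) :=
    (hS.homology_exact₂ k).mono_g ((hex k).isZero_homology.eq_of_src _ _)
  have e2 : Epi (HomologicalComplex.homologyMap (relπ 𝔽 A) k) := by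
    cases k with
    | zero =>
      have : Epi ((relπ 𝔽 A).f 0) := by infer_instance
      exact HomologicalComplex.epi_homologyMap_of_epi_of_not_rel (relπ 𝔽 A) 0 (by simp)
    | succ k =>
      exact (hS.homology_exact₃ (k + 1) k rfl).epi_f ((hex k).isZero_homology.eq_of_tgt _ _)
  have := isIso_of_mono_of_epi (HomologicalComplex.homologyMap (relπ 𝔽 A) k)
  exact (rank_eq_of_iso (asIso (HomologicalComplex.homologyMap (relπ 𝔽 A) k))).symm

variable {A : Set X}

/-- The identity of `X` is homotopic to the constant map at a point of `A`, which factors through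
the inclusion of `A`. -/
lemma epi_singHMap_incl_zero [ContractibleSpace X] (hA : A.Nonempty) :
    Epi (singHMap 𝔽 (inclMap A) 0) := by
  obtain ⟨a, ha⟩ := hA
  have h : (ContinuousMap.id X).Homotopic
      ((inclMap A).comp (ContinuousMap.const X (⟨a, ha⟩ : A))) := by
    obtain ⟨y, hy⟩ := id_nullhomotopic X
    exact hy.trans (ContinuousMap.Homotopic.comp hy (.refl (ContinuousMap.const X a))).symm
  have : singHMap 𝔽 (ContinuousMap.const X (⟨a, ha⟩ : A)) 0 ≫ singHMap 𝔽 (inclMap A) 0 = 𝟙 _ := by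
    rw [singHMap_comp, ← singHMap_eq_of_homotopic h, singHMap_id]
  exact epi_of_epi_fac this

variable [ContractibleSpace X]

lemma rank_relativeHomology_add_two (k : ℕ) :
    Module.rank 𝔽 (relativeHomology 𝔽 X A (k + 2)) = Module.rank 𝔽 (singH 𝔽 A (k + 1)) :=
  rank_eq_of_iso ((cokerSeq_shortExact (singMap 𝔽 (inclMap A))).δIso (k + 2) (k + 1) rfl
    (isZero_singH_contractible (𝔽 := 𝔽) (X := X) (k + 1))
    (isZero_singH_contractible (𝔽 := 𝔽) (X := X) k))

lemma rank_relativeHomology_zero (hA : A.Nonempty) :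
    Module.rank 𝔽 (relativeHomology 𝔽 X A 0) = 0 := by
  have hS := cokerSeq_shortExact (singMap 𝔽 (inclMap A))
  rw [rank_eq_zero_iff_isZero]
  have h1 : Epi (HomologicalComplex.homologyMap (relπ 𝔽 A) 0) := by
    have : Epi ((relπ 𝔽 A).f 0) := by infer_instance
    exact HomologicalComplex.epi_homologyMap_of_epi_of_not_rel (relπ 𝔽 A) 0 (by simp)
  have h2 := epi_singHMap_incl_zero (𝔽 := 𝔽) hA
  have h3 : singHMap 𝔽 (inclMap A) 0 ≫ HomologicalComplex.homologyMap (relπ 𝔽 A) 0 = 0 := by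
    rw [singHMap, ← HomologicalComplex.homologyMap_comp, Limits.cokernel.condition,
      HomologicalComplex.homologyMap_zero]
  rw [Limits.IsZero.iff_id_eq_zero]
  have h4 := (cancel_epi (singHMap 𝔽 (inclMap A) 0)).1 (h3.trans Limits.comp_zero.symm)
  refine (cancel_epi (HomologicalComplex.homologyMap (relπ 𝔽 A) 0)).1 ?_
  rw [h4]
  exact Limits.zero_comp.trans Limits.zero_comp.symm

/-- For contractible `X` the sequence `0 → H₁(X, A) → H₀(A) → H₀(X) → 0` is exact and its last term
has rank one. The additive form avoids subtracting cardinals. -/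
lemma rank_relativeHomology_one (hA : A.Nonempty) :
    1 + Module.rank 𝔽 (relativeHomology 𝔽 X A 1) = Module.rank 𝔽 (singH 𝔽 A 0) := by
  have hS := cokerSeq_shortExact (singMap 𝔽 (inclMap A))
  have hepi := epi_singHMap_incl_zero (𝔽 := 𝔽) hA
  have hsurj := (ModuleCat.epi_iff_surjective _).1 hepi
  have hδ : Mono (hS.δ 1 0 rfl) := hS.mono_δ 1 0 rfl (isZero_singH_contractible (𝔽 := 𝔽) (X := X) 0)
  have hinj := (ModuleCat.mono_iff_injective _).1 hδ
  have hex := (ShortComplex.moduleCat_exact_iff_range_eq_ker _).1 (hS.homology_exact₁ 1 0 rfl)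
  rw [← LinearMap.rank_range_add_rank_ker (singHMap 𝔽 (inclMap A) 0).hom]
  congr 1
  · rw [LinearMap.range_eq_top.2 hsurj, rank_top, rank_singH_contractible, if_pos rfl]
  · have : LinearMap.ker (singHMap 𝔽 (inclMap A) 0).hom = LinearMap.range (hS.δ 1 0 rfl).hom :=
      hex.symm
    rw [this]
    exact (LinearEquiv.ofInjective _ hinj).rank_eq

open scoped ContinuousMap in
lemma rank_relativeHomology_of_discrete (hA : A.Nonempty) {D : Type u} [TopologicalSpace D]
    [DiscreteTopology D] [Finite D] (e : A ≃ₕ D) (k : ℕ) :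
    Module.rank 𝔽 (relativeHomology 𝔽 X A k) = if k = 1 then ((Nat.card D - 1 : ℕ) : Cardinal) else 0 := by
  have hD : ∀ k, Module.rank 𝔽 (singH 𝔽 A k) = if k = 0 then ((Nat.card D : ℕ) : Cardinal) else 0 := by
    intro k
    rw [rank_eq_of_iso (singHIso e k), rank_singH_discrete, Nat.cast_card]
  match k with
  | 0 => simp [rank_relativeHomology_zero hA]
  | 1 =>
    have h := rank_relativeHomology_one (𝔽 := 𝔽) hA
    rw [hD, if_pos rfl] at h
    -- The rank has to be known to be finite before the 1 can be cancelled.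
    have hlt : Module.rank 𝔽 (relativeHomology 𝔽 X A 1) < Cardinal.aleph0 :=
      lt_of_le_of_lt (le_add_self.trans h.le) (Cardinal.natCast_lt_aleph0)
    obtain ⟨m, hm⟩ := Cardinal.lt_aleph0.1 hlt
    rw [hm] at h ⊢
    have : 1 + m = Nat.card D := by exact_mod_cast h
    rw [if_pos rfl, ← this]
    simp
  | k + 2 => rw [rank_relativeHomology_add_two, hD]; simp

end Ranks

end

noncomputable section

/-! ### The homology of the circle -/

section Circle

/-- The universal covering of the circle. -/
def circleCov : C(ULift.{u} ℝ, ULift.{u} Circle) := ⟨fun x => ⟨Circle.exp x.down⟩, by fun_prop⟩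

/-- The generating deck transformation of the universal covering of the circle. -/
def circleDeck : C(ULift.{u} ℝ, ULift.{u} ℝ) := ⟨fun x => ⟨x.down + 2 * Real.pi⟩, by fun_prop⟩

lemma circleCov_comp_deck : circleCov.{u}.comp circleDeck = circleCov := by
  ext x
  simp [circleCov, circleDeck, Circle.exp_add]

/-- The straight contraction of the standard simplex to a vertex turns `s` into a homotopy that
starts at a constant map. A lift of that constant extends by homotopy lifting, and its end is a lift
of `s`. -/
lemma circleCov_lift {n : ℕ} (s : Simp (ULift.{u} Circle) n) :
    ∃ s' : Simp (ULift.{u} ℝ) n, circleCov.comp s' = s := by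
  let x₀ : stdSimplex ℝ (Fin (n + 1)) := vtx n 0
  let c : C(unitInterval × stdSimplex ℝ (Fin (n + 1)), stdSimplex ℝ (Fin (n + 1))) :=
    ⟨fun q => ⟨(1 - q.1.1) • x₀.1 + q.1.1 • q.2.1, convex_stdSimplex ℝ _ x₀.2 q.2.2
      (by linarith [q.1.2.2]) q.1.2.1 (by ring)⟩, by fun_prop⟩
  let H : C(unitInterval × stdSimplex ℝ (Fin (n + 1)), Circle) :=
    ⟨fun q => (s (c q)).down, by fun_prop⟩
  obtain ⟨e, he⟩ : ∃ e : ℝ, Circle.exp e = (s x₀).down :=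
    ⟨_, Circle.exp_arg _⟩
  let F := Circle.isCoveringMap_exp.liftHomotopy H (.const _ e) (fun a => by
    have : c (0, a) = x₀ := by apply Subtype.ext; simp [c]
    change (s (c (0, a))).down = Circle.exp e
    rw [this, he])
  have hF := Circle.isCoveringMap_exp.liftHomotopy_lifts H (.const _ e) (fun a => by
    have : c (0, a) = x₀ := by apply Subtype.ext; simp [c]
    change (s (c (0, a))).down = Circle.exp e
    rw [this, he])
  refine ⟨⟨fun a => ⟨F (1, a)⟩, by fun_prop⟩, ContinuousMap.ext fun a => ULift.ext _ _ ?_⟩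
  refine (congrFun hF (1, a)).trans ?_
  have : c (1, a) = a := by apply Subtype.ext; simp [c]
  change (s (c (1, a))).down = _
  rw [this]

/-- The translates of a simplex by deck transformations. -/
def deckZ {n : ℕ} (m : ℤ) (s : Simp (ULift.{u} ℝ) n) : Simp (ULift.{u} ℝ) n :=
  ⟨fun a => ⟨(s a).down + m * (2 * Real.pi)⟩, by fun_prop⟩

lemma deckZ_succ {n : ℕ} (m : ℤ) (s : Simp (ULift.{u} ℝ) n) :
    deckZ (m + 1) s = circleDeck.comp (deckZ m s) := by
  ext a
  simp [deckZ, circleDeck]; ring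

lemma deckZ_zero {n : ℕ} (s : Simp (ULift.{u} ℝ) n) : deckZ 0 s = s := by
  ext a
  simp [deckZ]

lemma deckZ_injective {n : ℕ} (s : Simp (ULift.{u} ℝ) n) : Function.Injective (deckZ · s) := by
  intro m m' h
  have : (deckZ m s (vtx n 0)).down = (deckZ m' s (vtx n 0)).down := by
    simp only at h; rw [h]
  have hpi : (2 * Real.pi) ≠ 0 := by positivity
  simpa [deckZ, hpi] using this

/-- The difference of two lifts, divided by `2π`, is continuous with integer values on a connected
simplex, hence constant. -/
lemma exists_deckZ_of_circleCov_eq {n : ℕ} {s s' : Simp (ULift.{u} ℝ) n}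
    (h : circleCov.comp s = circleCov.comp s') : ∃ m, s = deckZ m s' := by
  have h1 : ∀ a, ∃ m : ℤ, (s a).down = (s' a).down + m * (2 * Real.pi) := fun a => by
    have : Circle.exp (s a).down = Circle.exp (s' a).down := congr(($h a).down)
    exact Circle.exp_eq_exp.1 this
  choose m hm using h1
  have hpi : (2 * Real.pi) ≠ 0 := by positivity
  have hcont : Continuous m := by
    have hc : Continuous fun a => ((m a : ℤ) : ℝ) := by
      have : (fun a => ((m a : ℤ) : ℝ)) = fun a => ((s a).down - (s' a).down) / (2 * Real.pi) := by
        funext a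
        rw [hm a]; field_simp; ring
      rw [this]
      fun_prop
    exact Int.isClosedEmbedding_coe_real.isEmbedding.continuous_iff.2 hc
  refine ⟨m (vtx n 0), ?_⟩
  ext a
  have : m a = m (vtx n 0) :=
    (PreconnectedSpace.constant (inferInstance) hcont)
  change (s a).down = (s' a).down + _
  rw [← this, hm a]

variable (𝔽 : Type u) [Field 𝔽]

/-- The sequence `C(ℝ) → C(ℝ) → C(S¹)`. -/
def circleSeq : ShortComplex (ChainComplex (ModuleCat.{u} 𝔽) ℕ) :=
  ShortComplex.mk (𝟙 (singC 𝔽 (ULift.{u} ℝ)) - singMap 𝔽 circleDeck) (singMap 𝔽 circleCov) (by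
    rw [Preadditive.sub_comp, singMap_comp, circleCov_comp_deck, Category.id_comp, sub_self])

lemma circleSeq_f_apply (n : ℕ) (z : (singC 𝔽 (ULift.{u} ℝ)).X n) :
    ((circleSeq 𝔽).f.f n).hom z = z - ((singMap 𝔽 circleDeck).f n).hom z := rfl

lemma repr_deck (n : ℕ) (z : (singC 𝔽 (ULift.{u} ℝ)).X n) (s : Simp (ULift.{u} ℝ) n) :
    (chB 𝔽 _ n).repr (((singMap 𝔽 circleDeck).f n).hom z) (circleDeck.comp s) =
      (chB 𝔽 _ n).repr z s := by
  have inj : Function.Injective (fun s : Simp (ULift.{u} ℝ) n => circleDeck.comp s) := by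
    intro s s' h
    ext a
    have : (circleDeck.comp s a).down = (circleDeck.comp s' a).down := by simp only at h; rw [h]
    simpa [circleDeck] using this
  have hr : (chB 𝔽 _ n).repr (((singMap 𝔽 circleDeck).f n).hom z) =
      Finsupp.mapDomain (fun s : Simp _ n => circleDeck.comp s) ((chB 𝔽 _ n).repr z) := by
    suffices e : (chB 𝔽 _ n).repr.toLinearMap ∘ₗ ((singMap 𝔽 circleDeck).f n).hom =
        Finsupp.lmapDomain 𝔽 𝔽 (fun s : Simp _ n => circleDeck.comp s) ∘ₗ
          (chB 𝔽 _ n).repr.toLinearMap from congr($e z)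
    refine (chB 𝔽 _ n).ext fun s => ?_
    simp [chB_map]
  rw [hr]
  exact Finsupp.mapDomain_apply inj _ _

/-- An invariant chain has the same coefficient at all the infinitely many translates of a simplex,
whereas its support is finite. -/
lemma eq_zero_of_deck_eq (n : ℕ) (z : (singC 𝔽 (ULift.{u} ℝ)).X n)
    (hz : z = ((singMap 𝔽 circleDeck).f n).hom z) : z = 0 := by
  refine (chB 𝔽 _ n).repr.map_eq_zero_iff.1 (Finsupp.ext fun s => ?_)
  by_contra hs
  have h : ∀ m : ℕ, (chB 𝔽 _ n).repr z (deckZ m s) = (chB 𝔽 _ n).repr z s := by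
    intro m
    induction m with
    | zero => rw [Nat.cast_zero, deckZ_zero]
    | succ m ih =>
      have e := repr_deck 𝔽 n z (deckZ m s)
      rw [← hz] at e
      rw [Nat.cast_succ, deckZ_succ, e, ih]
  have hinj : Function.Injective fun m : ℕ => deckZ (m : ℤ) s :=
    (deckZ_injective s).comp Nat.cast_injective
  refine Set.infinite_range_of_injective hinj
    (((chB 𝔽 _ n).repr z).support.finite_toSet.subset ?_)
  rintro _ ⟨m, rfl⟩
  simp only [Finset.mem_coe, Finsupp.mem_support_iff]
  rw [h m]
  exact hs

lemma circleSeq_f_injective (n : ℕ) : Function.Injective ((circleSeq 𝔽).f.f n).hom := by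
  rw [injective_iff_map_eq_zero]
  exact fun z hz => eq_zero_of_deck_eq 𝔽 n z
    (sub_eq_zero.1 ((circleSeq_f_apply 𝔽 n z).symm.trans hz))

/-- The image of `1 - T`, `T` being the deck transformation. -/
def deckRange (n : ℕ) : Submodule 𝔽 ((singC 𝔽 (ULift.{u} ℝ)).X n) :=
  LinearMap.range (LinearMap.id - ((singMap 𝔽 circleDeck).f n).hom)

lemma deck_sub_mem_range (n : ℕ) (m : ℤ) (s : Simp (ULift.{u} ℝ) n) :
    chB 𝔽 _ n (deckZ m s) - chB 𝔽 _ n s ∈ deckRange 𝔽 n := by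
  have step : ∀ s : Simp (ULift.{u} ℝ) n, chB 𝔽 _ n s - chB 𝔽 _ n (circleDeck.comp s) ∈
      deckRange 𝔽 n := fun s =>
    ⟨chB 𝔽 _ n s, by rw [LinearMap.sub_apply, chB_map, LinearMap.id_apply]⟩
  induction m using Int.induction_on with
  | zero => rw [deckZ_zero, sub_self]; exact Submodule.zero_mem _
  | succ m ih =>
    rw [deckZ_succ]
    have := Submodule.sub_mem _ ih (step (deckZ m s))
    rwa [sub_sub_sub_cancel_left, ← neg_sub, neg_sub] at this
  | pred m ih =>
    have h := deckZ_succ (-(m : ℤ) - 1) s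
    rw [sub_add_cancel] at h
    have := Submodule.add_mem _ ih (step (deckZ (-(m : ℤ) - 1) s))
    rw [← h] at this
    rwa [add_comm, sub_add_sub_cancel] at this

/-- Choosing a lift of every simplex gives a linear section `L` of the projection. Two lifts of a
simplex are translates of each other, so `L` applied to the projection of `z` differs from `z` by an
element of the image of `1 - T`. If the projection of `z` is zero, then `z` itself lies in this
image. -/
lemma circleSeq_shortExact : (circleSeq 𝔽).ShortExact := by
  refine HomologicalComplex.shortExact_of_degreewise_shortExact _ fun n => ?_
  have lift : ∀ s : Simp (ULift.{u} Circle) n, ∃ s' : Simp (ULift.{u} ℝ) n,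
    circleCov.comp s' = s := circleCov_lift
  choose ℓ hℓ using lift
  let L : (singC 𝔽 (ULift.{u} Circle)).X n →ₗ[𝔽] (singC 𝔽 (ULift.{u} ℝ)).X n :=
    (chB 𝔽 _ n).constr 𝔽 fun s => chB 𝔽 _ n (ℓ s)
  have hL : ∀ z, ((singMap 𝔽 circleCov).f n).hom (L z) = z := by
    intro z
    suffices e : ((singMap 𝔽 circleCov).f n).hom ∘ₗ L = LinearMap.id from congr($e z)
    refine (chB 𝔽 _ n).ext fun s => ?_
    simp only [LinearMap.comp_apply, L, Module.Basis.constr_basis, chB_map, hℓ, LinearMap.id_apply]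
  have hR : ∀ z, L (((singMap 𝔽 circleCov).f n).hom z) - z ∈
      deckRange 𝔽 n := by
    intro z
    have : z ∈ Submodule.span 𝔽 (Set.range (chB 𝔽 (ULift.{u} ℝ) n)) := by
      rw [(chB 𝔽 _ n).span_eq]; trivial
    induction this using Submodule.span_induction with
    | mem x hx =>
      obtain ⟨s, rfl⟩ := hx
      obtain ⟨m, hm⟩ := exists_deckZ_of_circleCov_eq (hℓ (circleCov.comp s))
      rw [chB_map, Module.Basis.constr_basis, hm]
      exact deck_sub_mem_range 𝔽 n m s
    | zero => rw [map_zero, map_zero, sub_zero]; exact Submodule.zero_mem _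
    | add x y _ _ hx hy =>
      rw [map_add, map_add, add_sub_add_comm]
      exact Submodule.add_mem _ hx hy
    | smul a x _ hx =>
      rw [map_smul, map_smul, ← smul_sub]
      exact Submodule.smul_mem _ _ hx
  have hK : ∀ z : (singC 𝔽 (ULift.{u} ℝ)).X n, ((singMap 𝔽 circleCov).f n).hom z = 0 →
      z ∈ deckRange 𝔽 n := by
    intro z hz
    have := hR z
    rw [hz, map_zero, zero_sub] at this
    exact neg_mem_iff.1 this
  refine { exact := ?_, mono_f := ?_, epi_g := ?_ }
  · refine (ShortComplex.moduleCat_exact_iff _).2 fun z hz => ?_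
    exact hK z hz
  · exact (ModuleCat.mono_iff_injective _).2 (circleSeq_f_injective 𝔽 n)
  · exact (ModuleCat.epi_iff_surjective _).2 fun z => ⟨L z, hL z⟩

instance : ContractibleSpace (ULift.{u} ℝ) := Homeomorph.ulift.contractibleSpace

/-- Translations of the line are homotopic to the identity. With `1 - T` acting as zero on homology,
the long exact sequence of the covering determines the homology of the circle. -/
lemma homologyMap_circleSeq_f (k : ℕ) :
    HomologicalComplex.homologyMap (circleSeq 𝔽).f k = 0 := by
  have h : (ContinuousMap.id (ULift.{u} ℝ)).Homotopic circleDeck :=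
    ⟨{  toFun := fun q => ⟨q.2.down + q.1.1 * (2 * Real.pi)⟩
        continuous_toFun := by fun_prop
        map_zero_left := fun x => by simp
        map_one_left := fun x => by simp [circleDeck] }⟩
  have e : HomologicalComplex.homologyMap (singMap 𝔽 circleDeck.{u}) k = 𝟙 _ :=
    (singHMap_eq_of_homotopic (𝔽 := 𝔽) h k).symm.trans (singHMap_id k)
  change HomologicalComplex.homologyMap (𝟙 (singC 𝔽 (ULift.{u} ℝ)) - singMap 𝔽 circleDeck) k = 0
  rw [HomologicalComplex.homologyMap_sub, HomologicalComplex.homologyMap_id, e, sub_self]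

lemma rank_singH_circle (k : ℕ) :
    Module.rank 𝔽 (singH 𝔽 (ULift.{u} Circle) k) = if k ≤ 1 then 1 else 0 := by
  have hS := circleSeq_shortExact 𝔽
  match k with
  | 0 =>
    have e1 : Mono (HomologicalComplex.homologyMap (circleSeq 𝔽).g 0) :=
      (hS.homology_exact₂ 0).mono_g (homologyMap_circleSeq_f 𝔽 0)
    have e2 : Epi (HomologicalComplex.homologyMap (circleSeq 𝔽).g 0) := by
      have := hS.epi_g
      have : Epi ((circleSeq 𝔽).g.f 0) := by infer_instance
      exact HomologicalComplex.epi_homologyMap_of_epi_of_not_rel _ 0 (by simp)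
    have := isIso_of_mono_of_epi (HomologicalComplex.homologyMap (circleSeq 𝔽).g 0)
    have h := rank_eq_of_iso (asIso (HomologicalComplex.homologyMap (circleSeq 𝔽).g 0))
    refine h.symm.trans ((rank_singH_contractible 0).trans ?_)
    simp
  | 1 =>
    have e1 : Mono (hS.δ 1 0 rfl) :=
      hS.mono_δ 1 0 rfl (isZero_singH_contractible (𝔽 := 𝔽) (X := ULift.{u} ℝ) 0)
    have e2 : Epi (hS.δ 1 0 rfl) :=
      (hS.homology_exact₁ 1 0 rfl).epi_f (homologyMap_circleSeq_f 𝔽 0)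
    have := isIso_of_mono_of_epi (hS.δ 1 0 rfl)
    refine (rank_eq_of_iso (asIso (hS.δ 1 0 rfl))).trans ((rank_singH_contractible 0).trans ?_)
    simp
  | k + 2 =>
    refine (rank_eq_of_iso (hS.δIso (k + 2) (k + 1) rfl
      (isZero_singH_contractible (𝔽 := 𝔽) (X := ULift.{u} ℝ) (k + 1))
      (isZero_singH_contractible (𝔽 := 𝔽) (X := ULift.{u} ℝ) k))).trans
        ((rank_singH_contractible (k + 1)).trans ?_)
    simp

open scoped ContinuousMap in
lemma rank_relativeHomology_of_circle {X : Type u} [TopologicalSpace X] [ContractibleSpace X]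
    {A : Set X} (e : A ≃ₕ ULift.{u} Circle) (k : ℕ) :
    Module.rank 𝔽 (relativeHomology 𝔽 X A k) = if k = 2 then 1 else 0 := by
  have hA : A.Nonempty := ⟨_, (e.invFun ⟨1⟩).2⟩
  have hD : ∀ k, Module.rank 𝔽 (singH 𝔽 A k) = if k ≤ 1 then 1 else 0 := by
    intro k
    rw [rank_eq_of_iso (singHIso e k), rank_singH_circle]
  match k with
  | 0 => simp [rank_relativeHomology_zero hA]
  | 1 =>
    have h := rank_relativeHomology_one (𝔽 := 𝔽) hA
    rw [hD, if_pos (by simp)] at h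
    have hlt : Module.rank 𝔽 (relativeHomology 𝔽 X A 1) < Cardinal.aleph0 :=
      lt_of_le_of_lt (le_add_self.trans h.le) Cardinal.one_lt_aleph0
    obtain ⟨m, hm⟩ := Cardinal.lt_aleph0.1 hlt
    rw [hm] at h ⊢
    have : 1 + m = 1 := by exact_mod_cast h
    simp [show m = 0 by omega]
  | k + 2 => rw [rank_relativeHomology_add_two, hD]; simp

end Circle

end

noncomputable section

/-! ### Homology of a level set at a point with a conical local model -/

section LocalHomology

/-- The `ℓ¹` norm on the plane. -/
def nrm1 (y : Fin 2 → ℝ) : ℝ := |y 0| + |y 1|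

/-- Positive homogeneity of degree one. -/
def PosHom (h : (Fin 2 → ℝ) → ℝ) : Prop := ∀ c : ℝ, 0 ≤ c → ∀ y, h (c • y) = c * h y

lemma nrm1_nonneg (y : Fin 2 → ℝ) : 0 ≤ nrm1 y := by unfold nrm1; positivity

lemma nrm1_smul (c : ℝ) (y : Fin 2 → ℝ) : nrm1 (c • y) = |c| * nrm1 y := by
  simp [nrm1, abs_mul, mul_add]

@[fun_prop]
lemma continuous_nrm1 : Continuous nrm1 := by unfold nrm1; fun_prop

lemma norm_le_nrm1 (y : Fin 2 → ℝ) : ‖y‖ ≤ nrm1 y := by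
  rw [pi_norm_le_iff_of_nonneg (nrm1_nonneg y), Fin.forall_fin_two]
  unfold nrm1
  constructor <;> simp

lemma nrm1_eq_zero_iff {y : Fin 2 → ℝ} : nrm1 y = 0 ↔ y = 0 := by
  constructor
  · intro h
    exact norm_le_zero_iff.1 ((norm_le_nrm1 y).trans h.le)
  · rintro rfl; simp [nrm1]

lemma nrm1_pos {y : Fin 2 → ℝ} (hy : y ≠ 0) : 0 < nrm1 y :=
  lt_of_le_of_ne (nrm1_nonneg y) fun h => hy (nrm1_eq_zero_iff.1 h.symm)

lemma nrm1_inv_smul {y : Fin 2 → ℝ} (hy : y ≠ 0) : nrm1 ((nrm1 y)⁻¹ • y) = 1 := by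
  rw [nrm1_smul, abs_of_pos (inv_pos.2 (nrm1_pos hy)), inv_mul_cancel₀ (nrm1_pos hy).ne']

lemma PosHom.map_zero {h : (Fin 2 → ℝ) → ℝ} (hh : PosHom h) : h 0 = 0 := by
  simpa using hh 0 le_rfl 0

/-- The closed sublevel part of the unit `ℓ¹` circle. -/
def lowerCircle (h : (Fin 2 → ℝ) → ℝ) : Set (Fin 2 → ℝ) := {y | nrm1 y = 1 ∧ h y ≤ 0}

/-- A sublevel cone cut off at radius `ε`. -/
def lowerCone (h : (Fin 2 → ℝ) → ℝ) (ε : ℝ) : Set (Fin 2 → ℝ) := {y | ‖y‖ < ε ∧ h y ≤ 0}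

open scoped ContinuousMap

/-- The punctured sublevel cone is homotopy equivalent to its base. -/
def puncturedConeEquiv {h : (Fin 2 → ℝ) → ℝ} (hh : PosHom h) {ε : ℝ} (hε : 0 < ε) :
    {y : Fin 2 → ℝ // y ∈ lowerCone h ε ∧ y ≠ 0} ≃ₕ lowerCircle h where
  toFun := ⟨fun y => ⟨(nrm1 y.1)⁻¹ • y.1, nrm1_inv_smul y.2.2, by
      rw [hh _ (inv_nonneg.2 (nrm1_nonneg _))]
      exact mul_nonpos_of_nonneg_of_nonpos (inv_nonneg.2 (nrm1_nonneg _)) y.2.1.2⟩, by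
    have : Continuous fun y : {y : Fin 2 → ℝ // y ∈ lowerCone h ε ∧ y ≠ 0} => (nrm1 y.1)⁻¹ :=
      Continuous.inv₀ (by fun_prop) fun y => (nrm1_pos y.2.2).ne'
    fun_prop⟩
  invFun := ⟨fun y => ⟨(ε / 2) • y.1, ⟨by
      rw [norm_smul, Real.norm_of_nonneg (by positivity)]
      have := (norm_le_nrm1 y.1).trans y.2.1.le
      nlinarith, by
      rw [hh _ (by positivity)]
      exact mul_nonpos_of_nonneg_of_nonpos (by positivity) y.2.2⟩, by
      rw [Ne, smul_eq_zero, not_or]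
      refine ⟨by positivity, fun h0 => ?_⟩
      have := y.2.1
      rw [h0, nrm1_eq_zero_iff.2 rfl] at this
      exact zero_ne_one this⟩, by fun_prop⟩
  left_inv := ⟨{
    -- The homotopy is radial: the factor moves from the one that brings the point to `ℓ¹` radius `ε
    -- / 2` to the factor one. The sup norm is at most the `ℓ¹` norm, so the path stays within
    -- radius `ε`.
    toFun := fun q => ⟨((1 - q.1.1) * (ε / 2 * (nrm1 q.2.1)⁻¹) + q.1.1) • q.2.1, by
      have hN := nrm1_pos q.2.2.2
      have h0 := q.1.2.1
      have h1 := q.1.2.2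
      have hc : 0 < (1 - q.1.1) * (ε / 2 * (nrm1 q.2.1)⁻¹) + q.1.1 := by
        rcases h0.eq_or_lt with h | h
        · rw [← h]; simp only [sub_zero, one_mul, add_zero]; positivity
        · have : 0 ≤ (1 - q.1.1) * (ε / 2 * (nrm1 q.2.1)⁻¹) :=
            mul_nonneg (by linarith) (by positivity)
          linarith
      refine ⟨⟨?_, ?_⟩, ?_⟩
      · rw [norm_smul, Real.norm_of_nonneg hc.le, add_mul]
        have e1 : ε / 2 * (nrm1 q.2.1)⁻¹ * ‖q.2.1‖ ≤ ε / 2 := by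
          have : (nrm1 q.2.1)⁻¹ * ‖q.2.1‖ ≤ 1 := by
            rw [inv_mul_le_one₀ hN]; exact norm_le_nrm1 _
          rw [mul_assoc]
          nlinarith
        have e2 : ‖q.2.1‖ < ε := q.2.2.1.1
        have e3 : (1 - q.1.1) * (ε / 2 * (nrm1 q.2.1)⁻¹) * ‖q.2.1‖ ≤ (1 - q.1.1) * (ε / 2) := by
          rw [mul_assoc]
          exact mul_le_mul_of_nonneg_left e1 (by linarith)
        rcases h0.eq_or_lt with h | h
        · rw [← h] at e3 ⊢; linarith
        · nlinarith
      · rw [hh _ hc.le]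
        exact mul_nonpos_of_nonneg_of_nonpos hc.le q.2.2.1.2
      · exact smul_ne_zero hc.ne' q.2.2.2⟩
    continuous_toFun := by
      have : Continuous fun q : unitInterval × {y : Fin 2 → ℝ // y ∈ lowerCone h ε ∧ y ≠ 0} =>
          (nrm1 q.2.1)⁻¹ := Continuous.inv₀ (by fun_prop) fun q => (nrm1_pos q.2.2.2).ne'
      fun_prop
    map_zero_left := fun y => by
      apply Subtype.ext
      simp [smul_smul]
    map_one_left := fun y => by
      apply Subtype.ext
      simp }⟩
  right_inv := by
    have : ∀ y : lowerCircle h, (nrm1 ((ε / 2) • y.1))⁻¹ • (ε / 2) • y.1 = y.1 := fun y => by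
      rw [nrm1_smul, y.2.1, smul_smul, abs_of_pos (by positivity), mul_one,
        inv_mul_cancel₀ (by positivity), one_smul]
    convert ContinuousMap.Homotopic.refl _
    ext y
    exact (congrFun (this y) _).symm

/-- The `ℓ¹` circle is homeomorphic to the circle. -/
def diamondHomeo : {y : Fin 2 → ℝ | nrm1 y = 1} ≃ₜ Circle where
  toFun y := ⟨((‖(⟨y.1 0, y.1 1⟩ : ℂ)‖⁻¹ : ℝ) : ℂ) * ⟨y.1 0, y.1 1⟩, by
    have : (⟨y.1 0, y.1 1⟩ : ℂ) ≠ 0 := fun h => by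
      have h0 : y.1 0 = 0 := congrArg Complex.re h
      have h1 : y.1 1 = 0 := congrArg Complex.im h
      have := y.2
      simp [nrm1, h0, h1] at this
    change _ ∈ Metric.sphere (0 : ℂ) 1
    rw [mem_sphere_zero_iff_norm, norm_mul, Complex.norm_real, norm_inv, norm_norm, inv_mul_cancel₀]
    exact norm_ne_zero_iff.2 this⟩
  invFun z := ⟨(nrm1 ![(z : ℂ).re, (z : ℂ).im])⁻¹ • ![(z : ℂ).re, (z : ℂ).im], by
    refine nrm1_inv_smul fun h => ?_
    have h0 : (z : ℂ).re = 0 := congrFun h 0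
    have h1 : (z : ℂ).im = 0 := congrFun h 1
    exact z.coe_ne_zero (Complex.ext h0 h1)⟩
  left_inv y := by
    apply Subtype.ext
    have hy : nrm1 y.1 = 1 := y.2
    have hne : (⟨y.1 0, y.1 1⟩ : ℂ) ≠ 0 := fun h => by
      have h0 : y.1 0 = 0 := congrArg Complex.re h
      have h1 : y.1 1 = 0 := congrArg Complex.im h
      simp [nrm1, h0, h1] at hy
    have hc : 0 < ‖(⟨y.1 0, y.1 1⟩ : ℂ)‖⁻¹ := inv_pos.2 (norm_pos_iff.2 hne)
    set c := ‖(⟨y.1 0, y.1 1⟩ : ℂ)‖⁻¹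
    have : (![((c : ℂ) * ⟨y.1 0, y.1 1⟩ : ℂ).re, ((c : ℂ) * ⟨y.1 0, y.1 1⟩ : ℂ).im] : Fin 2 → ℝ)
        = c • y.1 := by
      funext i; fin_cases i <;> simp
    change (nrm1 ![((c : ℂ) * ⟨y.1 0, y.1 1⟩ : ℂ).re, ((c : ℂ) * ⟨y.1 0, y.1 1⟩ : ℂ).im])⁻¹ •
      (![((c : ℂ) * ⟨y.1 0, y.1 1⟩ : ℂ).re, ((c : ℂ) * ⟨y.1 0, y.1 1⟩ : ℂ).im] : Fin 2 → ℝ) = y.1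
    rw [this, nrm1_smul, hy, smul_smul, abs_of_pos hc, mul_one, inv_mul_cancel₀ hc.ne', one_smul]
  right_inv z := by
    apply Subtype.ext
    set c := (nrm1 ![(z : ℂ).re, (z : ℂ).im])⁻¹ with hcdef
    have hc : 0 < c := by
      refine inv_pos.2 (nrm1_pos fun h => ?_)
      have h0 : (z : ℂ).re = 0 := congrFun h 0
      have h1 : (z : ℂ).im = 0 := congrFun h 1
      exact z.coe_ne_zero (Complex.ext h0 h1)
    have : (⟨(c • ![(z : ℂ).re, (z : ℂ).im]) 0, (c • ![(z : ℂ).re, (z : ℂ).im]) 1⟩ : ℂ) =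
        (c : ℂ) * z := by
      apply Complex.ext <;> simp
    change ((‖(⟨(c • ![(z : ℂ).re, (z : ℂ).im]) 0, (c • ![(z : ℂ).re, (z : ℂ).im]) 1⟩ : ℂ)‖⁻¹ : ℝ)
      : ℂ) * ⟨(c • ![(z : ℂ).re, (z : ℂ).im]) 0, (c • ![(z : ℂ).re, (z : ℂ).im]) 1⟩ = (z : ℂ)
    rw [this, norm_mul, Complex.norm_real, Circle.norm_coe, mul_one, Real.norm_of_nonneg hc.le,
      ← mul_assoc, ← Complex.ofReal_mul, inv_mul_cancel₀ hc.ne', Complex.ofReal_one, one_mul]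
  continuous_toFun := by
    have h01 : Continuous fun y : {y : Fin 2 → ℝ | nrm1 y = 1} => (y.1 0, y.1 1) :=
      ((continuous_apply 0).comp continuous_subtype_val).prodMk
        ((continuous_apply 1).comp continuous_subtype_val)
    have hc : Continuous fun y : {y : Fin 2 → ℝ | nrm1 y = 1} => (⟨y.1 0, y.1 1⟩ : ℂ) :=
      Complex.equivRealProdCLM.symm.continuous.comp h01
    refine Continuous.subtype_mk (Continuous.mul (Complex.continuous_ofReal.comp
      (Continuous.inv₀ ?_ ?_)) ?_) _
    · exact hc.norm
    · intro y h
      have h := norm_eq_zero.1 h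
      have h0 : y.1 0 = 0 := congrArg Complex.re h
      have h1 : y.1 1 = 0 := congrArg Complex.im h
      have := y.2
      simp [nrm1, h0, h1] at this
    · exact hc
  continuous_invFun := by
    have hc : Continuous fun z : Circle => ![(z : ℂ).re, (z : ℂ).im] := by
      refine continuous_pi fun i => ?_
      fin_cases i
      · exact Complex.continuous_re.comp continuous_subtype_val
      · exact Complex.continuous_im.comp continuous_subtype_val
    refine Continuous.subtype_mk (Continuous.smul (Continuous.inv₀
      (continuous_nrm1.comp hc) fun z h => ?_) hc) _
    have h := nrm1_eq_zero_iff.1 h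
    have h0 : (z : ℂ).re = 0 := congrFun h 0
    have h1 : (z : ℂ).im = 0 := congrFun h 1
    exact z.coe_ne_zero (Complex.ext h0 h1)

lemma contractibleSpace_lowerCone {h : (Fin 2 → ℝ) → ℝ} (hh : PosHom h) {ε : ℝ} (hε : 0 < ε) :
    ContractibleSpace (lowerCone h ε) := by
  refine StarConvex.contractibleSpace (x := 0) ?_ ⟨0, by simpa, hh.map_zero.le⟩
  rw [starConvex_zero_iff]
  intro y hy a ha ha1
  refine ⟨?_, ?_⟩
  · rw [norm_smul, Real.norm_of_nonneg ha]
    nlinarith [norm_nonneg y, hy.1]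
  · rw [hh a ha]
    exact mul_nonpos_of_nonneg_of_nonpos ha hy.2

variable {M : Type u} [TopologicalSpace M]

/-- `e` is a chart centred at `v` in which `f` is, near `v` and up to a constant, given by the
continuous and positively homogeneous function `h`. -/
structure IsConical (e : OpenPartialHomeomorph M (Fin 2 → ℝ)) (h : (Fin 2 → ℝ) → ℝ) (f : M → ℝ)
    (v : M) : Prop where
  mem_source : v ∈ e.source
  map_eq_zero : e v = 0
  continuous : Continuous h
  posHom : PosHom h
  eventually_eq : ∀ᶠ x in 𝓝 v, f x = f v + h (e x)

variable {e : OpenPartialHomeomorph M (Fin 2 → ℝ)} {h : (Fin 2 → ℝ) → ℝ} {f : M → ℝ} {v : M}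

lemma IsConical.exists_ball (H : IsConical e h f v) : ∃ ε > 0, Metric.ball 0 ε ⊆ e.target ∧
    ∀ y ∈ Metric.ball 0 ε, f (e.symm y) = f v + h y := by
  have h0 : (0 : Fin 2 → ℝ) ∈ e.target := H.map_eq_zero ▸ e.map_source H.mem_source
  have h1 : e.target ∈ 𝓝 (0 : Fin 2 → ℝ) := e.open_target.mem_nhds h0
  have h2 : Filter.Tendsto e.symm (𝓝 0) (𝓝 v) := by
    have := e.continuousAt_symm h0
    rwa [ContinuousAt, ← H.map_eq_zero, e.left_inv H.mem_source, H.map_eq_zero] at this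
  obtain ⟨ε, hε, hb⟩ := Metric.mem_nhds_iff.1
    (Filter.inter_mem h1 (h2.eventually H.eventually_eq))
  refine ⟨ε, hε, fun y hy => (hb hy).1, fun y hy => ?_⟩
  have := (hb hy).2
  simp only [mem_ofPred_eq, e.right_inv (hb hy).1] at this
  exact this

/-- The homology of the pair `(f_a, f_a ∖ {v})` is the one of a pair homeomorphic to
a sublevel cone and the sublevel cone without its apex. -/
lemma IsConical.exists_model [T1Space M] (H : IsConical e h f v) :
    ∃ ε > 0, ∃ (U : Set {x : M // f x ≤ f v}) (φ : U ≃ₜ lowerCone h ε),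
      (∀ x, x.1.1 = v ↔ (φ x).1 = 0) ∧ ∀ (𝔽 : Type u) [Field 𝔽] (k : ℕ),
        Module.rank 𝔽 (levelHomology 𝔽 f v k) =
          Module.rank 𝔽 (relativeHomology 𝔽 U (Subtype.val ⁻¹' {x | (x : M) ≠ v}) k) := by
  obtain ⟨ε, hε, hb, hf⟩ := H.exists_ball
  let U : Set {x : M // f x ≤ f v} := {x | x.1 ∈ e.source ∩ e ⁻¹' Metric.ball 0 ε}
  have hU : IsOpen U := (e.isOpen_inter_preimage Metric.isOpen_ball).preimage continuous_subtype_val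
  have hmem : ∀ y : lowerCone h ε, y.1 ∈ Metric.ball (0 : Fin 2 → ℝ) ε := fun y => by
    simpa using y.2.1
  let φ : U ≃ₜ lowerCone h ε :=
    { toFun := fun x => ⟨e x.1.1, by simpa using x.2.2, by
        have := hf _ x.2.2
        rw [e.left_inv x.2.1] at this
        have := x.1.2
        linarith⟩
      invFun := fun y => ⟨⟨e.symm y.1, by
          rw [hf y.1 (hmem y)]; linarith [y.2.2]⟩,
        e.map_target (hb (hmem y)), by
          change e (e.symm y.1) ∈ Metric.ball 0 ε
          rw [e.right_inv (hb (hmem y))]; exact hmem y⟩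
      left_inv := fun x => Subtype.ext (Subtype.ext (e.left_inv x.2.1))
      right_inv := fun y => Subtype.ext (e.right_inv (hb (hmem y)))
      continuous_toFun := by
        refine Continuous.subtype_mk ?_ _
        exact e.continuousOn.comp_continuous (by fun_prop) fun x => x.2.1
      continuous_invFun := by
        refine Continuous.subtype_mk (Continuous.subtype_mk ?_ _) _
        exact e.continuousOn_symm.comp_continuous (by fun_prop)
          fun y => hb (hmem y) }
  refine ⟨ε, hε, U, φ, fun x => ?_, fun 𝔽 _ k => ?_⟩
  · change x.1.1 = v ↔ e x.1.1 = 0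
    rw [← H.map_eq_zero]
    exact (e.injOn.eq_iff x.2.1 H.mem_source).symm
  -- The chart neighbourhood `U` and the complement of `v` form an open cover of the sublevel set,
  -- so excision applies directly.
  · refine (rank_eq_of_iso (exciseIso (𝔽 := 𝔽) U {x | (x : M) ≠ v} hU ?_ ?_ k)).symm
    · exact isOpen_ne.preimage continuous_subtype_val
    · ext x
      simp only [mem_union, mem_ofPred_eq, mem_univ, iff_true]
      by_cases hx : x.1 = v
      · left
        refine ⟨by rw [hx]; exact H.mem_source, ?_⟩
        rw [mem_preimage, hx, H.map_eq_zero]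
        exact Metric.mem_ball_self hε
      · exact .inr hx

/-- The punctured neighbourhood in the local model. -/
def puncturedHomeo {X : Type u} [TopologicalSpace X] {C : Set (Fin 2 → ℝ)} (φ : X ≃ₜ C)
    {A : Set X} (hA : ∀ x, x ∈ A ↔ (φ x).1 ≠ 0) : A ≃ₜ {y : Fin 2 → ℝ // y ∈ C ∧ y ≠ 0} where
  toFun x := ⟨(φ x.1).1, (φ x.1).2, (hA _).1 x.2⟩
  invFun y := ⟨φ.symm ⟨y.1, y.2.1⟩, (hA _).2 (by simpa using y.2.2)⟩
  left_inv x := by apply Subtype.ext; simp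
  right_inv y := by apply Subtype.ext; simp
  continuous_toFun := by fun_prop
  continuous_invFun := by fun_prop

variable [T1Space M] (𝔽 : Type u) [Field 𝔽]

/-- The sublevel cone is only its apex, so the subspace of the pair is empty and absolute homology
remains. -/
lemma IsConical.rank_of_pos (H : IsConical e h f v) (hpos : ∀ y ≠ 0, 0 < h y) (k : ℕ) :
    Module.rank 𝔽 (levelHomology 𝔽 f v k) = if k = 0 then 1 else 0 := by
  obtain ⟨ε, hε, U, φ, hφ, hrank⟩ := H.exists_model
  have := contractibleSpace_lowerCone H.posHom hε
  have : ContractibleSpace U := φ.contractibleSpace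
  rw [hrank, rank_relativeHomology_empty, rank_singH_contractible]
  ext x
  simp only [mem_preimage, mem_ofPred_eq, mem_empty_iff_false, iff_false, not_not]
  rw [hφ]
  by_contra hne
  exact absurd (φ x).2.2 (not_le.2 (hpos _ hne))

/-- The base of the sublevel cone is the whole circle. -/
lemma IsConical.rank_of_neg (H : IsConical e h f v) (hneg : ∀ y ≠ 0, h y < 0) (k : ℕ) :
    Module.rank 𝔽 (levelHomology 𝔽 f v k) = if k = 2 then 1 else 0 := by
  obtain ⟨ε, hε, U, φ, hφ, hrank⟩ := H.exists_model
  have := contractibleSpace_lowerCone H.posHom hε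
  have : ContractibleSpace U := φ.contractibleSpace
  have hL : lowerCircle h = {y | nrm1 y = 1} := by
    ext y
    refine ⟨fun h => h.1, fun hy => ⟨hy, (hneg y fun h0 => ?_).le⟩⟩
    subst h0
    simp [nrm1] at hy
  rw [hrank]
  refine rank_relativeHomology_of_circle 𝔽 (((puncturedHomeo φ fun x => ?_).toHomotopyEquiv.trans
    (puncturedConeEquiv H.posHom hε)).trans
      (((Homeomorph.setCongr hL).trans (diamondHomeo.trans Homeomorph.ulift.symm)).toHomotopyEquiv)) k
  exact not_congr (hφ x)

lemma IsConical.rank_of_discrete (H : IsConical e h f v) {D : Type} [TopologicalSpace D]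
    [DiscreteTopology D] [Finite D] [Nonempty D] (E : lowerCircle h ≃ₕ D) (k : ℕ) :
    Module.rank 𝔽 (levelHomology 𝔽 f v k) =
      if k = 1 then ((Nat.card D - 1 : ℕ) : Cardinal) else 0 := by
  obtain ⟨ε, hε, U, φ, hφ, hrank⟩ := H.exists_model
  have := contractibleSpace_lowerCone H.posHom hε
  have : ContractibleSpace U := φ.contractibleSpace
  have E' : (Subtype.val ⁻¹' {x | (x : M) ≠ v} : Set U) ≃ₕ ULift.{u} D :=
    (((puncturedHomeo φ fun x => not_congr (hφ x)).toHomotopyEquiv.trans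
    (puncturedConeEquiv H.posHom hε)).trans E).trans Homeomorph.ulift.symm.toHomotopyEquiv
  rw [hrank]
  have hne : (Subtype.val ⁻¹' {x | (x : M) ≠ v} : Set U).Nonempty :=
    ⟨_, (E'.invFun ⟨Classical.arbitrary D⟩).2⟩
  rw [rank_relativeHomology_of_discrete hne E' k, Nat.card_ulift]

end LocalHomology

end

noncomputable section

/-! ### Polytopes -/

section Polytopes

variable {n m : ℕ}

lemma IsPolytope.isCompact {P : Set (Fin n → ℝ)} (hP : IsPolytope P) : IsCompact P := by
  obtain ⟨s, rfl⟩ := hP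
  exact s.finite_toSet.isCompact_convexHull (𝕜 := ℝ)

lemma IsPolytope.convex {P : Set (Fin n → ℝ)} (hP : IsPolytope P) : Convex ℝ P := by
  obtain ⟨s, rfl⟩ := hP
  exact convex_convexHull ℝ _

/-- A point of a convex set that lies in no proper exposed face is a relative interior point. -/
lemma Convex.exists_add_smul_sub_mem {E : Type*} [NormedAddCommGroup E] [NormedSpace ℝ E]
    [FiniteDimensional ℝ E] {P : Set E} (hP : Convex ℝ P) {x : E} (hx : x ∈ P)
    (hF : ∀ F, IsExposed ℝ P F → x ∈ F → F = P) {p : E} (hp : p ∈ P) :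
    ∃ ε > (0 : ℝ), x + ε • (x - p) ∈ P := by
  -- With `x` as origin, the directions into `P` are considered inside their span `V`, where they
  -- form a convex set with nonempty interior. The claim becomes that 0 lies in this interior.
  set D : Set E := {u | x + u ∈ P} with hD
  set V := Submodule.span ℝ D with hV
  set C : Set V := (↑) ⁻¹' D with hC
  have hDc : Convex ℝ D := hP.translate_preimage_right x
  have hCc : Convex ℝ C := hDc.linear_preimage V.subtype
  have h0 : (0 : V) ∈ C := by simpa [hC, hD] using hx
  have hspan : affineSpan ℝ C = ⊤ := by
    rw [← AffineSubspace.direction_eq_top_iff_of_nonempty ⟨0, subset_affineSpan ℝ C h0⟩,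
      direction_affineSpan, vectorSpan_eq_span_vsub_set_right ℝ h0]
    simp only [vsub_eq_sub, sub_zero, image_id']
    exact Submodule.span_span_coe_preimage
  have hint : (interior C).Nonempty := hCc.interior_nonempty_iff_affineSpan_eq_top.2 hspan
  -- Otherwise a functional separates 0 from the interior. Extended to `E`, it is maximal on `P` at
  -- `x`, so the exposed face where it is maximal contains `x` and is all of `P`. But the functional
  -- is strictly smaller at interior points.
  have key : (0 : V) ∈ interior C := by
    by_contra hn
    obtain ⟨l, hl⟩ := geometric_hahn_banach_open_point hCc.interior isOpen_interior hn
    obtain ⟨L, hL⟩ := LinearMap.exists_extend l.toLinearMap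
    have hl0 : ∀ u ∈ C, l u ≤ 0 := by
      intro u hu
      have : u ∈ closure (interior C) := by
        rw [hCc.closure_interior_eq_closure_of_nonempty_interior hint]
        exact subset_closure hu
      have hcl : IsClosed {u | l u ≤ 0} := isClosed_le l.continuous continuous_const
      refine closure_minimal (fun u hu => ?_) hcl this
      simpa using (hl u hu).le
    have hLl : ∀ u (hu : u ∈ V), L u = l ⟨u, hu⟩ := fun u hu => congr($hL ⟨u, hu⟩)
    have hle : ∀ q ∈ P, L q ≤ L x := by
      intro q hq
      have hq' : q - x ∈ D := by simpa [hD] using hq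
      have := hl0 ⟨q - x, Submodule.subset_span hq'⟩ hq'
      rw [← hLl, map_sub] at this
      linarith
    have := hF {q ∈ P | ∀ w ∈ P, L w ≤ L q} (fun _ => ⟨L.toContinuousLinearMap, by simp⟩)
      ⟨hx, hle⟩
    obtain ⟨u, hu⟩ := hint
    have h1 := hl u hu
    have h2 : x + u.1 ∈ P := (interior_subset hu : u ∈ C)
    rw [← this] at h2
    have h3 := h2.2 x hx
    rw [map_add, hLl _ u.2] at h3
    simp only [map_zero] at h1
    linarith
  have hpV : x - p ∈ V := by
    have : p - x ∈ V := Submodule.subset_span (by simpa [hD] using hp)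
    simpa using V.neg_mem this
  have hcont : Filter.Tendsto (fun ε : ℝ => ε • (⟨x - p, hpV⟩ : V)) (𝓝[>] 0) (𝓝 0) := by
    have : Continuous fun ε : ℝ => ε • (⟨x - p, hpV⟩ : V) := by fun_prop
    simpa using (this.tendsto 0).mono_left nhdsWithin_le_nhds
  obtain ⟨ε, hε, hε0⟩ := ((hcont.eventually (mem_interior_iff_mem_nhds.1 key)).and
    self_mem_nhdsWithin).exists
  exact ⟨ε, hε0, hε⟩

/-- The point where the segment from `p` to `q` crosses the zero set of `l`. -/
def crossPt (l : (Fin n → ℝ) →ᵃ[ℝ] ℝ) (p q : Fin n → ℝ) : Fin n → ℝ :=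
  (l q - l p)⁻¹ • (l q • p - l p • q)

lemma affineMap_combo {E F : Type*} [AddCommGroup E] [Module ℝ E] [AddCommGroup F] [Module ℝ F]
    (l : E →ᵃ[ℝ] F) {a b : ℝ} (hab : a + b = 1) (p q : E) :
    l (a • p + b • q) = a • l p + b • l q :=
  Convex.combo_affine_apply hab

/-- If one endpoint is a convex combination, the crossing point is a convex combination of the
individual crossing points, with weights multiplied by the corresponding differences of `l` and
renormalized. This is done for `p` with `q` in `s`, and then for `q` with `p` in the hull. -/
lemma crossPt_mem {l : (Fin n → ℝ) →ᵃ[ℝ] ℝ} {s : Set (Fin n → ℝ)} {D : Set (Fin n → ℝ)}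
    (hD : Convex ℝ D) (hs : ∀ p ∈ s, ∀ q ∈ s, l p ≤ 0 → 0 < l q → crossPt l p q ∈ D)
    {p q : Fin n → ℝ} (hp : p ∈ convexHull ℝ {p ∈ s | l p ≤ 0})
    (hq : q ∈ convexHull ℝ {q ∈ s | 0 < l q}) : crossPt l p q ∈ D := by
  have h1 : ∀ q ∈ s, 0 < l q → ∀ p ∈ convexHull ℝ {p ∈ s | l p ≤ 0},
      l p ≤ 0 ∧ crossPt l p q ∈ D := by
    intro q hq hlq
    refine convexHull_min (t := {p | l p ≤ 0 ∧ crossPt l p q ∈ D})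
      (fun p hp => ⟨hp.2, hs p hp.1 q hq hp.2 hlq⟩) ?_
    rintro p₁ ⟨hp₁, h₁⟩ p₂ ⟨hp₂, h₂⟩ a b ha hb hab
    have hl := affineMap_combo l hab p₁ p₂
    simp only [smul_eq_mul] at hl
    have hle : l (a • p₁ + b • p₂) ≤ 0 := by rw [hl]; nlinarith
    refine ⟨hle, ?_⟩
    set d := l q - l (a • p₁ + b • p₂) with hd
    have hd0 : 0 < d := by linarith
    have e1 : 0 < l q - l p₁ := by linarith
    have e2 : 0 < l q - l p₂ := by linarith
    have hde : d = a * (l q - l p₁) + b * (l q - l p₂) := by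
      rw [hd, hl]; linear_combination (-(l q)) * hab
    convert hD h₁ h₂ (a := a * (l q - l p₁) / d) (b := b * (l q - l p₂) / d) (by positivity)
      (by positivity) (by rw [← add_div, ← hde, div_self hd0.ne']) using 1
    have c1 : ∀ w : Fin n → ℝ, l q - l w ≠ 0 → ∀ i,
        (l q - l w) * crossPt l w q i = l q * w i - l w * q i := by
      intro w hw i
      simp only [crossPt, Pi.smul_apply, Pi.sub_apply, smul_eq_mul]
      rw [← mul_assoc, mul_inv_cancel₀ hw, one_mul]
    ext i
    have f1 := c1 p₁ e1.ne' i
    have f2 := c1 p₂ e2.ne' i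
    have f3 := c1 (a • p₁ + b • p₂) hd0.ne' i
    rw [← hd, hl] at f3
    simp only [Pi.smul_apply, Pi.add_apply, smul_eq_mul] at f3 ⊢
    rw [div_mul_eq_mul_div, div_mul_eq_mul_div, ← add_div, eq_div_iff hd0.ne']
    linear_combination f3 - a * f1 - b * f2
  refine (convexHull_min (t := {q | 0 < l q ∧ crossPt l p q ∈ D})
      (fun q hq => ⟨hq.2, (h1 q hq.1 hq.2 p hp).2⟩) ?_ hq).2
  have hlp : l p ≤ 0 := by
    refine convexHull_min (t := {p | l p ≤ 0}) (fun p hp => hp.2) ?_ hp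
    exact (convex_Iic (0 : ℝ)).affine_preimage l
  rintro q₁ ⟨hq₁, h₁⟩ q₂ ⟨hq₂, h₂⟩ a b ha hb hab
  have hl := affineMap_combo l hab q₁ q₂
  simp only [smul_eq_mul] at hl
  have hle : 0 < l (a • q₁ + b • q₂) := by
    rw [hl]
    rcases ha.eq_or_lt with h | h
    · subst h; simp only [zero_add] at hab; subst hab; linarith
    · have := mul_pos h hq₁; have := mul_nonneg hb hq₂.le; linarith
  refine ⟨hle, ?_⟩
  set d := l (a • q₁ + b • q₂) - l p with hd
  have hd0 : 0 < d := by linarith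
  have e1 : 0 < l q₁ - l p := by linarith
  have e2 : 0 < l q₂ - l p := by linarith
  have hde : d = a * (l q₁ - l p) + b * (l q₂ - l p) := by
    rw [hd, hl]; linear_combination (l p) * hab
  convert hD h₁ h₂ (a := a * (l q₁ - l p) / d) (b := b * (l q₂ - l p) / d) (by positivity)
    (by positivity) (by rw [← add_div, ← hde, div_self hd0.ne']) using 1
  have c1 : ∀ w : Fin n → ℝ, l w - l p ≠ 0 → ∀ i,
      (l w - l p) * crossPt l p w i = l w * p i - l p * w i := by
    intro w hw i
    simp only [crossPt, Pi.smul_apply, Pi.sub_apply, smul_eq_mul]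
    rw [← mul_assoc, mul_inv_cancel₀ hw, one_mul]
  ext i
  have f1 := c1 q₁ e1.ne' i
  have f2 := c1 q₂ e2.ne' i
  have f3 := c1 (a • q₁ + b • q₂) hd0.ne' i
  rw [← hd, hl] at f3
  simp only [Pi.smul_apply, Pi.add_apply, smul_eq_mul] at f3 ⊢
  rw [div_mul_eq_mul_div, div_mul_eq_mul_div, ← add_div, eq_div_iff hd0.ne']
  linear_combination f3 - a * f1 - b * f2

lemma crossPt_mem_segment {l : (Fin n → ℝ) →ᵃ[ℝ] ℝ} {p q : Fin n → ℝ} (hp : l p ≤ 0)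
    (hq : 0 < l q) : crossPt l p q ∈ segment ℝ p q := by
  have : 0 < l q - l p := by linarith
  refine ⟨l q / (l q - l p), - l p / (l q - l p), by positivity,
    div_nonneg (by linarith) this.le, by rw [← add_div, ← sub_eq_add_neg, div_self this.ne'], ?_⟩
  ext i
  simp only [crossPt, Pi.smul_apply, Pi.add_apply, Pi.sub_apply, smul_eq_mul]
  ring

lemma apply_crossPt {l : (Fin n → ℝ) →ᵃ[ℝ] ℝ} {p q : Fin n → ℝ} (hp : l p ≤ 0)
    (hq : 0 < l q) : l (crossPt l p q) = 0 := by
  have h : 0 < l q - l p := by linarith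
  have e : crossPt l p q = (l q / (l q - l p)) • p + (- l p / (l q - l p)) • q := by
    ext i
    simp only [crossPt, Pi.smul_apply, Pi.add_apply, Pi.sub_apply, smul_eq_mul]
    ring
  rw [e, affineMap_combo l (by rw [← add_div, ← sub_eq_add_neg, div_self h.ne'])]
  simp only [smul_eq_mul]
  ring

/-- The intersection of a polytope with a closed half-space is a polytope. -/
lemma IsPolytope.inter_halfSpace {P : Set (Fin n → ℝ)} (hP : IsPolytope P)
    (l : (Fin n → ℝ) →ᵃ[ℝ] ℝ) : IsPolytope (P ∩ {x | l x ≤ 0}) := by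
  classical
  obtain ⟨s, rfl⟩ := hP
  -- The intersection is spanned by the given points in the half-space and the crossing points of
  -- all segments that join its two sides.
  refine ⟨s.filter (fun p => l p ≤ 0) ∪
    ((s.filter fun p => l p ≤ 0) ×ˢ (s.filter fun q => 0 < l q)).image
      fun z => crossPt l z.1 z.2, ?_⟩
  set C := s.filter (fun p => l p ≤ 0) ∪
    ((s.filter fun p => l p ≤ 0) ×ˢ (s.filter fun q => 0 < l q)).image
      fun z => crossPt l z.1 z.2 with hC
  have hCl : Convex ℝ {x | l x ≤ 0} := (convex_Iic (0 : ℝ)).affine_preimage l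
  apply subset_antisymm
  · rintro x ⟨hx, hlx⟩
    have hs : (s : Set (Fin n → ℝ)) = {p ∈ (s : Set (Fin n → ℝ)) | l p ≤ 0} ∪
        {q ∈ (s : Set (Fin n → ℝ)) | 0 < l q} := by
      ext p
      have := le_or_gt (l p) 0
      simp only [mem_union, mem_ofPred_eq]
      tauto
    have hsub : {p ∈ (s : Set (Fin n → ℝ)) | l p ≤ 0} ⊆ (C : Set (Fin n → ℝ)) := by
      intro p hp
      rw [hC]
      exact Finset.mem_coe.2 (Finset.mem_union_left _ (Finset.mem_filter.2 hp))
    rcases {q ∈ (s : Set (Fin n → ℝ)) | 0 < l q}.eq_empty_or_nonempty with h2 | h2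
    · rw [hs, h2, union_empty] at hx
      exact convexHull_mono hsub hx
    rcases {p ∈ (s : Set (Fin n → ℝ)) | l p ≤ 0}.eq_empty_or_nonempty with h1 | h1
    · rw [hs, h1, empty_union] at hx
      have : 0 < l x := convexHull_min (t := {x | 0 < l x}) (fun q hq => hq.2)
        ((convex_Ioi (0 : ℝ)).affine_preimage l) hx
      exact absurd hlx (not_le.2 this)
    rw [hs, convexHull_union h1 h2, mem_convexJoin] at hx
    obtain ⟨p, hp, q, hq, a, b, ha, hb, hab, rfl⟩ := hx
    have hpC : p ∈ convexHull ℝ (C : Set (Fin n → ℝ)) := convexHull_mono hsub hp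
    have hcC : crossPt l p q ∈ convexHull ℝ (C : Set (Fin n → ℝ)) := by
      refine crossPt_mem (convex_convexHull ℝ _) (fun p hp q hq h1 h2 => subset_convexHull ℝ _ ?_)
        hp hq
      rw [hC]
      exact Finset.mem_coe.2 (Finset.mem_union_right _ (Finset.mem_image.2 ⟨(p, q),
        Finset.mem_product.2 ⟨Finset.mem_filter.2 ⟨hp, h1⟩, Finset.mem_filter.2 ⟨hq, h2⟩⟩, rfl⟩))
    have hlp : l p ≤ 0 := convexHull_min (t := {p | l p ≤ 0}) (fun p hp => hp.2) hCl hp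
    have hlq : 0 < l q := convexHull_min (t := {q | 0 < l q}) (fun p hp => hp.2)
      ((convex_Ioi (0 : ℝ)).affine_preimage l) hq
    have hl := affineMap_combo l hab p q
    simp only [smul_eq_mul] at hl
    have hlx' : a * l p + b * l q ≤ 0 := by rw [← hl]; exact hlx
    rcases hlp.eq_or_lt with h0 | h0
    · have : b = 0 := by
        rw [h0, mul_zero, zero_add] at hlx'
        by_contra hb0
        exact absurd hlx' (not_le.2 (mul_pos (lt_of_le_of_ne hb (Ne.symm hb0)) hlq))
      subst this
      rw [add_zero] at hab
      simpa [hab] using hpC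
    · have hd : 0 < l q - l p := by linarith
      have hn : 0 < - l p := by linarith
      -- The point lies on the segment from `p` to the crossing point. Comparing values of `l`,
      -- which is zero at the crossing point, gives this weight for the latter.
      have hμ : b * (l q - l p) / (- l p) ≤ 1 := by
        rw [div_le_one hn]
        have : a = 1 - b := by linarith
        subst this; nlinarith
      convert convex_convexHull ℝ (C : Set (Fin n → ℝ)) hpC hcC
        (a := 1 - b * (l q - l p) / (- l p)) (b := b * (l q - l p) / (- l p)) (by linarith)
        (by positivity) (by ring) using 1
      have : a = 1 - b := by linarith
      subst this
      ext i
      simp only [crossPt, Pi.smul_apply, Pi.add_apply, Pi.sub_apply, smul_eq_mul]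
      have := h0.ne
      field_simp
      ring
  · refine convexHull_min ?_ ((convex_convexHull ℝ _).inter hCl)
    intro x hx
    rw [hC] at hx
    rcases Finset.mem_union.1 (Finset.mem_coe.1 hx) with hx | hx
    · have := Finset.mem_filter.1 hx
      exact ⟨subset_convexHull ℝ _ this.1, this.2⟩
    · obtain ⟨⟨p, q⟩, hpq, rfl⟩ := Finset.mem_image.1 hx
      obtain ⟨hp, hq⟩ := Finset.mem_product.1 hpq
      obtain ⟨hp, hp'⟩ := Finset.mem_filter.1 hp
      obtain ⟨hq, hq'⟩ := Finset.mem_filter.1 hq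
      refine ⟨(convex_convexHull ℝ _).segment_subset (subset_convexHull ℝ _ hp)
        (subset_convexHull ℝ _ hq) (crossPt_mem_segment hp' hq'), ?_⟩
      exact (apply_crossPt hp' hq').le

lemma isPLOn_of_finite {g : (Fin n → ℝ) → (Fin m → ℝ)} {S : Set (Fin n → ℝ)}
    (h : ∀ x ∈ S, ∃ U ∈ 𝓝 x, ∃ (J : Type) (_ : Finite J) (Q : J → Set (Fin n → ℝ))
      (A : J → ((Fin n → ℝ) →ᵃ[ℝ] (Fin m → ℝ))),
      (∀ i, IsPolytope (Q i)) ∧ S ∩ U ⊆ ⋃ i, Q i ∧ ∀ i, EqOn g (A i) (S ∩ U ∩ Q i)) :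
    IsPLOn g S := by
  intro x hx
  obtain ⟨U, hU, J, _, Q, A, hQ, hcov, heq⟩ := h x hx
  let e := Finite.equivFin J
  refine ⟨U, hU, Nat.card J, fun i => Q (e.symm i), fun i => A (e.symm i), fun i => hQ _, ?_,
    fun i => heq _⟩
  intro y hy
  obtain ⟨j, hj⟩ := mem_iUnion.1 (hcov hy)
  exact mem_iUnion.2 ⟨e j, by simpa using hj⟩

/-- Composing a piecewise linear map with a map that is affine on each of finitely many sectors
gives a piecewise linear map. -/
lemma IsPLOn.comp_sectors {k : ℕ} {g : (Fin n → ℝ) → (Fin m → ℝ)} {S S' : Set (Fin n → ℝ)}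
    (hg : IsPLOn g S) (hS : S' ⊆ S) {ψ : (Fin m → ℝ) → (Fin k → ℝ)} {J : Type} [Finite J]
    (l₁ l₂ : J → ((Fin m → ℝ) →ᵃ[ℝ] ℝ)) (L : J → ((Fin m → ℝ) →ᵃ[ℝ] (Fin k → ℝ)))
    (hcov : ∀ y, ∃ j, l₁ j y ≤ 0 ∧ l₂ j y ≤ 0)
    (hL : ∀ j y, l₁ j y ≤ 0 → l₂ j y ≤ 0 → ψ y = L j y) : IsPLOn (fun x => ψ (g x)) S' := by
  refine isPLOn_of_finite fun x hx => ?_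
  obtain ⟨U, hU, N, Q, A, hQ, hQc, heq⟩ := hg x (hS hx)
  refine ⟨U, hU, Fin N × J, inferInstance,
    fun z => (Q z.1 ∩ {x | (l₁ z.2).comp (A z.1) x ≤ 0}) ∩ {x | (l₂ z.2).comp (A z.1) x ≤ 0},
    fun z => (L z.2).comp (A z.1), fun z => ((hQ _).inter_halfSpace _).inter_halfSpace _, ?_, ?_⟩
  · intro y hy
    obtain ⟨i, hi⟩ := mem_iUnion.1 (hQc ⟨hS hy.1, hy.2⟩)
    obtain ⟨j, hj⟩ := hcov (A i y)
    exact mem_iUnion.2 ⟨(i, j), ⟨hi, hj.1⟩, hj.2⟩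
  · rintro ⟨i, j⟩ y ⟨hy, ⟨hyQ, h1⟩, h2⟩
    have : g y = A i y := heq i ⟨⟨hS hy.1, hy.2⟩, hyQ⟩
    change ψ (g y) = L j (A i y)
    rw [this]
    exact hL j _ h1 h2

/-- Near a point of a convex set, a piecewise linear map is conical. -/
lemma IsPLOn.exists_cone {g : (Fin n → ℝ) → (Fin m → ℝ)} {S P : Set (Fin n → ℝ)} {p : Fin n → ℝ}
    (hg : IsPLOn g S) (hp : p ∈ S) (hP : Convex ℝ P) (hpP : p ∈ P) {δ₀ : ℝ} (hδ₀ : 0 < δ₀)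
    (hS : P ∩ Metric.ball p δ₀ ⊆ S) :
    ∃ δ > 0, P ∩ Metric.ball p δ ⊆ S ∧ ∃ (N : ℕ) (C : Fin N → Set (Fin n → ℝ))
      (A : Fin N → ((Fin n → ℝ) →ᵃ[ℝ] (Fin m → ℝ))), (∀ i, Convex ℝ (C i)) ∧
      (∀ i, C i ⊆ P ∩ Metric.ball p δ) ∧ P ∩ Metric.ball p δ ⊆ ⋃ i, C i ∧
      (∀ i, EqOn g (A i) (C i)) ∧
      ∀ x ∈ P ∩ Metric.ball p δ, ∀ t ∈ Icc (0 : ℝ) 1,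
        g (p + t • (x - p)) = g p + t • (g x - g p) := by
  classical
  obtain ⟨U, hU, N, Q, A, hQ, hQc, heq⟩ := hg p hp
  -- Polytopes are closed, so near `p` only those containing `p` matter. On such a piece the map is
  -- affine along the segments from `p`, which gives homogeneity.
  have hV : ∀ i, ∀ᶠ y in 𝓝 p, y ∈ Q i → p ∈ Q i := by
    intro i
    by_cases h : p ∈ Q i
    · exact .of_forall fun _ _ => h
    · filter_upwards [(hQ i).isCompact.isClosed.isOpen_compl.mem_nhds h] with y hy hy'
      exact absurd hy' hy
  obtain ⟨δ₁, hδ₁, hb⟩ := Metric.eventually_nhds_iff_ball.1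
    ((Filter.eventually_all.2 hV).and hU)
  refine ⟨min δ₀ δ₁, lt_min hδ₀ hδ₁, ?_, N,
    fun i => if p ∈ Q i then P ∩ Metric.ball p (min δ₀ δ₁) ∩ Q i else ∅, A, ?_, ?_, ?_, ?_, ?_⟩
  · exact fun x hx => hS ⟨hx.1, Metric.ball_subset_ball (min_le_left _ _) hx.2⟩
  · intro i
    beta_reduce
    split_ifs
    · exact (hP.inter (convex_ball _ _)).inter (hQ i).convex
    · exact convex_empty
  · intro i
    beta_reduce
    split_ifs
    · exact inter_subset_left
    · exact empty_subset _
  · rintro x ⟨hx, hxb⟩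
    have h1 := hS ⟨hx, Metric.ball_subset_ball (min_le_left _ _) hxb⟩
    have h2 := hb x (Metric.ball_subset_ball (min_le_right _ _) hxb)
    obtain ⟨i, hi⟩ := mem_iUnion.1 (hQc ⟨h1, h2.2⟩)
    refine mem_iUnion.2 ⟨i, ?_⟩
    rw [if_pos (h2.1 i hi)]
    exact ⟨⟨hx, hxb⟩, hi⟩
  · intro i x hx
    beta_reduce at hx
    split_ifs at hx with hpi
    · have h1 := hS ⟨hx.1.1, Metric.ball_subset_ball (min_le_left _ _) hx.1.2⟩
      have h2 := hb x (Metric.ball_subset_ball (min_le_right _ _) hx.1.2)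
      exact heq i ⟨⟨h1, h2.2⟩, hx.2⟩
    · exact hx.elim
  · rintro x ⟨hx, hxb⟩ t ht
    have key : ∀ y ∈ P ∩ Metric.ball p (min δ₀ δ₁), y ∈ S ∩ U := fun y hy =>
      ⟨hS ⟨hy.1, Metric.ball_subset_ball (min_le_left _ _) hy.2⟩,
        (hb y (Metric.ball_subset_ball (min_le_right _ _) hy.2)).2⟩
    have h2 := hb x (Metric.ball_subset_ball (min_le_right _ _) hxb)
    obtain ⟨i, hi⟩ := mem_iUnion.1 (hQc (key x ⟨hx, hxb⟩))
    have hpi := h2.1 i hi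
    have hpb : p ∈ Metric.ball p (min δ₀ δ₁) := Metric.mem_ball_self (lt_min hδ₀ hδ₁)
    have e : p + t • (x - p) = (1 - t) • p + t • x := by module
    have h1t : 0 ≤ 1 - t := by linarith [ht.2]
    have hst : 1 - t + t = 1 := by ring
    have hz := key _ ⟨hP hpP hx h1t ht.1 hst, convex_ball p _ hpb hxb h1t ht.1 hst⟩
    rw [e, heq i ⟨hz, (hQ i).convex hpi hi h1t ht.1 hst⟩, affineMap_combo _ hst,
      heq i ⟨key p ⟨hpP, hpb⟩, hpi⟩, heq i ⟨key x ⟨hx, hxb⟩, hi⟩]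
    module

end Polytopes

end

noncomputable section

/-! ### Cells of a polytopal complex -/

namespace PolytopalComplex

variable {M : Type u} [TopologicalSpace M] (K : PolytopalComplex M)

lemma convex_polytope (c : K.Cell) : Convex ℝ (K.polytope c) := (K.isPolytope c).convex

lemma isCompact_cell (c : K.Cell) : IsCompact (K.cell c) :=
  (K.isPolytope c).isCompact.image_of_continuousOn (K.continuousOn_param c)

lemma isClosed_cell [T2Space M] (c : K.Cell) : IsClosed (K.cell c) := (K.isCompact_cell c).isClosed

lemma exists_mem_cell (x : M) : ∃ c, x ∈ K.cell c := by
  have : x ∈ ⋃ c, K.cell c := by rw [show (⋃ c, K.cell c) = univ from K.cover]; trivial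
  exact mem_iUnion.1 this

lemma mem_cell_of_mem {c : K.Cell} {q : Fin K.n → ℝ} (hq : q ∈ K.polytope c) :
    K.param c q ∈ K.cell c := ⟨q, hq, rfl⟩

/-- The relative position of two points does not depend on the cell in which it is computed. -/
lemma param_combo_eq {c₁ c₂ : K.Cell} {p₁ q₁ p₂ q₂ : Fin K.n → ℝ} (hp₁ : p₁ ∈ K.polytope c₁)
    (hq₁ : q₁ ∈ K.polytope c₁) (hp₂ : p₂ ∈ K.polytope c₂) (hq₂ : q₂ ∈ K.polytope c₂)
    (hp : K.param c₁ p₁ = K.param c₂ p₂) (hq : K.param c₁ q₁ = K.param c₂ q₂) {t : ℝ}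
    (ht : t ∈ Icc (0 : ℝ) 1) :
    K.param c₁ (p₁ + t • (q₁ - p₁)) = K.param c₂ (p₂ + t • (q₂ - p₂)) := by
  have hpm : K.param c₁ p₁ ∈ K.cell c₁ ∩ K.cell c₂ := ⟨⟨_, hp₁, rfl⟩, ⟨_, hp₂, hp.symm⟩⟩
  have hqm : K.param c₁ q₁ ∈ K.cell c₁ ∩ K.cell c₂ := ⟨⟨_, hq₁, rfl⟩, ⟨_, hq₂, hq.symm⟩⟩
  obtain ⟨d, hd, ⟨A, hA, hA'⟩, B, hB, hB'⟩ := K.inter_face c₁ c₂ ⟨_, hpm⟩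
  change _ = K.cell c₁ ∩ K.cell c₂ at hd
  rw [← hd] at hpm hqm
  obtain ⟨p, hpd, hpe⟩ := hpm
  obtain ⟨q, hqd, hqe⟩ := hqm
  have h1 : 0 ≤ 1 - t := by linarith [ht.2]
  have h2 : 1 - t + t = 1 := by ring
  have hz := K.convex_polytope d hpd hqd h1 ht.1 h2
  have e : ∀ a b : Fin K.n → ℝ, a + t • (b - a) = (1 - t) • a + t • b := fun a b => by module
  have a1 : p₁ = A p := K.injOn_param c₁ hp₁ (hA.subset ⟨_, hpd, rfl⟩) (by rw [hA' p hpd, hpe])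
  have a2 : q₁ = A q := K.injOn_param c₁ hq₁ (hA.subset ⟨_, hqd, rfl⟩) (by rw [hA' q hqd, hqe])
  have b1 : p₂ = B p := K.injOn_param c₂ hp₂ (hB.subset ⟨_, hpd, rfl⟩) (by
    rw [hB' p hpd, hpe, hp])
  have b2 : q₂ = B q := K.injOn_param c₂ hq₂ (hB.subset ⟨_, hqd, rfl⟩) (by
    rw [hB' q hqd, hqe, hq])
  rw [e, e, a1, a2, b1, b2, ← affineMap_combo A h2, ← affineMap_combo B h2, hA' _ hz, hB' _ hz]

/-- Cells are extreme in each other. -/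
lemma mem_cell_of_combo_mem {c d : K.Cell} {p q : Fin K.n → ℝ} (hp : p ∈ K.polytope c)
    (hq : q ∈ K.polytope c) {t : ℝ} (h0 : 0 < t) (h1 : t < 1)
    (hz : K.param c (p + t • (q - p)) ∈ K.cell d) : K.param c p ∈ K.cell d ∧
      K.param c q ∈ K.cell d := by
  have e : p + t • (q - p) = (1 - t) • p + t • q := by module
  rw [e] at hz
  have h2 : 1 - t + t = 1 := by ring
  have hzc := K.convex_polytope c hp hq (by linarith) h0.le h2
  obtain ⟨d', hd, ⟨A, hA, hA'⟩, -⟩ := K.inter_face c d ⟨_, ⟨_, hzc, rfl⟩, hz⟩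
  change _ = K.cell c ∩ K.cell d at hd
  have hzd : K.param c ((1 - t) • p + t • q) ∈ K.cell c ∩ K.cell d := ⟨⟨_, hzc, rfl⟩, hz⟩
  rw [← hd] at hzd
  obtain ⟨z, hz', hze⟩ := hzd
  have hzA : (1 - t) • p + t • q ∈ A '' K.polytope d' := ⟨z, hz', K.injOn_param c
    (hA.subset ⟨_, hz', rfl⟩) hzc (by rw [hA' z hz', hze])⟩
  have hseg : (1 - t) • p + t • q ∈ openSegment ℝ p q := ⟨1 - t, t, by linarith, h0, h2, rfl⟩
  have hseg' : (1 - t) • p + t • q ∈ openSegment ℝ q p := by rwa [openSegment_symm]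
  have key : ∀ w ∈ A '' K.polytope d', K.param c w ∈ K.cell d := by
    rintro _ ⟨w, hw, rfl⟩
    rw [hA' w hw]
    exact (hd.subset ⟨w, hw, rfl⟩ : _ ∈ K.cell c ∩ K.cell d).2
  exact ⟨key _ (hA.isExtreme.left_mem_of_mem_openSegment hp hq hzA hseg),
    key _ (hA.isExtreme.left_mem_of_mem_openSegment hq hp hzA hseg')⟩

/-- Every point has a smallest cell that contains it, and it lies in the relative interior of
this cell. -/
lemma exists_carrier (x : M) : ∃ d, ∃ z ∈ K.polytope d, K.param d z = x ∧
    (∀ c, x ∈ K.cell c → K.cell d ⊆ K.cell c) ∧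
    ∀ p ∈ K.polytope d, ∃ ε > (0 : ℝ), z + ε • (z - p) ∈ K.polytope d := by
  have := K.finite_cell
  obtain ⟨d, hd⟩ := (Set.toFinite {c | x ∈ K.cell c}).exists_minimalFor K.cell _
    (K.exists_mem_cell x)
  obtain ⟨z, hz, hzx⟩ := hd.1
  have hmin : ∀ c, x ∈ K.cell c → K.cell c ⊆ K.cell d → K.cell d ⊆ K.cell c :=
    fun c hc hcd => hd.2 hc hcd
  refine ⟨d, z, hz, hzx, fun c hc => ?_, fun p hp => ?_⟩
  · obtain ⟨d', hd', -⟩ := K.inter_face d c ⟨x, hd.1, hc⟩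
    change K.cell d' = K.cell d ∩ K.cell c at hd'
    have h1 : x ∈ K.cell d' := by rw [hd']; exact ⟨hd.1, hc⟩
    exact (hmin d' h1 (hd'.subset.trans inter_subset_left)).trans
      (hd'.subset.trans inter_subset_right)
  -- A proper exposed face through `z` would be a smaller cell containing `x`.
  · refine (K.convex_polytope d).exists_add_smul_sub_mem hz (fun F hF hzF => ?_) hp
    obtain ⟨c', A, hA, hA'⟩ := K.exists_face d F hF ⟨z, hzF⟩
    have hc' : K.cell c' = K.param d '' F := by
      rw [← hA, image_image]
      exact image_congr fun w hw => (hA' w hw).symm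
    have h1 : K.cell d ⊆ K.cell c' := hmin c' (by rw [hc']; exact ⟨z, hzF, hzx⟩)
      (by rw [hc']; exact image_mono hF.subset)
    refine hF.subset.antisymm fun w hw => ?_
    have : K.param d w ∈ K.param d '' F := hc' ▸ h1 ⟨w, hw, rfl⟩
    obtain ⟨w', hw', he⟩ := this
    rwa [← K.injOn_param d (hF.subset hw') hw he]

/-- A minimal cell inside `d` coincides with each of its faces on which a coordinate is maximal. All
coordinates are then constant on it, so it is a point. -/
lemma exists_vertex_mem_cell (d : K.Cell) : ∃ w ∈ K.vertices, w ∈ K.cell d := by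
  have := K.finite_cell
  obtain ⟨c, hc⟩ := (Set.toFinite {c | K.cell c ⊆ K.cell d}).exists_minimalFor K.cell _
    ⟨d, (subset_rfl : K.cell d ⊆ K.cell d)⟩
  have hcd : K.cell c ⊆ K.cell d := hc.1
  obtain ⟨p, hp⟩ := K.nonempty c
  refine ⟨K.param c p, ⟨c, ?_⟩, hcd ⟨p, hp, rfl⟩⟩
  suffices h : ∀ q ∈ K.polytope c, q = p by
    apply Set.eq_singleton_iff_unique_mem.2
    exact ⟨⟨p, hp, rfl⟩, by rintro _ ⟨q, hq, rfl⟩; rw [h q hq]⟩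
  have key : ∀ i, ∀ q ∈ K.polytope c, ∀ w ∈ K.polytope c, w i ≤ q i := by
    intro i
    set l : StrongDual ℝ (Fin K.n → ℝ) := ContinuousLinearMap.proj i
    obtain ⟨a, ha, hmax⟩ := (K.isPolytope c).isCompact.exists_isMaxOn ⟨p, hp⟩
      l.continuous.continuousOn
    have hF : IsExposed ℝ (K.polytope c) {q ∈ K.polytope c | ∀ w ∈ K.polytope c, l w ≤ l q} :=
      fun _ => ⟨l, rfl⟩
    obtain ⟨c', A, hA, hA'⟩ := K.exists_face c _ hF ⟨a, ha, fun w hw => hmax hw⟩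
    have hc' : K.cell c' = K.param c '' {q ∈ K.polytope c | ∀ w ∈ K.polytope c, l w ≤ l q} := by
      rw [← hA, image_image]
      exact image_congr fun w hw => (hA' w hw).symm
    have h1 : K.cell c' ⊆ K.cell c := by rw [hc']; exact image_mono hF.subset
    have h2 : K.cell c ⊆ K.cell c' := hc.2 (h1.trans hcd : K.cell c' ⊆ K.cell d) h1
    intro q hq w hw
    have : K.param c q ∈ K.cell c' := h2 ⟨q, hq, rfl⟩
    rw [hc'] at this
    obtain ⟨q', hq', he⟩ := this
    rw [← K.injOn_param c hq'.1 hq he]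
    exact hq'.2 w hw
  intro q hq
  ext i
  exact le_antisymm (key i p hp q hq) (key i q hq p hp)

end PolytopalComplex

end

noncomputable section

/-! ### The star of a vertex -/

namespace PolytopalComplex

variable {M : Type u} [TopologicalSpace M] (K : PolytopalComplex M)

/-- The union of the cells that contain `v`. -/
def star (v : M) : Set M := {x | ∃ c, v ∈ K.cell c ∧ x ∈ K.cell c}

open Classical in
/-- The dilation with factor `t` of the star of `v`. -/
def dil (v : M) (t : ℝ) (x : M) : M :=
  if h : ∃ z : K.Cell × (Fin K.n → ℝ) × (Fin K.n → ℝ), z.2.1 ∈ K.polytope z.1 ∧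
      z.2.2 ∈ K.polytope z.1 ∧ K.param z.1 z.2.1 = v ∧ K.param z.1 z.2.2 = x
  then K.param h.choose.1 (h.choose.2.1 + t • (h.choose.2.2 - h.choose.2.1)) else x

variable {K} {v : M}

/-- The choice in the definition of `dil` is immaterial, because the transitions between cells are
affine (`param_combo_eq`). -/
lemma dil_param {c : K.Cell} {p q : Fin K.n → ℝ} (hp : p ∈ K.polytope c) (hpv : K.param c p = v)
    (hq : q ∈ K.polytope c) {t : ℝ} (ht : t ∈ Icc (0 : ℝ) 1) :
    K.dil v t (K.param c q) = K.param c (p + t • (q - p)) := by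
  have h : ∃ z : K.Cell × (Fin K.n → ℝ) × (Fin K.n → ℝ), z.2.1 ∈ K.polytope z.1 ∧
      z.2.2 ∈ K.polytope z.1 ∧ K.param z.1 z.2.1 = v ∧ K.param z.1 z.2.2 = K.param c q :=
    ⟨(c, p, q), hp, hq, hpv, rfl⟩
  rw [dil, dif_pos h]
  obtain ⟨h1, h2, h3, h4⟩ := h.choose_spec
  exact K.param_combo_eq h1 h2 hp hq (h3.trans hpv.symm) h4 ht

lemma combo_mem {c : K.Cell} {p q : Fin K.n → ℝ} (hp : p ∈ K.polytope c)
    (hq : q ∈ K.polytope c) {t : ℝ} (ht : t ∈ Icc (0 : ℝ) 1) : p + t • (q - p) ∈ K.polytope c := by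
  have e : p + t • (q - p) = (1 - t) • p + t • q := by module
  rw [e]
  exact K.convex_polytope c hp hq (by linarith [ht.2]) ht.1 (by ring)

lemma dil_mem_star {x : M} (hx : x ∈ K.star v) {t : ℝ} (ht : t ∈ Icc (0 : ℝ) 1) :
    K.dil v t x ∈ K.star v := by
  obtain ⟨c, ⟨p, hp, rfl⟩, q, hq, rfl⟩ := hx
  rw [dil_param hp rfl hq ht]
  exact ⟨c, ⟨p, hp, rfl⟩, _, combo_mem hp hq ht, rfl⟩

lemma dil_zero {x : M} (hx : x ∈ K.star v) : K.dil v 0 x = v := by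
  obtain ⟨c, ⟨p, hp, rfl⟩, q, hq, rfl⟩ := hx
  rw [dil_param hp rfl hq (by simp)]
  simp

lemma dil_one {x : M} (hx : x ∈ K.star v) : K.dil v 1 x = x := by
  obtain ⟨c, ⟨p, hp, rfl⟩, q, hq, rfl⟩ := hx
  rw [dil_param hp rfl hq (by simp)]
  simp

lemma apply_dil {f : M → ℝ} (hf : K.IsGenericPL f) {x : M} (hx : x ∈ K.star v) {t : ℝ}
    (ht : t ∈ Icc (0 : ℝ) 1) : f (K.dil v t x) = f v + t * (f x - f v) := by
  obtain ⟨c, ⟨p, hp, rfl⟩, q, hq, rfl⟩ := hx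
  obtain ⟨A, hA⟩ := hf.1 c
  have e : p + t • (q - p) = (1 - t) • p + t • q := by module
  rw [dil_param hp rfl hq ht, hA _ (combo_mem hp hq ht), hA _ hp, hA _ hq, e,
    affineMap_combo A (by ring)]
  simp only [smul_eq_mul]; ring

/-- A cell that contains an inner point of the segment from `v` to `x` contains `v` and `x`. -/
lemma mem_cell_of_dil_mem {x : M} (hx : x ∈ K.star v) {d : K.Cell} {t : ℝ} (h0 : 0 < t)
    (h1 : t < 1) (h : K.dil v t x ∈ K.cell d) : v ∈ K.cell d ∧ x ∈ K.cell d := by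
  obtain ⟨c, ⟨p, hp, rfl⟩, q, hq, rfl⟩ := hx
  rw [dil_param hp rfl hq ⟨h0.le, h1.le⟩] at h
  exact K.mem_cell_of_combo_mem hp hq h0 h1 h

/-- Two points with equal images lie in a common cell, since a cell containing an inner point of a
segment contains its ends. Within one cell a dilation is injective. -/
lemma dil_injOn {t : ℝ} (h0 : 0 < t) (h1 : t < 1) : InjOn (K.dil v t) (K.star v) := by
  intro x hx y hy hxy
  obtain ⟨c, ⟨p, hp, rfl⟩, q, hq, rfl⟩ := id hx
  have h : K.dil (K.param c p) t y ∈ K.cell c := by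
    rw [← hxy, dil_param hp rfl hq ⟨h0.le, h1.le⟩]
    exact ⟨_, combo_mem hp hq ⟨h0.le, h1.le⟩, rfl⟩
  obtain ⟨-, q', hq', rfl⟩ := mem_cell_of_dil_mem hy h0 h1 h
  rw [dil_param hp rfl hq ⟨h0.le, h1.le⟩, dil_param hp rfl hq' ⟨h0.le, h1.le⟩] at hxy
  have := K.injOn_param c (combo_mem hp hq ⟨h0.le, h1.le⟩) (combo_mem hp hq' ⟨h0.le, h1.le⟩) hxy
  have := smul_right_injective _ h0.ne' (add_left_cancel this)
  rw [sub_left_inj.1 this]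

lemma star_eq : K.star v = ⋃ c : {c // v ∈ K.cell c}, K.cell c := by
  ext x
  simp [star]

section Topology

variable [T2Space M]

lemma continuousOn_cell {Y : Type*} [TopologicalSpace Y] {g : M → Y} {c : K.Cell}
    (h : ContinuousOn (fun q => g (K.param c q)) (K.polytope c)) : ContinuousOn g (K.cell c) := by
  have : CompactSpace (K.polytope c) := isCompact_iff_compactSpace.1 (K.isPolytope c).isCompact
  let π : K.polytope c → K.cell c := fun q => ⟨K.param c q, q, q.2, rfl⟩
  have hπ : Continuous π := by
    have := (continuousOn_iff_continuous_domRestrict.1 (K.continuousOn_param c))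
    exact Continuous.subtype_mk this _
  have hs : Function.Surjective π := by
    rintro ⟨_, q, hq, rfl⟩
    exact ⟨⟨q, hq⟩, rfl⟩
  have hq : IsQuotientMap π := hπ.isClosedMap.isQuotientMap hπ hs
  rw [continuousOn_iff_continuous_domRestrict, hq.continuous_iff]
  exact continuousOn_iff_continuous_domRestrict.1 h

lemma continuousOn_star {Y : Type*} [TopologicalSpace Y] {g : M → Y}
    (h : ∀ c, v ∈ K.cell c → ContinuousOn (fun q => g (K.param c q)) (K.polytope c)) :
    ContinuousOn g (K.star v) := by
  have := K.finite_cell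
  rw [star_eq]
  exact (locallyFinite_of_finite _).continuousOn_iUnion (fun c => K.isClosed_cell _)
    (fun c => continuousOn_cell (h c c.2))

lemma continuousOn_dil {t : ℝ} (ht : t ∈ Icc (0 : ℝ) 1) : ContinuousOn (K.dil v t) (K.star v) := by
  refine continuousOn_star ?_
  rintro c ⟨p, hp, rfl⟩
  have : ContinuousOn (fun q => K.param c (p + t • (q - p))) (K.polytope c) :=
    (K.continuousOn_param c).comp (by fun_prop) fun q hq => combo_mem hp hq ht
  exact this.congr fun q hq => dil_param hp rfl hq ht

lemma star_mem_nhds : K.star v ∈ 𝓝 v := by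
  have := K.finite_cell
  have hcl : IsClosed (⋃ c : {c // v ∉ K.cell c}, K.cell c) :=
    isClosed_iUnion_of_finite fun c => K.isClosed_cell _
  have hv : v ∉ ⋃ c : {c // v ∉ K.cell c}, K.cell c := by
    simp
  filter_upwards [hcl.isOpen_compl.mem_nhds hv] with x hx
  obtain ⟨c, hc⟩ := K.exists_mem_cell x
  refine ⟨c, ?_, hc⟩
  by_contra h
  exact hx (mem_iUnion.2 ⟨⟨c, h⟩, hc⟩)

/-- The part of the polytope away from `p` is compact, so its image is closed and misses `v`. -/
lemma eventually_dist_lt {c : K.Cell} {p : Fin K.n → ℝ} (hp : p ∈ K.polytope c)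
    (hpv : K.param c p = v) {δ : ℝ} (hδ : 0 < δ) :
    ∀ᶠ x in 𝓝 v, ∀ q ∈ K.polytope c, K.param c q = x → q ∈ Metric.ball p δ := by
  have hcp : IsCompact (K.polytope c \ Metric.ball p δ) :=
    (K.isPolytope c).isCompact.diff Metric.isOpen_ball
  have hcl : IsClosed (K.param c '' (K.polytope c \ Metric.ball p δ)) :=
    (hcp.image_of_continuousOn ((K.continuousOn_param c).mono sdiff_subset)).isClosed
  have hv : v ∉ K.param c '' (K.polytope c \ Metric.ball p δ) := by
    rintro ⟨q, hq, hqv⟩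
    rw [K.injOn_param c hq.1 hp (hqv.trans hpv.symm)] at hq
    exact hq.2 (Metric.mem_ball_self hδ)
  filter_upwards [hcl.isOpen_compl.mem_nhds hv] with x hx q hq hqx
  by_contra h
  exact hx ⟨q, ⟨hq, h⟩, hqx⟩

/-- The star of the centre of a piecewise linear chart embeds conically into the plane. -/
theorem IsPLChart.exists_star_map {m : ℕ} {e : OpenPartialHomeomorph M (Fin m → ℝ)}
    (he : K.IsPLChart e)
    (hv : v ∈ e.source) (hv0 : e v = 0) : ∃ Ψ : M → (Fin m → ℝ), ContinuousOn Ψ (K.star v) ∧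
      InjOn Ψ (K.star v) ∧
      (∀ x ∈ K.star v, ∀ t ∈ Icc (0 : ℝ) 1, Ψ (K.dil v t x) = t • Ψ x) ∧
      (∀ᶠ x in 𝓝 v, x ∈ K.star v ∧ x ∈ e.source ∧ Ψ x = e x ∧
        ∀ t ∈ Icc (0 : ℝ) 1, K.dil v t x ∈ e.source ∧ e (K.dil v t x) = t • e x) ∧
      ∃ (J : Type) (_ : Finite J) (κ : J → K.Cell) (C : J → Set (Fin K.n → ℝ))
        (A : J → ((Fin K.n → ℝ) →ᵃ[ℝ] (Fin m → ℝ))), (∀ j, Convex ℝ (C j)) ∧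
        (∀ j, C j ⊆ K.polytope (κ j)) ∧
        (∀ j, ∀ q ∈ C j, K.param (κ j) q ∈ K.star v ∧ K.param (κ j) q ∈ e.source ∧
          Ψ (K.param (κ j) q) = A j q) ∧
        ∀ᶠ x in 𝓝 v, ∃ j, ∃ q ∈ C j, K.param (κ j) q = x := by
  have := K.finite_cell
  have hloc : ∀ c : {c // v ∈ K.cell c}, ∃ p ∈ K.polytope c, K.param c p = v ∧ ∃ δ > 0,
      (∀ q ∈ K.polytope c ∩ Metric.ball p δ, K.param c q ∈ e.source) ∧
      (∃ (N : ℕ) (C : Fin N → Set (Fin K.n → ℝ))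
        (A : Fin N → ((Fin K.n → ℝ) →ᵃ[ℝ] (Fin m → ℝ))), (∀ i, Convex ℝ (C i)) ∧
        (∀ i, C i ⊆ K.polytope c ∩ Metric.ball p δ) ∧ K.polytope c ∩ Metric.ball p δ ⊆ ⋃ i, C i ∧
        (∀ i, EqOn (fun q => e (K.param c q)) (A i) (C i))) ∧
      ∀ q ∈ K.polytope c ∩ Metric.ball p δ, ∀ t ∈ Icc (0 : ℝ) 1,
        e (K.param c (p + t • (q - p))) = t • e (K.param c q) := by
    rintro ⟨c, p, hp, hpv⟩
    have h1 : ∀ᶠ q in 𝓝[K.polytope c] p, K.param c q ∈ e.source :=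
      (K.continuousOn_param c p hp).eventually (e.open_source.mem_nhds (hpv.symm ▸ hv))
    obtain ⟨δ₀, hδ₀, hb⟩ := Metric.mem_nhdsWithin_iff.1 h1
    obtain ⟨δ, hδ, hS, N, C, A, hC, hCs, hCc, hA, hcone⟩ := (he c).exists_cone (p := p)
      ⟨hp, by rw [mem_preimage, hpv]; exact hv⟩ (K.convex_polytope c) hp hδ₀
      (fun q hq => ⟨hq.1, hb ⟨hq.2, hq.1⟩⟩)
    refine ⟨p, hp, hpv, δ, hδ, fun q hq => (hS hq).2, ⟨N, C, A, hC, hCs, hCc, hA⟩, ?_⟩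
    intro q hq t ht
    have := hcone q hq t ht
    rwa [hpv, hv0, zero_add, sub_zero] at this
  choose p hp hpv δ hδ hsrc hpieces hcone using hloc
  choose N C A hC hCs hCc hA using hpieces
  have hball : ∀ c : {c // v ∈ K.cell c}, ∀ q ∈ K.polytope c ∩ Metric.ball (p c) (δ c),
      ∀ t ∈ Icc (0 : ℝ) 1, p c + t • (q - p c) ∈ K.polytope c ∩ Metric.ball (p c) (δ c) := by
    rintro c q ⟨hq, hqb⟩ t ht
    refine ⟨combo_mem (hp c) hq ht, ?_⟩
    have e : p c + t • (q - p c) = (1 - t) • p c + t • q := by module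
    rw [e]
    exact convex_ball _ _ (Metric.mem_ball_self (hδ c)) hqb (by linarith [ht.2]) ht.1 (by ring)
  -- One dilation factor that shrinks every cell at `v`, hence the whole star, into the region where
  -- the chart is homogeneous. The polytopes are bounded and finite in number.
  obtain ⟨t₀, ht₀, ht01, htb⟩ : ∃ t₀ : ℝ, 0 < t₀ ∧ t₀ < 1 ∧ ∀ c : {c // v ∈ K.cell c},
      ∀ q ∈ K.polytope c, p c + t₀ • (q - p c) ∈ Metric.ball (p c) (δ c) := by
    have hev : ∀ c : {c // v ∈ K.cell c}, ∀ᶠ t in 𝓝[>] (0 : ℝ), ∀ q ∈ K.polytope c,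
        p c + t • (q - p c) ∈ Metric.ball (p c) (δ c) := by
      intro c
      obtain ⟨R, hR0, hR⟩ := (K.isPolytope c).isCompact.isBounded.exists_pos_norm_le
      have hpos : 0 < δ c / (R + R + 1) := div_pos (hδ c) (by linarith)
      filter_upwards [Ioo_mem_nhdsGT hpos] with t ht q hq
      rw [Metric.mem_ball, dist_eq_norm, add_sub_cancel_left, norm_smul,
        Real.norm_of_nonneg ht.1.le]
      have h1 : ‖q - p c‖ ≤ R + R := (norm_sub_le _ _).trans (add_le_add (hR q hq) (hR _ (hp c)))
      have h2 := (lt_div_iff₀ (by linarith)).1 ht.2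
      nlinarith [ht.1]
    obtain ⟨t, ht, ht'⟩ := ((Filter.eventually_all.2 hev).and
      (Ioo_mem_nhdsGT (zero_lt_one' ℝ))).exists
    exact ⟨t, ht'.1, ht'.2, ht⟩
  have ht0I : t₀ ∈ Icc (0 : ℝ) 1 := ⟨ht₀.le, ht01.le⟩
  -- The conical extension of the germ of the chart: shrink, apply the chart, enlarge again. It
  -- agrees with `e` near `v` by homogeneity, but it is defined on the whole star even where `e` is
  -- not.
  set Ψ : M → (Fin m → ℝ) := fun x => t₀⁻¹ • e (K.dil v t₀ x) with hΨ
  have hΨp : ∀ (c : {c // v ∈ K.cell c}), ∀ q ∈ K.polytope c,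
      Ψ (K.param c q) = t₀⁻¹ • e (K.param c (p c + t₀ • (q - p c))) := by
    intro c q hq
    simp only [hΨ]
    rw [dil_param (hp c) (hpv c) hq ht0I]
  have hΨe : ∀ (c : {c // v ∈ K.cell c}), ∀ q ∈ K.polytope c ∩ Metric.ball (p c) (δ c),
      Ψ (K.param c q) = e (K.param c q) := by
    intro c q hq
    rw [hΨp c q hq.1, hcone c q hq t₀ ht0I, smul_smul, inv_mul_cancel₀ ht₀.ne', one_smul]
  have hmaps : MapsTo (K.dil v t₀) (K.star v) e.source := by
    rintro x ⟨c, hc, q, hq, rfl⟩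
    rw [dil_param (hp ⟨c, hc⟩) (hpv ⟨c, hc⟩) hq ht0I]
    exact hsrc ⟨c, hc⟩ _ ⟨combo_mem (hp ⟨c, hc⟩) hq ht0I, htb ⟨c, hc⟩ q hq⟩
  have hnear : ∀ᶠ x in 𝓝 v, ∃ (c : {c // v ∈ K.cell c}), ∃ q ∈ K.polytope c ∩
      Metric.ball (p c) (δ c), K.param c q = x := by
    filter_upwards [star_mem_nhds (K := K), Filter.eventually_all.2 fun c =>
      eventually_dist_lt (hp c) (hpv c) (hδ c)] with x hx hx'
    obtain ⟨c, hc, q, hq, rfl⟩ := hx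
    exact ⟨⟨c, hc⟩, q, ⟨hq, hx' ⟨c, hc⟩ q hq rfl⟩, rfl⟩
  refine ⟨Ψ, ?_, ?_, ?_, ?_, (Σ c : {c // v ∈ K.cell c}, Fin (N c)), inferInstance,
    fun j => j.1, fun j => C j.1 j.2, fun j => A j.1 j.2, fun j => hC _ _,
    fun j => (hCs j.1 j.2).trans inter_subset_left, ?_, ?_⟩
  · have : ContinuousOn (fun x => e (K.dil v t₀ x)) (K.star v) :=
      e.continuousOn.comp (continuousOn_dil ht0I) hmaps
    exact this.const_smul t₀⁻¹
  · intro x hx y hy hxy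
    exact dil_injOn ht₀ ht01 hx hy (e.injOn (hmaps hx) (hmaps hy)
      (smul_right_injective _ (inv_ne_zero ht₀.ne') hxy))
  · rintro x ⟨c, hc, q, hq, rfl⟩ t ht
    have hp' := hp ⟨c, hc⟩
    rw [dil_param hp' (hpv ⟨c, hc⟩) hq ht, hΨp ⟨c, hc⟩ _ (combo_mem hp' hq ht),
      hΨp ⟨c, hc⟩ _ hq, smul_comm t]
    congr 1
    rw [← hcone ⟨c, hc⟩ _ ⟨combo_mem hp' hq ht0I, htb ⟨c, hc⟩ q hq⟩ t ht]
    congr 2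
    module
  · filter_upwards [hnear] with x hx
    obtain ⟨c, q, hq, rfl⟩ := hx
    refine ⟨⟨c, c.2, q, hq.1, rfl⟩, hsrc c q hq, hΨe c q hq, fun t ht => ?_⟩
    rw [dil_param (hp c) (hpv c) hq.1 ht]
    exact ⟨hsrc c _ (hball c q hq t ht), hcone c q hq t ht⟩
  · rintro ⟨c, i⟩ q hq
    have hq' := hCs c i hq
    refine ⟨⟨c, c.2, q, hq'.1, rfl⟩, hsrc c q hq', ?_⟩
    rw [hΨe c q hq']
    exact hA c i hq
  · filter_upwards [hnear] with x hx
    obtain ⟨c, q, hq, rfl⟩ := hx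
    obtain ⟨i, hi⟩ := mem_iUnion.1 (hCc c hq)
    exact ⟨⟨c, i⟩, q, hi, rfl⟩

end Topology

end PolytopalComplex

end

noncomputable section

/-! ### The conical model of a piecewise linear function at a vertex -/

/-- Near the origin, `h` is affine on each of finitely many convex sets. -/
def LocallyPL (h : (Fin 2 → ℝ) → ℝ) : Prop :=
  ∃ (J : Type) (_ : Finite J) (C : J → Set (Fin 2 → ℝ)), (∀ j, Convex ℝ (C j)) ∧
    (∀ j, ∀ y ∈ C j, ∀ z ∈ C j, ∀ a b : ℝ, 0 ≤ a → 0 ≤ b → a + b = 1 →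
      h (a • y + b • z) = a * h y + b * h z) ∧ ∀ᶠ y in 𝓝 0, ∃ j, y ∈ C j

/-- A germ at the origin that is homogeneous on a ball extends to a homogeneous function. -/
lemma exists_posHom_of_ball {F : (Fin 2 → ℝ) → ℝ} {ε : ℝ} (hε : 0 < ε)
    (hF : ContinuousOn F (Metric.ball 0 ε))
    (hhom : ∀ y, ‖y‖ < ε → ∀ t ∈ Icc (0 : ℝ) 1, F (t • y) = t * F y) :
    ∃ h : (Fin 2 → ℝ) → ℝ, Continuous h ∧ PosHom h ∧
      ∀ y, ∀ s : ℝ, 0 < s → ‖s • y‖ < ε → F (s • y) = s * h y := by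
  -- A scaling factor that brings `y` into the ball and depends continuously on `y`, also at the
  -- origin. This makes the continuity of `h` immediate.
  set σ : (Fin 2 → ℝ) → ℝ := fun y => (ε / 2) * (1 + ‖y‖)⁻¹ with hσ
  have hpos : ∀ y : Fin 2 → ℝ, 0 < 1 + ‖y‖ := fun y => by positivity
  have hσ0 : ∀ y, 0 < σ y := fun y => mul_pos (by positivity) (inv_pos.2 (hpos y))
  have hσb : ∀ y, ‖σ y • y‖ < ε := fun y => by
    rw [norm_smul, Real.norm_of_nonneg (hσ0 y).le, hσ]
    have : (1 + ‖y‖)⁻¹ * ‖y‖ ≤ 1 := by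
      rw [inv_mul_le_one₀ (hpos y)]; linarith
    nlinarith
  have hσc : Continuous σ :=
    continuous_const.mul (Continuous.inv₀ (by fun_prop) fun y => (hpos y).ne')
  set h : (Fin 2 → ℝ) → ℝ := fun y => (σ y)⁻¹ * F (σ y • y) with hh
  have mono : ∀ y, ∀ s s' : ℝ, 0 < s → s ≤ s' → ‖s' • y‖ < ε →
      s⁻¹ * F (s • y) = s'⁻¹ * F (s' • y) := by
    intro y s s' hs hss hb
    have hs' : 0 < s' := hs.trans_le hss
    have e : s • y = (s / s') • s' • y := by rw [smul_smul, div_mul_cancel₀ _ hs'.ne']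
    rw [e, hhom _ hb _ ⟨by positivity, (div_le_one hs').2 hss⟩]
    field_simp
  have key : ∀ y, ∀ s : ℝ, 0 < s → ‖s • y‖ < ε → h y = s⁻¹ * F (s • y) := by
    intro y s hs hb
    rcases le_total s (σ y) with hle | hle
    · exact (mono y s _ hs hle (hσb y)).symm
    · exact mono y _ s (hσ0 y) hle hb
  have hlin : ∀ y, ∀ s : ℝ, 0 < s → ‖s • y‖ < ε → F (s • y) = s * h y := fun y s hs hb => by
    rw [key y s hs hb, ← mul_assoc, mul_inv_cancel₀ hs.ne', one_mul]
  refine ⟨h, ?_, ?_, hlin⟩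
  · refine (hσc.inv₀ fun y => (hσ0 y).ne').mul ?_
    exact hF.comp_continuous (hσc.smul continuous_id) fun y => by simpa using hσb y
  · intro c hc y
    rcases hc.eq_or_lt with rfl | hc
    · have h0 : F 0 = 0 := by
        have := hhom 0 (by simpa using hε) 0 (by simp)
        simpa using this
      rw [zero_smul, zero_mul]
      simp [hh, h0]
    · have h1 := key (c • y) _ (hσ0 _) (hσb _)
      have h2 := key y (σ (c • y) * c) (mul_pos (hσ0 _) hc) (by
        rw [← smul_smul]; exact hσb _)
      have h3 : ∀ s X : ℝ, s⁻¹ * X = c * ((s * c)⁻¹ * X) := fun s X => by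
        rw [mul_inv_rev, ← mul_assoc, ← mul_assoc, mul_inv_cancel₀ hc.ne', one_mul]
      rw [h1, h2, smul_smul]
      exact h3 _ _

namespace PolytopalComplex

variable {M : Type u} [TopologicalSpace M] {K : PolytopalComplex M} {v : M}

lemma IsGenericPL.continuousOn_star [T2Space M] {f : M → ℝ} (hf : K.IsGenericPL f) :
    ContinuousOn f (K.star v) := by
  refine PolytopalComplex.continuousOn_star fun c _ => ?_
  obtain ⟨A, hA⟩ := hf.1 c
  exact A.continuous_of_finiteDimensional.continuousOn.congr hA

/-- The conical model of a generic piecewise linear function at the centre of a chart, and the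
conical embedding of the star. -/
theorem IsPLChart.exists_conical [T2Space M] {f : M → ℝ} (hf : K.IsGenericPL f)
    {e : OpenPartialHomeomorph M (Fin 2 → ℝ)} (he : K.IsPLChart e) (hv : v ∈ e.source)
    (hv0 : e v = 0) : ∃ (h : (Fin 2 → ℝ) → ℝ) (Ψ : M → (Fin 2 → ℝ)), IsConical e h f v ∧
      LocallyPL h ∧ ContinuousOn Ψ (K.star v) ∧ InjOn Ψ (K.star v) ∧
      (∀ x ∈ K.star v, ∀ t ∈ Icc (0 : ℝ) 1, Ψ (K.dil v t x) = t • Ψ x) ∧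
      (∀ x ∈ K.star v, f x = f v + h (Ψ x)) ∧
      ∀ᶠ y in 𝓝 (0 : Fin 2 → ℝ), ∃ x ∈ K.star v, Ψ x = y := by
  obtain ⟨Ψ, hΨc, hΨi, hΨd, hnear, J, _, κ, C, A, hC, hCP, hCA, hcov⟩ := he.exists_star_map hv hv0
  have hsymm0 : e.symm 0 = v := by rw [← hv0, e.left_inv hv]
  have h0t : (0 : Fin 2 → ℝ) ∈ e.target := hv0 ▸ e.map_source hv
  have htend : Filter.Tendsto e.symm (𝓝 0) (𝓝 v) := by
    have := e.continuousAt_symm h0t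
    rwa [ContinuousAt, hsymm0] at this
  obtain ⟨ε, hε, hb⟩ := Metric.eventually_nhds_iff_ball.1
    ((e.open_target.eventually_mem h0t).and (htend.eventually (hnear.and hcov)))
  set F : (Fin 2 → ℝ) → ℝ := fun y => f (e.symm y) - f v with hF
  have hFc : ContinuousOn F (Metric.ball 0 ε) := by
    refine ContinuousOn.sub ?_ continuousOn_const
    exact hf.continuousOn_star.comp (e.continuousOn_symm.mono fun y hy => (hb y hy).1)
      fun y hy => (hb y hy).2.1.1
  have hdil : ∀ y, ‖y‖ < ε → ∀ t ∈ Icc (0 : ℝ) 1, F (t • y) = t * F y := by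
    intro y hy t ht
    obtain ⟨hyt, ⟨hst, hsrc, hΨ, hd⟩, -⟩ := hb y (by simpa using hy)
    obtain ⟨hd1, hd2⟩ := hd t ht
    rw [e.right_inv hyt] at hd2
    have : e.symm (t • y) = K.dil v t (e.symm y) := by rw [← hd2, e.left_inv hd1]
    simp only [hF]
    rw [this, apply_dil hf hst ht]
    ring
  obtain ⟨h, hc, hh, hlin⟩ := exists_posHom_of_ball hε hFc hdil
  have hFh : ∀ y, ‖y‖ < ε → F y = h y := fun y hy => by
    simpa using hlin y 1 one_pos (by simpa using hy)
  -- Both sides are affine along the segment from `v` to `x`, so it suffices to compare them after a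
  -- dilation by a factor `s` small enough to reach the ball.
  have hfh : ∀ x ∈ K.star v, f x = f v + h (Ψ x) := by
    intro x hx
    have hpos : 0 < 1 + ‖Ψ x‖ + ε := by positivity
    set s := ε / (1 + ‖Ψ x‖ + ε) with hs
    have hs0 : 0 < s := by positivity
    have hs1 : s ≤ 1 := (div_le_one hpos).2 (by linarith [norm_nonneg (Ψ x)])
    have hsb : ‖s • Ψ x‖ < ε := by
      rw [norm_smul, Real.norm_of_nonneg hs0.le, hs, div_mul_eq_mul_div, div_lt_iff₀ hpos]
      nlinarith [norm_nonneg (Ψ x)]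
    obtain ⟨hyt, ⟨hst, hsrc, hΨ, -⟩, -⟩ := hb (s • Ψ x) (by simpa using hsb)
    rw [e.right_inv hyt] at hΨ
    have h1 := hΨi hst (dil_mem_star hx ⟨hs0.le, hs1⟩)
      (hΨ.trans (hΨd x hx s ⟨hs0.le, hs1⟩).symm)
    have h2 := hlin (Ψ x) s hs0 hsb
    simp only [hF] at h2
    rw [h1, apply_dil hf hx ⟨hs0.le, hs1⟩] at h2
    have h3 : s * (f x - f v) = s * h (Ψ x) := by linarith
    linarith [mul_left_cancel₀ hs0.ne' h3]
  refine ⟨h, Ψ, ⟨hv, hv0, hc, hh, ?_⟩, ⟨J, inferInstance, fun j => A j '' C j,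
    fun j => (hC j).affine_image _, ?_, ?_⟩, hΨc, hΨi, hΨd, hfh, ?_⟩
  · filter_upwards [hnear] with x hx
    rw [hfh x hx.1, hx.2.2.1]
  · rintro j _ ⟨q, hq, rfl⟩ _ ⟨q', hq', rfl⟩ a b ha hb hab
    obtain ⟨B, hB⟩ := hf.1 (κ j)
    have hval : ∀ q ∈ C j, h (A j q) = B q - f v := fun q hq => by
      obtain ⟨h1, h2, h3⟩ := hCA j q hq
      have := hfh _ h1
      rw [hB q (hCP j hq), h3] at this
      linarith
    rw [← affineMap_combo (A j) hab, hval _ (hC j hq hq' ha hb hab), hval q hq, hval q' hq',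
      affineMap_combo B hab]
    simp only [smul_eq_mul]
    linear_combination (f v) * hab
  · filter_upwards [Metric.ball_mem_nhds 0 hε] with y hy
    obtain ⟨hyt, ⟨hst, hsrc, hΨ, -⟩, j, q, hq, hqe⟩ := hb y hy
    refine ⟨j, q, hq, ?_⟩
    rw [← (hCA j q hq).2.2, hqe, hΨ, e.right_inv hyt]
  · filter_upwards [Metric.ball_mem_nhds 0 hε] with y hy
    obtain ⟨hyt, ⟨hst, hsrc, hΨ, -⟩, -⟩ := hb y hy
    exact ⟨_, hst, by rw [hΨ, e.right_inv hyt]⟩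

/-! ### The link -/

lemma link_subset_star : K.link v ⊆ K.star v := by
  rintro x ⟨c, c', hv, hcc', -, hx⟩
  exact ⟨c', hv, hcc' hx⟩

lemma notMem_link : v ∉ K.link v := by
  rintro ⟨c, c', -, -, hv, hx⟩
  exact hv hx

lemma isCompact_link : IsCompact (K.link v) := by
  have := K.finite_cell
  have : K.link v = ⋃ c : {c // ∃ c', v ∈ K.cell c' ∧ K.cell c ⊆ K.cell c' ∧ v ∉ K.cell c},
      K.cell c := by
    ext x
    simp only [link, mem_ofPred_eq, mem_iUnion, Subtype.exists, exists_prop]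
    constructor
    · rintro ⟨c, c', h1, h2, h3, h4⟩; exact ⟨c, ⟨c', h1, h2, h3⟩, h4⟩
    · rintro ⟨c, ⟨c', h1, h2, h3⟩, h4⟩; exact ⟨c, c', h1, h2, h3, h4⟩
  rw [this]
  exact isCompact_iUnion fun c => K.isCompact_cell _

/-- Every point of the star other than the centre lies on a segment from the centre to the link. -/
lemma exists_link_dil {x : M} (hx : x ∈ K.star v) (hxv : x ≠ v) :
    ∃ y ∈ K.link v, ∃ t : ℝ, 0 < t ∧ t ≤ 1 ∧ K.dil v t y = x := by
  obtain ⟨c, ⟨p, hp, rfl⟩, q, hq, rfl⟩ := hx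
  have hpq : q - p ≠ 0 := fun h => hxv (by rw [sub_eq_zero.1 h])
  -- The parameters of the ray from `v` through `x` that lie beyond `x` but still in the cell. Their
  -- maximum gives the point where the ray leaves the cell.
  set T : Set ℝ := {t | 1 ≤ t ∧ p + t • (q - p) ∈ K.polytope c} with hT
  have hTc : IsCompact T := by
    refine Metric.isCompact_of_isClosed_isBounded ?_ ?_
    · refine IsClosed.inter isClosed_Ici ?_
      exact (K.isPolytope c).isCompact.isClosed.preimage (by fun_prop)
    · obtain ⟨R, hR0, hR⟩ := (K.isPolytope c).isCompact.isBounded.exists_pos_norm_le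
      refine (Metric.isBounded_Icc (1 : ℝ) ((R + R) / ‖q - p‖)).subset fun t ht => ⟨ht.1, ?_⟩
      rw [le_div_iff₀ (norm_pos_iff.2 hpq)]
      have h1 : ‖t • (q - p)‖ ≤ R + R := by
        have : t • (q - p) = (p + t • (q - p)) - p := by abel
        rw [this]
        exact (norm_sub_le _ _).trans (add_le_add (hR _ ht.2) (hR _ hp))
      rwa [norm_smul, Real.norm_of_nonneg (by linarith [ht.1])] at h1
  obtain ⟨t, ht, hmax⟩ := hTc.exists_isMaxOn ⟨1, le_rfl, by simpa using hq⟩ continuousOn_id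
  have ht0 : 0 < t := by linarith [ht.1]
  set z := p + t • (q - p) with hz
  refine ⟨K.param c z, ?_, t⁻¹, inv_pos.2 ht0, inv_le_one_of_one_le₀ ht.1, ?_⟩
  · obtain ⟨d, w, hw, hwz, hmin, hri⟩ := K.exists_carrier (K.param c z)
    refine ⟨d, c, ⟨p, hp, rfl⟩, hmin c ⟨z, ht.2, rfl⟩, ?_, ⟨w, hw, hwz⟩⟩
    -- If the smallest cell around the exit point contained `v`, the segment from `v` could be
    -- prolonged inside that cell beyond this relative interior point, against the maximality of
    -- `t`.
    rintro ⟨p', hp', hpp⟩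
    obtain ⟨ε, hε, hmem⟩ := hri p' hp'
    obtain ⟨u, hu, hue⟩ := hmin c ⟨z, ht.2, rfl⟩ (K.mem_cell_of_mem hmem)
    have hs : (1 + ε)⁻¹ ∈ Icc (0 : ℝ) 1 := ⟨by positivity, inv_le_one_of_one_le₀ (by linarith)⟩
    have h1 := K.param_combo_eq hp hu hp' hmem hpp.symm hue hs
    have e1 : p' + (1 + ε)⁻¹ • (w + ε • (w - p') - p') = w := by
      have : w + ε • (w - p') - p' = (1 + ε) • (w - p') := by module
      rw [this, smul_smul, inv_mul_cancel₀ (by positivity), one_smul]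
      abel
    rw [e1, hwz] at h1
    have h2 := K.injOn_param c (combo_mem hp hu hs) ht.2 h1
    have h3 : u = p + ((1 + ε) * t) • (q - p) := by
      have : (1 + ε)⁻¹ • (u - p) = t • (q - p) := add_left_cancel h2
      have : u - p = (1 + ε) • t • (q - p) := by
        rw [← this, smul_smul, mul_inv_cancel₀ (by positivity), one_smul]
      rw [← smul_smul, ← this]; abel
    have h4 : (1 + ε) * t ≤ t := hmax (show (1 + ε) * t ∈ T from
      ⟨by nlinarith [ht.1], h3 ▸ hu⟩)
    nlinarith
  · rw [dil_param hp rfl ht.2 ⟨by positivity, inv_le_one_of_one_le₀ ht.1⟩,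
      add_sub_cancel_left, smul_smul, inv_mul_cancel₀ ht0.ne', one_smul, add_sub_cancel]

/-- A cell containing an inner point of a segment issuing from `v` also contains `v`, which the
cells of the link do not. So a ray meets the link only once. -/
lemma link_dil_eq {x y : M} (hx : x ∈ K.link v) (hy : y ∈ K.link v) {t : ℝ} (h0 : 0 < t)
    (h1 : t ≤ 1) (h : K.dil v t y = x) : x = y := by
  rcases h1.eq_or_lt with rfl | h1
  · rw [← h, dil_one (link_subset_star hy)]
  · obtain ⟨c, c', -, -, hv, hxc⟩ := hx
    exact absurd (mem_cell_of_dil_mem (link_subset_star hy) h0 h1 (h ▸ hxc)).1 hv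

/-- At a point of the link where `f` takes the value `f v`, it changes its sign. -/
lemma mem_closure_of_link {f : M → ℝ} (hf : K.IsGenericPL f) (hvK : v ∈ K.vertices) {x : M}
    (hx : x ∈ K.link v) (hfx : f x = f v) :
    x ∈ closure {y ∈ K.link v | f y < f v} ∧ x ∈ closure {y ∈ K.link v | f v < f y} := by
  obtain ⟨c, c', hvc', hcc', hvc, hxc⟩ := hx
  obtain ⟨d, z, hz, hzx, hmin, hri⟩ := K.exists_carrier x
  have hdc := hmin c hxc
  have hdl : K.cell d ⊆ K.link v := fun y hy => ⟨c, c', hvc', hcc', hvc, hdc hy⟩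
  -- Here genericity is used: `w ≠ v` because `d` lies in a cell avoiding `v`, so `f w ≠ f v`. As
  -- `x` is relatively interior in `d`, one can move from it both towards `w` and away from it, and
  -- `f - f v` gets opposite signs.
  obtain ⟨w, hwK, w', hw', hwe⟩ := K.exists_vertex_mem_cell d
  have hwv : f w ≠ f v := fun h => hvc (hf.2 hwK hvK h ▸ hdc ⟨w', hw', hwe⟩)
  obtain ⟨ε, hε, hmem⟩ := hri w' hw'
  obtain ⟨A, hA⟩ := hf.1 d
  have hAz : A z = f v := by rw [← hA z hz, hzx, hfx]
  have hAw : A w' = f w := by rw [← hA w' hw', hwe]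
  have key : ∀ u ∈ K.polytope d, ∀ S : Set ℝ, (∀ t : ℝ, 0 < t → t ≤ 1 →
      f v + t * (A u - f v) ∈ S) → x ∈ closure {y ∈ K.link v | f y ∈ S} := by
    intro u hu S hS
    have hcont : ContinuousOn (fun t : ℝ => K.param d (z + t • (u - z))) (Icc 0 1) :=
      (K.continuousOn_param d).comp (by fun_prop) fun t ht => combo_mem hz hu ht
    have htend : Filter.Tendsto (fun t : ℝ => K.param d (z + t • (u - z))) (𝓝[Ioc 0 1] 0)
        (𝓝 x) := by
      have h1 := (hcont 0 (by simp)).tendsto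
      simp only [zero_smul, add_zero, hzx] at h1
      exact h1.mono_left (nhdsWithin_mono _ Ioc_subset_Icc_self)
    have : (𝓝[Ioc (0 : ℝ) 1] 0).NeBot := by
      rw [nhdsWithin_Ioc_eq_nhdsGT one_pos]; infer_instance
    refine mem_closure_of_tendsto htend ?_
    filter_upwards [self_mem_nhdsWithin] with t ht
    have htI : t ∈ Icc (0 : ℝ) 1 := ⟨ht.1.le, ht.2⟩
    refine ⟨hdl ⟨_, combo_mem hz hu htI, rfl⟩, ?_⟩
    have e : z + t • (u - z) = (1 - t) • z + t • u := by module
    rw [hA _ (combo_mem hz hu htI), e, affineMap_combo A (by ring), hAz]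
    convert hS t ht.1 ht.2 using 1
    simp only [smul_eq_mul]; ring
  have hAu : A (z + ε • (z - w')) = f v - ε * (f w - f v) := by
    have e : z + ε • (z - w') = (1 + ε) • z + (-ε) • w' := by module
    rw [e, affineMap_combo A (by ring), hAz, hAw]
    simp only [smul_eq_mul]; ring
  rcases lt_or_gt_of_ne hwv with hlt | hlt
  · refine ⟨key w' hw' (Iio (f v)) fun t ht _ => ?_, key _ hmem (Ioi (f v)) fun t ht _ => ?_⟩
    · rw [hAw, mem_Iio]; nlinarith
    · rw [hAu, mem_Ioi]; nlinarith [mul_pos ht (mul_pos hε (sub_pos.2 hlt))]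
  · refine ⟨key _ hmem (Iio (f v)) fun t ht _ => ?_, key w' hw' (Ioi (f v)) fun t ht _ => ?_⟩
    · rw [hAu, mem_Iio]; nlinarith [mul_pos ht (mul_pos hε (sub_pos.2 hlt))]
    · rw [hAw, mem_Ioi]; nlinarith

end PolytopalComplex

end

/-! ### The lower link and the sign changes in the conical model -/

noncomputable section

namespace PolytopalComplex

variable {M : Type u} [TopologicalSpace M] {K : PolytopalComplex M} {v : M}

/-- The conical model of a generic piecewise linear function at a vertex: the lower link is the
sublevel part of the unit circle, and the model changes its sign at each of its zeros. -/
theorem IsPLChart.exists_vertex_model [T2Space M] {f : M → ℝ} (hf : K.IsGenericPL f)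
    (hvK : v ∈ K.vertices) {e : OpenPartialHomeomorph M (Fin 2 → ℝ)} (he : K.IsPLChart e)
    (hv : v ∈ e.source) (hv0 : e v = 0) : ∃ h : (Fin 2 → ℝ) → ℝ, IsConical e h f v ∧
      LocallyPL h ∧ Nonempty (K.lowerLink f v ≃ₜ lowerCircle h) ∧
      ∀ y ≠ 0, h y = 0 → y ∈ closure {y | h y < 0} ∧ y ∈ closure {y | 0 < h y} := by
  obtain ⟨h, Ψ, H, hPL, hΨc, hΨi, hΨd, hfh, hcov⟩ := he.exists_conical hf hv hv0
  have hvs : v ∈ K.star v := mem_of_mem_nhds star_mem_nhds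
  have hΨv : Ψ v = 0 := by
    have := hΨd v hvs 0 (by simp)
    rwa [dil_zero hvs, zero_smul] at this
  have hΨne : ∀ x ∈ K.link v, Ψ x ≠ 0 := fun x hx h0 => notMem_link
    (hΨi (link_subset_star hx) hvs (h0.trans hΨv.symm) ▸ hx)
  -- Small multiples of `y` lie in the image of the star, and each star point other than `v` is a
  -- dilate of a link point. Together with `huniq` this says that every ray from the origin meets
  -- the image of the link exactly once, so radial projection to the circle is bijective.
  have hray : ∀ y ≠ 0, ∃ x ∈ K.link v, ∃ s : ℝ, 0 < s ∧ Ψ x = s • y := by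
    intro y hy
    have htend : Filter.Tendsto (fun s : ℝ => s • y) (𝓝[>] 0) (𝓝 0) := by
      have : Continuous fun s : ℝ => s • y := by fun_prop
      simpa using (this.tendsto 0).mono_left nhdsWithin_le_nhds
    obtain ⟨s, ⟨x, hx, hxs⟩, hs⟩ := ((htend.eventually hcov).and self_mem_nhdsWithin).exists
    have hs : 0 < s := hs
    have hxv : x ≠ v := by
      rintro rfl
      exact smul_ne_zero hs.ne' hy (hxs.symm.trans hΨv)
    obtain ⟨z, hz, t, ht0, ht1, hzx⟩ := exists_link_dil hx hxv
    refine ⟨z, hz, s / t, by positivity, ?_⟩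
    have := hΨd z (link_subset_star hz) t ⟨ht0.le, ht1⟩
    rw [hzx, hxs] at this
    rw [div_eq_inv_mul, ← smul_smul, this, smul_smul, inv_mul_cancel₀ ht0.ne', one_smul]
  have huniq : ∀ x ∈ K.link v, ∀ y ∈ K.link v, ∀ s : ℝ, 0 < s → Ψ x = s • Ψ y → x = y := by
    have key : ∀ x ∈ K.link v, ∀ y ∈ K.link v, ∀ s : ℝ, 0 < s → s ≤ 1 → Ψ x = s • Ψ y →
        x = y := by
      intro x hx y hy s hs hs1 h
      have hy' := link_subset_star hy
      rw [← hΨd y hy' s ⟨hs.le, hs1⟩] at h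
      exact link_dil_eq hx hy hs hs1
        (hΨi (link_subset_star hx) (dil_mem_star hy' ⟨hs.le, hs1⟩) h).symm
    intro x hx y hy s hs h
    rcases le_total s 1 with h1 | h1
    · exact key x hx y hy s hs h1 h
    · refine (key y hy x hx s⁻¹ (inv_pos.2 hs) (inv_le_one_of_one_le₀ h1) ?_).symm
      rw [h, smul_smul, inv_mul_cancel₀ hs.ne', one_smul]
  refine ⟨h, H, hPL, ?_, ?_⟩
  · have hlc : IsCompact (K.lowerLink f v) := by
      have h1 : ContinuousOn f (K.link v) := hf.continuousOn_star.mono link_subset_star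
      have := h1.preimage_isClosed_of_isClosed (isCompact_link (K := K) (v := v)).isClosed
        (isClosed_Iic (a := f v))
      exact isCompact_link.of_isClosed_subset this inter_subset_left
    have : CompactSpace (K.lowerLink f v) := isCompact_iff_compactSpace.1 hlc
    have hval : ∀ x ∈ K.link v, h ((nrm1 (Ψ x))⁻¹ • Ψ x) = (nrm1 (Ψ x))⁻¹ * (f x - f v) := by
      intro x hx
      rw [H.posHom _ (inv_nonneg.2 (nrm1_nonneg _)), hfh x (link_subset_star hx)]
      ring
    let g : K.lowerLink f v → lowerCircle h := fun x => ⟨(nrm1 (Ψ x))⁻¹ • Ψ x,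
      nrm1_inv_smul (hΨne x x.2.1), by
        rw [hval _ x.2.1]
        exact mul_nonpos_of_nonneg_of_nonpos (inv_nonneg.2 (nrm1_nonneg _))
          (sub_nonpos.2 x.2.2)⟩
    have hΨ' : Continuous fun x : K.lowerLink f v => Ψ x :=
      continuousOn_iff_continuous_domRestrict.1
        (hΨc.mono fun x hx => link_subset_star hx.1)
    have hg : Continuous g := by
      refine Continuous.subtype_mk ?_ _
      have : Continuous fun x : K.lowerLink f v => (nrm1 (Ψ x))⁻¹ :=
        (continuous_nrm1.comp hΨ').inv₀ fun x => (nrm1_pos (hΨne x x.2.1)).ne'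
      exact this.smul hΨ'
    have hb : Function.Bijective g := by
      constructor
      · intro x y hxy
        have h1 : (nrm1 (Ψ x))⁻¹ • Ψ x = (nrm1 (Ψ y))⁻¹ • Ψ y := congrArg Subtype.val hxy
        have hx := nrm1_pos (hΨne x x.2.1)
        have hy := nrm1_pos (hΨne y y.2.1)
        refine Subtype.ext (huniq x x.2.1 y y.2.1 (nrm1 (Ψ x) * (nrm1 (Ψ y))⁻¹) (by positivity) ?_)
        rw [← smul_smul, ← h1, smul_smul, mul_inv_cancel₀ hx.ne', one_smul]
      · rintro ⟨y, hy1, hy2⟩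
        have hy0 : y ≠ 0 := by rintro rfl; simp [nrm1] at hy1
        obtain ⟨x, hx, s, hs, hxy⟩ := hray y hy0
        refine ⟨⟨x, hx, ?_⟩, Subtype.ext ?_⟩
        · have := hfh x (link_subset_star hx)
          rw [hxy, H.posHom _ hs.le] at this
          nlinarith
        · change (nrm1 (Ψ x))⁻¹ • Ψ x = y
          rw [hxy, nrm1_smul, hy1, mul_one, abs_of_pos hs, smul_smul, inv_mul_cancel₀ hs.ne',
            one_smul]
    exact ⟨Continuous.homeoOfEquivCompactToT2 (f := Equiv.ofBijective g hb) hg⟩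
  · intro y hy hhy
    obtain ⟨x, hx, s, hs, hxy⟩ := hray y hy
    have hfx : f x = f v := by
      rw [hfh x (link_subset_star hx), hxy, H.posHom _ hs.le, hhy]; ring
    have hys : y = s⁻¹ • Ψ x := by rw [hxy, smul_smul, inv_mul_cancel₀ hs.ne', one_smul]
    have hcs : ContinuousOn (fun x => s⁻¹ • Ψ x) (K.star v) := hΨc.const_smul s⁻¹
    have hval : ∀ z ∈ K.link v, h (s⁻¹ • Ψ z) = s⁻¹ * (f z - f v) := fun z hz => by
      rw [H.posHom _ (by positivity), hfh z (link_subset_star hz)]; ring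
    have hs' : 0 < s⁻¹ := inv_pos.2 hs
    obtain ⟨h1, h2⟩ := mem_closure_of_link hf hvK hx hfx
    have hw : ∀ S ⊆ K.link v, ContinuousWithinAt (fun x => s⁻¹ • Ψ x) S x := fun S hS =>
      (hcs x (link_subset_star hx)).mono (hS.trans link_subset_star)
    rw [hys]
    constructor
    · refine closure_mono ?_ ((hw _ (fun z hz => hz.1)).mem_closure_image h1)
      rintro _ ⟨z, hz, rfl⟩
      change h (s⁻¹ • Ψ z) < 0
      rw [hval z hz.1]
      exact mul_neg_of_pos_of_neg hs' (sub_neg.2 hz.2)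
    · refine closure_mono ?_ ((hw _ (fun z hz => hz.1)).mem_closure_image h2)
      rintro _ ⟨z, hz, rfl⟩
      change 0 < h (s⁻¹ • Ψ z)
      rw [hval z hz.1]
      exact mul_pos hs' (sub_pos.2 hz.2)

/-- Rotating and scaling the plane so that `u` becomes the first basis vector. -/
def planeRotation (u : Fin 2 → ℝ) (hu : u ≠ 0) : (Fin 2 → ℝ) ≃ₗ[ℝ] (Fin 2 → ℝ) where
  toFun y := ![(y 0 * u 0 + y 1 * u 1) / (u 0 ^ 2 + u 1 ^ 2),
    (y 1 * u 0 - y 0 * u 1) / (u 0 ^ 2 + u 1 ^ 2)]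
  invFun y := ![y 0 * u 0 - y 1 * u 1, y 0 * u 1 + y 1 * u 0]
  map_add' y z := by ext i; fin_cases i <;> simp <;> ring
  map_smul' c y := by ext i; fin_cases i <;> simp <;> ring
  left_inv y := by
    have : u 0 ^ 2 + u 1 ^ 2 ≠ 0 := fun h => hu (by
      ext i; fin_cases i <;> simp <;> nlinarith [sq_nonneg (u 0), sq_nonneg (u 1)])
    ext i; fin_cases i <;> simp <;> field_simp <;> ring
  right_inv y := by
    have : u 0 ^ 2 + u 1 ^ 2 ≠ 0 := fun h => hu (by
      ext i; fin_cases i <;> simp <;> nlinarith [sq_nonneg (u 0), sq_nonneg (u 1)])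
    ext i; fin_cases i <;> simp <;> field_simp <;> ring

lemma planeRotation_self (u : Fin 2 → ℝ) (hu : u ≠ 0) : planeRotation u hu u = ![1, 0] := by
  have : u 0 ^ 2 + u 1 ^ 2 ≠ 0 := fun h => hu (by
    ext i; fin_cases i <;> simp <;> nlinarith [sq_nonneg (u 0), sq_nonneg (u 1)])
  ext i
  fin_cases i
  · change (u 0 * u 0 + u 1 * u 1) / (u 0 ^ 2 + u 1 ^ 2) = 1
    rw [← sq, ← sq, div_self this]
  · change (u 1 * u 0 - u 0 * u 1) / (u 0 ^ 2 + u 1 ^ 2) = 0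
    rw [mul_comm, sub_self, zero_div]

/-- Translating and rotating a piecewise linear chart. -/
lemma IsPLChart.trans_affine {m : ℕ} {e : OpenPartialHomeomorph M (Fin m → ℝ)}
    (he : K.IsPLChart e) (φ : (Fin m → ℝ) ≃ₜ (Fin m → ℝ)) (L : (Fin m → ℝ) →ᵃ[ℝ] (Fin m → ℝ))
    (hL : ∀ y, φ y = L y) : K.IsPLChart (e.transHomeomorph φ) := by
  intro c
  exact (he c).comp_sectors (J := Unit) (ψ := φ) subset_rfl (fun _ => 0) (fun _ => 0)
    (fun _ => L) (fun y => ⟨(), by simp⟩) fun _ y _ _ => hL y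

lemma IsPLManifold.exists_centred {m : ℕ} (hM : K.IsPLManifold m) (v : M) :
    ∃ e : OpenPartialHomeomorph M (Fin m → ℝ), K.IsPLChart e ∧ v ∈ e.source ∧ e v = 0 := by
  obtain ⟨e, he, hv⟩ := hM v
  refine ⟨e.transHomeomorph (Homeomorph.subRight (e v)), he.trans_affine _
    (AffineMap.id ℝ _ - AffineMap.const ℝ _ (e v)) (fun y => by simp), hv, by simp⟩

/-- At each vertex there is a chart in which the conical model is definite or else is positive
at the first basis vector and not positive at some other point. -/
theorem IsPLManifold.exists_vertex_model [T2Space M] (hM : K.IsPLManifold 2) {f : M → ℝ}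
    (hf : K.IsGenericPL f) (hvK : v ∈ K.vertices) :
    ∃ (e : OpenPartialHomeomorph M (Fin 2 → ℝ)) (h : (Fin 2 → ℝ) → ℝ), K.IsPLChart e ∧
      IsConical e h f v ∧ LocallyPL h ∧ Nonempty (K.lowerLink f v ≃ₜ lowerCircle h) ∧
      (∀ y ≠ 0, h y = 0 → y ∈ closure {y | h y < 0} ∧ y ∈ closure {y | 0 < h y}) ∧
      ((∀ y ≠ 0, 0 < h y) ∨ (∀ y ≠ 0, h y < 0) ∨ (0 < h ![1, 0] ∧ ∃ y, h y < 0)) := by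
  obtain ⟨e, he, hv, hv0⟩ := hM.exists_centred v
  obtain ⟨h, H, hPL, hlk, hz⟩ := he.exists_vertex_model hf hvK hv hv0
  by_cases hpos : ∀ y ≠ 0, 0 < h y
  · exact ⟨e, h, he, H, hPL, hlk, hz, .inl hpos⟩
  by_cases hneg : ∀ y ≠ 0, h y < 0
  · exact ⟨e, h, he, H, hPL, hlk, hz, .inr (.inl hneg)⟩
  push Not at hpos hneg
  obtain ⟨y₁, hy₁, hle⟩ := hpos
  obtain ⟨y₂, hy₂, hge⟩ := hneg
  have h1 : ∃ y, h y < 0 := by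
    rcases hle.lt_or_eq with h1 | h1
    · exact ⟨_, h1⟩
    · exact closure_nonempty_iff.1 ⟨_, (hz y₁ hy₁ h1).1⟩
  have h2 : ∃ y, 0 < h y := by
    rcases hge.lt_or_eq with h1 | h1
    · exact ⟨_, h1⟩
    · exact closure_nonempty_iff.1 ⟨_, (hz y₂ hy₂ h1.symm).2⟩
  obtain ⟨w, hw⟩ := h1
  obtain ⟨u, hu⟩ := h2
  have hu0 : u ≠ 0 := by
    rintro rfl
    rw [H.posHom.map_zero] at hu
    exact lt_irrefl _ hu
  -- After this rotation the model is positive at `![1, 0]`, which is both `dia 0` and `dia 4`. The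
  -- circle can then be cut open there without cutting the sublevel set.
  set R := (planeRotation u hu0).toContinuousLinearEquiv with hR
  have hR' : ∀ y, R y = planeRotation u hu0 y := fun y => rfl
  set e' := e.transHomeomorph R.toHomeomorph with he'
  have hPe' : K.IsPLChart e' := he.trans_affine _ (planeRotation u hu0).toLinearMap.toAffineMap
    fun y => rfl
  obtain ⟨h', H', hPL', hlk', hz'⟩ := hPe'.exists_vertex_model hf hvK hv
    (show R (e v) = 0 by rw [hv0, map_zero])
  -- Both models describe the same germ of `f`, and a homogeneous function is determined by its germ
  -- at the origin.
  have hhh : ∀ y, h y = h' (R y) := by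
    intro y
    have hsymm0 : e.symm 0 = v := by rw [← hv0, e.left_inv hv]
    have h0t : (0 : Fin 2 → ℝ) ∈ e.target := hv0 ▸ e.map_source hv
    have htend : Filter.Tendsto e.symm (𝓝 0) (𝓝 v) := by
      have := e.continuousAt_symm h0t
      rwa [ContinuousAt, hsymm0] at this
    have htend2 : Filter.Tendsto (fun s : ℝ => s • y) (𝓝[>] 0) (𝓝 0) := by
      have : Continuous fun s : ℝ => s • y := by fun_prop
      simpa using (this.tendsto 0).mono_left nhdsWithin_le_nhds
    obtain ⟨s, ⟨h3, h4, h5⟩, hs⟩ := ((htend2.eventually ((e.open_target.eventually_mem h0t).and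
      (htend.eventually (H.eventually_eq.and H'.eventually_eq)))).and self_mem_nhdsWithin).exists
    have hs : 0 < s := hs
    have e1 : e' (e.symm (s • y)) = R (s • y) := by
      change R (e (e.symm (s • y))) = _
      rw [e.right_inv h3]
    rw [e.right_inv h3] at h4
    rw [e1, h4, map_smul, H.posHom _ hs.le, H'.posHom _ hs.le] at h5
    exact mul_left_cancel₀ hs.ne' (add_left_cancel h5)
  refine ⟨e', h', hPe', H', hPL', hlk', hz', .inr (.inr ⟨?_, R w, ?_⟩)⟩
  · rw [← planeRotation_self u hu0, ← hR', ← hhh]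
    exact hu
  · rw [← hhh]; exact hw

end PolytopalComplex

end

noncomputable section

/-! ### The parametrization of the `ℓ¹` circle -/

/-- The piecewise linear parametrization of the `ℓ¹` circle by `[0, 4]`. -/
def dia (t : ℝ) : Fin 2 → ℝ := ![|t - 2| - 1, |t - 3| - |t - 1| + t - 2]

/-- The parameter in `[0, 4)` of a point of the `ℓ¹` circle. -/
def ang (y : Fin 2 → ℝ) : ℝ := if 0 ≤ y 1 then 1 - y 0 else 3 + y 0

/-- Two parameters belong to the same side of the `ℓ¹` circle. -/
def SameSide (a b : ℝ) : Prop :=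
  ∃ k : ℕ, k < 4 ∧ a ∈ Icc (k : ℝ) (k + 1) ∧ b ∈ Icc (k : ℝ) (k + 1)

@[fun_prop]
lemma continuous_dia : Continuous dia := by
  unfold dia
  refine continuous_pi fun i => ?_
  fin_cases i <;> simp <;> fun_prop

lemma dia_zero : dia 0 = ![1, 0] := by
  ext i; fin_cases i <;> norm_num [dia, abs_of_neg, abs_of_pos]

lemma dia_four : dia 4 = dia 0 := by
  ext i; fin_cases i <;> norm_num [dia, abs_of_neg, abs_of_pos]

lemma dia_of_mem_zero {t : ℝ} (ht : t ∈ Icc (0 : ℝ) 1) : dia t = ![1 - t, t] := by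
  have h1 : |t - 2| = 2 - t := by rw [abs_of_nonpos] <;> linarith [ht.1, ht.2]
  have h2 : |t - 3| = 3 - t := by rw [abs_of_nonpos] <;> linarith [ht.1, ht.2]
  have h3 : |t - 1| = 1 - t := by rw [abs_of_nonpos] <;> linarith [ht.1, ht.2]
  rw [dia, h1, h2, h3]; ext i; fin_cases i <;> (simp; ring)

lemma dia_of_mem_one {t : ℝ} (ht : t ∈ Icc (1 : ℝ) 2) : dia t = ![1 - t, 2 - t] := by
  have h1 : |t - 2| = 2 - t := by rw [abs_of_nonpos] <;> linarith [ht.1, ht.2]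
  have h2 : |t - 3| = 3 - t := by rw [abs_of_nonpos] <;> linarith [ht.1, ht.2]
  have h3 : |t - 1| = t - 1 := by rw [abs_of_nonneg] <;> linarith [ht.1, ht.2]
  rw [dia, h1, h2, h3]; ext i; fin_cases i <;> (simp; ring)

lemma dia_of_mem_two {t : ℝ} (ht : t ∈ Icc (2 : ℝ) 3) : dia t = ![t - 3, 2 - t] := by
  have h1 : |t - 2| = t - 2 := by rw [abs_of_nonneg] <;> linarith [ht.1, ht.2]
  have h2 : |t - 3| = 3 - t := by rw [abs_of_nonpos] <;> linarith [ht.1, ht.2]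
  have h3 : |t - 1| = t - 1 := by rw [abs_of_nonneg] <;> linarith [ht.1, ht.2]
  rw [dia, h1, h2, h3]; ext i; fin_cases i <;> (simp; ring)

lemma dia_of_mem_three {t : ℝ} (ht : t ∈ Icc (3 : ℝ) 4) : dia t = ![t - 3, t - 4] := by
  have h1 : |t - 2| = t - 2 := by rw [abs_of_nonneg] <;> linarith [ht.1, ht.2]
  have h2 : |t - 3| = t - 3 := by rw [abs_of_nonneg] <;> linarith [ht.1, ht.2]
  have h3 : |t - 1| = t - 1 := by rw [abs_of_nonneg] <;> linarith [ht.1, ht.2]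
  rw [dia, h1, h2, h3]; ext i; fin_cases i <;> (simp; ring)

lemma exists_side {t : ℝ} (ht : t ∈ Icc (0 : ℝ) 4) : t ∈ Icc (0 : ℝ) 1 ∨ t ∈ Icc (1 : ℝ) 2 ∨
    t ∈ Icc (2 : ℝ) 3 ∨ t ∈ Icc (3 : ℝ) 4 := by
  rcases le_total t 1 with h1 | h1
  · exact .inl ⟨ht.1, h1⟩
  rcases le_total t 2 with h2 | h2
  · exact .inr (.inl ⟨h1, h2⟩)
  rcases le_total t 3 with h3 | h3
  · exact .inr (.inr (.inl ⟨h2, h3⟩))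
  · exact .inr (.inr (.inr ⟨h3, ht.2⟩))

lemma nrm1_dia {t : ℝ} (ht : t ∈ Icc (0 : ℝ) 4) : nrm1 (dia t) = 1 := by
  rcases exists_side ht with h | h | h | h
  · rw [dia_of_mem_zero h]
    simp [nrm1, abs_of_nonneg (sub_nonneg.2 h.2), abs_of_nonneg h.1]
  · rw [dia_of_mem_one h]
    simp [nrm1, abs_of_nonneg (sub_nonneg.2 h.2), abs_of_nonpos (sub_nonpos.2 h.1)]
    ring
  · rw [dia_of_mem_two h]
    simp [nrm1, abs_of_nonpos (sub_nonpos.2 h.2), abs_of_nonpos (sub_nonpos.2 h.1)]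
    ring
  · rw [dia_of_mem_three h]
    simp [nrm1, abs_of_nonpos (sub_nonpos.2 h.2), abs_of_nonneg (sub_nonneg.2 h.1)]
    ring

lemma dia_ne_zero {t : ℝ} (ht : t ∈ Icc (0 : ℝ) 4) : dia t ≠ 0 := by
  intro h
  have := nrm1_dia ht
  rw [h] at this
  simp [nrm1] at this

lemma ang_dia {t : ℝ} (ht : t ∈ Ico (0 : ℝ) 4) : ang (dia t) = t := by
  rcases exists_side ⟨ht.1, ht.2.le⟩ with h | h | h | h
  · rw [dia_of_mem_zero h, ang, if_pos (by simpa using h.1)]; simp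
  · rw [dia_of_mem_one h, ang, if_pos (by simpa using h.2)]; simp
  · rw [dia_of_mem_two h, ang]
    split_ifs with h'
    · have : t = 2 := le_antisymm (by simpa using h') h.1
      subst this; norm_num
    · simp
  · rw [dia_of_mem_three h, ang, if_neg (by simpa using ht.2)]; simp

lemma ang_mem_and_dia_ang {y : Fin 2 → ℝ} (hy : nrm1 y = 1) :
    ang y ∈ Ico (0 : ℝ) 4 ∧ dia (ang y) = y := by
  have hy' : |y 0| + |y 1| = 1 := hy
  have h0 := neg_abs_le (y 0)
  have h0' := le_abs_self (y 0)
  have h1 := abs_nonneg (y 1)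
  unfold ang
  split_ifs with h
  · rw [abs_of_nonneg h] at hy'
    refine ⟨⟨by linarith, by linarith⟩, ?_⟩
    rcases le_total 0 (y 0) with h2 | h2
    · rw [dia_of_mem_zero ⟨by linarith, by linarith⟩]
      rw [abs_of_nonneg h2] at hy'
      ext i; fin_cases i <;> simp; linarith
    · rw [dia_of_mem_one ⟨by linarith, by linarith⟩]
      rw [abs_of_nonpos h2] at hy'
      ext i; fin_cases i <;> simp; linarith
  · push Not at h
    rw [abs_of_neg h] at hy'
    refine ⟨⟨by linarith, by linarith⟩, ?_⟩
    rcases le_total 0 (y 0) with h2 | h2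
    · rw [dia_of_mem_three ⟨by linarith, by linarith⟩]
      rw [abs_of_nonneg h2] at hy'
      ext i; fin_cases i <;> simp; linarith
    · rw [dia_of_mem_two ⟨by linarith, by linarith⟩]
      rw [abs_of_nonpos h2] at hy'
      ext i; fin_cases i <;> simp; linarith

lemma dia_combo {s t : ℝ} (h : SameSide s t) {a b : ℝ} (ha : 0 ≤ a) (hb : 0 ≤ b)
    (hab : a + b = 1) : dia (a * s + b * t) = a • dia s + b • dia t := by
  obtain ⟨k, hk, hs, ht⟩ := h
  have hst : a * s + b * t ∈ Icc (k : ℝ) (k + 1) := convex_Icc _ _ hs ht ha hb hab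
  have hb' : b = 1 - a := by linarith
  subst hb'
  interval_cases k <;> norm_num at hs ht hst
  · rw [dia_of_mem_zero hs, dia_of_mem_zero ht, dia_of_mem_zero hst]
    ext i; fin_cases i <;> simp; ring
  · rw [dia_of_mem_one hs, dia_of_mem_one ht, dia_of_mem_one hst]
    ext i; fin_cases i <;> simp <;> ring
  · rw [dia_of_mem_two hs, dia_of_mem_two ht, dia_of_mem_two hst]
    ext i; fin_cases i <;> simp <;> ring
  · rw [dia_of_mem_three hs, dia_of_mem_three ht, dia_of_mem_three hst]
    ext i; fin_cases i <;> simp <;> ring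

/-- The determinant of two plane vectors. -/
def det2 (y z : Fin 2 → ℝ) : ℝ := y 0 * z 1 - y 1 * z 0

/-- The determinant is positive for `s < t`, so sectors over pieces of a side are described by two
linear inequalities, and Cramer's rule gives coordinates on them. -/
lemma det2_dia {s t : ℝ} (h : SameSide s t) : det2 (dia s) (dia t) = t - s := by
  obtain ⟨k, hk, hs, ht⟩ := h
  interval_cases k <;> norm_num at hs ht
  · rw [dia_of_mem_zero hs, dia_of_mem_zero ht]; simp [det2]; ring
  · rw [dia_of_mem_one hs, dia_of_mem_one ht]; simp [det2]; ring
  · rw [dia_of_mem_two hs, dia_of_mem_two ht]; simp [det2]; ring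
  · rw [dia_of_mem_three hs, dia_of_mem_three ht]; simp [det2]; ring

lemma dia_injOn : InjOn dia (Ico 0 4) := fun s hs t ht h => by
  rw [← ang_dia hs, h, ang_dia ht]

/-! ### Sublevel sets on the circle -/

/-- The sublevel set of `h` in the parameter interval of the `ℓ¹` circle. -/
def lowerArc (h : (Fin 2 → ℝ) → ℝ) : Set ℝ := {t ∈ Icc (0 : ℝ) 4 | h (dia t) ≤ 0}

lemma isCompact_lowerArc {h : (Fin 2 → ℝ) → ℝ} (hc : Continuous h) : IsCompact (lowerArc h) :=
  isCompact_Icc.inter_right (isClosed_le (hc.comp continuous_dia) continuous_const)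

/-- The sublevel part of the circle is homeomorphic to the sublevel set in the interval. -/
def lowerArcHomeo {h : (Fin 2 → ℝ) → ℝ} (hc : Continuous h) (h0 : 0 < h ![1, 0]) :
    lowerArc h ≃ₜ lowerCircle h := by
  have : CompactSpace (lowerArc h) := isCompact_iff_compactSpace.1 (isCompact_lowerArc hc)
  have hlt : ∀ t : lowerArc h, t.1 ∈ Ico (0 : ℝ) 4 := by
    rintro ⟨t, ht, hle⟩
    refine ⟨ht.1, lt_of_le_of_ne ht.2 ?_⟩
    rintro rfl
    rw [dia_four, dia_zero] at hle
    exact absurd h0 (not_lt.2 hle)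
  let g : lowerArc h ≃ lowerCircle h :=
    { toFun := fun t => ⟨dia t, nrm1_dia t.2.1, t.2.2⟩
      invFun := fun y => ⟨ang y, ⟨(ang_mem_and_dia_ang y.2.1).1.1,
        (ang_mem_and_dia_ang y.2.1).1.2.le⟩, by rw [(ang_mem_and_dia_ang y.2.1).2]; exact y.2.2⟩
      left_inv := fun t => Subtype.ext (ang_dia (hlt t))
      right_inv := fun y => Subtype.ext (ang_mem_and_dia_ang y.2.1).2 }
  exact Continuous.homeoOfEquivCompactToT2 (f := g) (by
    have : Continuous fun t : lowerArc h => dia t := by fun_prop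
    exact Continuous.subtype_mk this _)

/-- The parameter interval is covered by finitely many convex sets on which `h ∘ dia` is
affine. -/
lemma LocallyPL.exists_cover {h : (Fin 2 → ℝ) → ℝ} (hPL : LocallyPL h) (hh : PosHom h) :
    ∃ (J : Type) (_ : Finite J) (I : J → Set ℝ), (∀ j, Convex ℝ (I j)) ∧ (∀ j, I j ⊆ Icc 0 4) ∧
      (∀ j, ∀ s ∈ I j, ∀ t ∈ I j, ∀ a b : ℝ, 0 ≤ a → 0 ≤ b → a + b = 1 →
        h (dia (a * s + b * t)) = a * h (dia s) + b * h (dia t)) ∧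
      Icc (0 : ℝ) 4 ⊆ ⋃ j, I j := by
  obtain ⟨J, _, C, hC, hlin, hcov⟩ := hPL
  obtain ⟨δ, hδ, hb⟩ := Metric.eventually_nhds_iff_ball.1 hcov
  have hδ2 : 0 < δ / 2 := by positivity
  have hside : ∀ k : Fin 4, ∀ s ∈ Icc (k : ℝ) (k + 1), ∀ t ∈ Icc (k : ℝ) (k + 1), SameSide s t :=
    fun k s hs t ht => ⟨k, k.2, hs, ht⟩
  refine ⟨Fin 4 × J, inferInstance,
    fun j => {t | t ∈ Icc (j.1 : ℝ) (j.1 + 1) ∧ (δ / 2) • dia t ∈ C j.2}, ?_, ?_, ?_, ?_⟩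
  · rintro ⟨k, j⟩ s ⟨hs, hs'⟩ t ⟨ht, ht'⟩ a b ha hb hab
    refine ⟨convex_Icc _ _ hs ht ha hb hab, ?_⟩
    simp only [smul_eq_mul]
    rw [dia_combo (hside k s hs t ht) ha hb hab, smul_add, smul_comm _ a, smul_comm _ b]
    exact hC j hs' ht' ha hb hab
  · rintro ⟨k, j⟩ t ⟨ht, -⟩
    have h3 : ((k : ℕ) : ℝ) ≤ 3 := by exact_mod_cast Nat.le_of_lt_succ k.2
    exact ⟨(Nat.cast_nonneg _).trans ht.1, by linarith [ht.2]⟩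
  · rintro ⟨k, j⟩ s ⟨hs, hs'⟩ t ⟨ht, ht'⟩ a b ha hb hab
    have := hlin j _ hs' _ ht' a b ha hb hab
    rw [smul_comm a, smul_comm b, ← smul_add, ← dia_combo (hside k s hs t ht) ha hb hab,
      hh _ hδ2.le, hh _ hδ2.le, hh _ hδ2.le] at this
    refine mul_left_cancel₀ hδ2.ne' ?_
    linarith
  · intro t ht
    have hball : (δ / 2) • dia t ∈ Metric.ball (0 : Fin 2 → ℝ) δ := by
      rw [mem_ball_zero_iff, norm_smul, Real.norm_of_nonneg hδ2.le]
      have := (norm_le_nrm1 (dia t)).trans (nrm1_dia ht).le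
      nlinarith
    obtain ⟨j, hj⟩ := hb _ hball
    have : ∃ k : Fin 4, t ∈ Icc (k : ℝ) (k + 1) := by
      rcases exists_side ht with h | h | h | h
      · exact ⟨0, by simpa using h⟩
      · exact ⟨1, by norm_num; exact h⟩
      · exact ⟨2, by norm_num; exact h⟩
      · exact ⟨3, by norm_num; exact h⟩
    obtain ⟨k, hk⟩ := this
    exact mem_iUnion.2 ⟨(k, j), hk, hj⟩

/-- `h ∘ dia` is affine between consecutive points of a suitable finite set. -/
lemma LocallyPL.exists_nodes {h : (Fin 2 → ℝ) → ℝ} (hPL : LocallyPL h) (hh : PosHom h)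
    (hc : Continuous h) : ∃ T : Finset ℝ, ∀ a b : ℝ, 0 ≤ a → a < b → b ≤ 4 →
      (∀ t ∈ T, t ∉ Ioo a b) → ∀ l ∈ Icc (0 : ℝ) 1,
      h (dia ((1 - l) * a + l * b)) = (1 - l) * h (dia a) + l * h (dia b) := by
  classical
  obtain ⟨J, _, I, hI, hI4, hlin, hcov⟩ := hPL.exists_cover hh
  have := Fintype.ofFinite J
  -- The nodes are the ends of the covering intervals. An interval with no node inside is contained,
  -- up to its ends, in the covering interval that contains its midpoint.
  refine ⟨Finset.univ.image (fun j => sInf (I j)) ∪ Finset.univ.image (fun j => sSup (I j)),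
    fun a b ha hab hb hT l hl => ?_⟩
  have hT1 : ∀ j, sInf (I j) ∉ Ioo a b := fun j => hT _ (Finset.mem_union_left _
    (Finset.mem_image_of_mem _ (Finset.mem_univ j)))
  have hT2 : ∀ j, sSup (I j) ∉ Ioo a b := fun j => hT _ (Finset.mem_union_right _
    (Finset.mem_image_of_mem _ (Finset.mem_univ j)))
  obtain ⟨j, hj⟩ := mem_iUnion.1 (hcov (show (a + b) / 2 ∈ Icc (0 : ℝ) 4 from
    ⟨by linarith, by linarith⟩))
  have hsub : Ioo a b ⊆ I j := by
    intro t ht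
    by_contra hn
    have hord := (hI j).ordConnected
    rcases le_total t ((a + b) / 2) with hle | hle
    · refine hT1 j ⟨lt_of_lt_of_le ht.1 (le_csInf ⟨_, hj⟩ fun s hs => ?_), ?_⟩
      · by_contra hlt
        exact hn (hord.out hs hj ⟨(not_le.1 hlt).le, hle⟩)
      · refine lt_of_le_of_lt (csInf_le ⟨0, fun s hs => (hI4 j hs).1⟩ hj) (by linarith)
    · refine hT2 j ⟨?_, lt_of_le_of_lt (csSup_le ⟨_, hj⟩ fun s hs => ?_) ht.2⟩
      · refine lt_of_lt_of_le (by linarith) (le_csSup ⟨4, fun s hs => (hI4 j hs).2⟩ hj)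
      · by_contra hlt
        exact hn (hord.out hj hs ⟨hle, (not_le.1 hlt).le⟩)
  -- The ends `a`, `b` need not belong to the covering interval. The defect from affinity vanishes
  -- when both ends are moved inwards, and by continuity also in the limit.
  set F : ℝ → ℝ := fun ε => h (dia ((1 - l) * (a + ε * (b - a)) + l * (b - ε * (b - a)))) -
    ((1 - l) * h (dia (a + ε * (b - a))) + l * h (dia (b - ε * (b - a)))) with hF
  have hFc : Continuous F := by fun_prop
  have hF0 : ∀ᶠ ε in 𝓝[>] (0 : ℝ), F ε = 0 := by
    filter_upwards [Ioo_mem_nhdsGT (show (0 : ℝ) < 1 by norm_num)] with ε hε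
    have h1 : 0 < b - a := by linarith
    have h2 := mul_pos hε.1 h1
    have h3 : ε * (b - a) < b - a := by nlinarith [hε.2]
    simp only [hF]
    rw [hlin j _ (hsub ⟨by linarith, by linarith⟩) _ (hsub ⟨by linarith, by linarith⟩) _ _
      (by linarith [hl.2]) hl.1 (by ring), sub_self]
  have hlim : Filter.Tendsto F (𝓝[>] 0) (𝓝 (F 0)) := (hFc.tendsto 0).mono_left nhdsWithin_le_nhds
  have := tendsto_nhds_unique (hlim.congr' hF0) tendsto_const_nhds
  simp only [hF, zero_mul, add_zero, sub_zero] at this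
  linarith

/-- At a zero of `h ∘ dia` the sign changes. -/
lemma mem_closure_of_zero {h : (Fin 2 → ℝ) → ℝ} (hh : PosHom h) {t : ℝ} (ht : t ∈ Ioo (0 : ℝ) 4)
    {S : Set ℝ} (hS : ∀ c : ℝ, 0 < c → ∀ x, x ∈ S → c * x ∈ S)
    (hcl : dia t ∈ closure {y | y ≠ 0 ∧ h y ∈ S}) :
    t ∈ closure {s ∈ Icc (0 : ℝ) 4 | h (dia s) ∈ S} := by
  have htI : t ∈ Icc (0 : ℝ) 4 := Ioo_subset_Icc_self ht
  have hcont : ContinuousAt (fun y : Fin 2 → ℝ => (nrm1 y)⁻¹ • y) (dia t) :=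
    (continuous_nrm1.continuousAt.inv₀ (nrm1_pos (dia_ne_zero htI)).ne').smul continuousAt_id
  have h1 := hcont.continuousWithinAt.mem_closure_image hcl
  simp only [nrm1_dia htI, inv_one, one_smul] at h1
  set A := {s ∈ Icc (0 : ℝ) 4 | h (dia s) ∈ S} with hA
  have hcl4 : closure A ⊆ Icc 0 4 := closure_minimal (fun s hs => hs.1) isClosed_Icc
  have hcomp : IsCompact (dia '' closure A) :=
    (isCompact_Icc.of_isClosed_subset isClosed_closure hcl4).image continuous_dia
  have h2 : dia t ∈ dia '' closure A := by
    refine closure_minimal ?_ hcomp.isClosed h1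
    rintro _ ⟨y, ⟨hy, hyS⟩, rfl⟩
    obtain ⟨h3, h4⟩ := ang_mem_and_dia_ang (nrm1_inv_smul hy)
    refine ⟨ang ((nrm1 y)⁻¹ • y), subset_closure ⟨⟨h3.1, h3.2.le⟩, ?_⟩, h4⟩
    rw [h4, hh _ (inv_nonneg.2 (nrm1_nonneg y))]
    exact hS _ (inv_pos.2 (nrm1_pos hy)) _ hyS
  obtain ⟨s, hs, hst⟩ := h2
  have hs4 := hcl4 hs
  -- `dia` identifies only the parameters 0 and 4, which differ from `t`.
  rcases hs4.2.eq_or_lt with rfl | hlt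
  · rw [dia_four] at hst
    have := dia_injOn ⟨le_rfl, by norm_num⟩ ⟨ht.1.le, ht.2⟩ hst
    exact absurd ht.1 (by rw [← this]; exact lt_irrefl _)
  · rwa [← dia_injOn ⟨hs4.1, hlt⟩ ⟨ht.1.le, ht.2⟩ hst]

end

noncomputable section

/-! ### Components of sublevel sets in an interval -/

section Components

variable {L : Set ℝ}

lemma connectedComponents_mk_eq {x y : L} :
    (x : _root_.ConnectedComponents L) = y ↔ (y : ℝ) ∈ connectedComponentIn L x := by
  rw [connectedComponentIn_eq_image x.2, ConnectedComponents.coe_eq_coe,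
    connectedComponent_eq_iff_mem]
  constructor
  · intro h
    refine ⟨y, ?_, rfl⟩
    rw [← connectedComponent_eq h]
    exact mem_connectedComponent
  · rintro ⟨z, hz, hzy⟩
    rw [Subtype.ext hzy] at hz
    rw [← connectedComponent_eq hz]
    exact mem_connectedComponent

lemma connectedComponents_mk_eq_of_convex {C : Set ℝ} (hC : Convex ℝ C) (hCL : C ⊆ L) {x y : L}
    (hx : (x : ℝ) ∈ C) (hy : (y : ℝ) ∈ C) : (x : _root_.ConnectedComponents L) = y :=
  connectedComponents_mk_eq.2 (hC.isPreconnected.subset_connectedComponentIn hx hCL hy)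

/-- A set of real numbers with finitely many components is homotopy equivalent to the set of its
components. -/
def homotopyEquivComponents [DiscreteTopology (_root_.ConnectedComponents L)] :
    ContinuousMap.HomotopyEquiv L (_root_.ConnectedComponents L) := by
  have hmk : ∀ x : _root_.ConnectedComponents L, ((Quot.out x : L) : _root_.ConnectedComponents L) = x :=
    fun x => Quot.out_eq x
  have hrep : Continuous fun x : L => (Quot.out (x : _root_.ConnectedComponents L) : L) :=
    (continuous_of_discreteTopology (f := fun c : _root_.ConnectedComponents L => (Quot.out c : L))).comp
      ConnectedComponents.continuous_coe
  exact
  { toFun := ⟨fun x => (x : _root_.ConnectedComponents L), ConnectedComponents.continuous_coe⟩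
    invFun := ⟨fun c => Quot.out c, continuous_of_discreteTopology⟩
    left_inv := ⟨{
      -- A point is moved straight to the chosen representative of its component. Connected subsets
      -- of the line are convex, so the path stays in the component.
      toFun := fun q => ⟨(1 - q.1.1) * (Quot.out (q.2 : _root_.ConnectedComponents L) : L).1 +
          q.1.1 * q.2.1, by
        have h1 : (q.2 : _root_.ConnectedComponents L) =
            (Quot.out (q.2 : _root_.ConnectedComponents L) : L) := (hmk _).symm
        have h2 := connectedComponents_mk_eq.1 h1
        have h3 := mem_connectedComponentIn (x := (q.2 : ℝ)) q.2.2
        have h4 := (isPreconnected_connectedComponentIn (F := L) (x := (q.2 : ℝ))).ordConnected.convex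
          (𝕜 := ℝ) h2 h3 (sub_nonneg.2 q.1.2.2) q.1.2.1 (by ring)
        exact connectedComponentIn_subset _ _ h4⟩
      continuous_toFun := by
        have : Continuous fun q : unitInterval × L =>
            (Quot.out (q.2 : _root_.ConnectedComponents L) : L) := hrep.comp continuous_snd
        fun_prop
      map_zero_left := fun x => by
        apply Subtype.ext
        simp
      map_one_left := fun x => by
        apply Subtype.ext
        simp }⟩
    right_inv := by
      convert ContinuousMap.Homotopic.refl _
      ext c
      exact (hmk c).symm }

/-- Assigning to each component a convex piece that contains its representative is injective,
because a piece is connected and meets only one component. -/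
lemma finite_connectedComponents_of_cover {J : Type} [Finite J] {C : J → Set ℝ}
    (hC : ∀ j, Convex ℝ (C j)) (hCL : ∀ j, C j ⊆ L) (hcov : L ⊆ ⋃ j, C j) :
    Finite (_root_.ConnectedComponents L) := by
  have : ∀ c : _root_.ConnectedComponents L, ∃ j, ((Quot.out c : L) : ℝ) ∈ C j :=
    fun c => mem_iUnion.1 (hcov (Quot.out c : L).2)
  choose g hg using this
  refine Finite.of_injective g fun c c' h => ?_
  have hmk : ∀ x : _root_.ConnectedComponents L, ((Quot.out x : L) : _root_.ConnectedComponents L) = x :=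
    fun x => Quot.out_eq x
  rw [← hmk c, ← hmk c']
  exact connectedComponents_mk_eq_of_convex (hC (g c)) (hCL _) (hg c) (h ▸ hg c')

/-- A component of a sublevel set of a function that changes its sign at each zero is an interval
with zeros at its ends and negative values in its interior. -/
lemma exists_component_eq_Icc {η : ℝ → ℝ} (hη : Continuous η) (h0 : 0 < η 0) (h4 : 0 < η 4)
    (hL : L = {t ∈ Icc (0 : ℝ) 4 | η t ≤ 0}) [Finite (_root_.ConnectedComponents L)]
    (hz : ∀ t ∈ Ioo (0 : ℝ) 4, η t = 0 → t ∈ closure {s ∈ Icc (0 : ℝ) 4 | η s < 0} ∧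
      t ∈ closure {s ∈ Icc (0 : ℝ) 4 | 0 < η s}) {x : ℝ} (hx : x ∈ L) :
    ∃ a b, 0 < a ∧ a < b ∧ b < 4 ∧ connectedComponentIn L x = Icc a b ∧ η a = 0 ∧ η b = 0 ∧
      ∀ t ∈ Ioo a b, η t < 0 := by
  have hLc : IsCompact L := by
    rw [hL]; exact isCompact_Icc.inter_right (isClosed_le hη continuous_const)
  set C := connectedComponentIn L x with hCdef
  have hCL : C ⊆ L := connectedComponentIn_subset _ _
  have hxC : x ∈ C := mem_connectedComponentIn hx
  have hCp : _root_.IsPreconnected C := isPreconnected_connectedComponentIn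
  have hCim : C = Subtype.val '' connectedComponent (⟨x, hx⟩ : L) :=
    connectedComponentIn_eq_image hx
  have hCcl : IsClosed C := by
    rw [hCim]
    exact hLc.isClosed.isClosedEmbedding_subtypeVal.isClosedMap _ isClosed_connectedComponent
  have hCc : IsCompact C := hLc.of_isClosed_subset hCcl hCL
  -- As there are finitely many components, each of them is open in `L`.
  have hCo : ∃ U : Set ℝ, IsOpen U ∧ L ∩ U = C := by
    have : IsOpen (connectedComponent (⟨x, hx⟩ : L)) := by
      rw [← connectedComponents_preimage_singleton]
      exact (isOpen_discrete _).preimage ConnectedComponents.continuous_coe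
    obtain ⟨U, hU, hUe⟩ := isOpen_induced_iff.1 this
    refine ⟨U, hU, ?_⟩
    rw [hCim, ← hUe, Subtype.image_preimage_coe]
  have hCI : C = Icc (sInf C) (sSup C) :=
    eq_Icc_csInf_csSup_of_connected_bdd_closed ⟨⟨x, hxC⟩, hCp⟩ hCc.bddBelow hCc.bddAbove hCcl
  set a := sInf C
  set b := sSup C
  have haC : a ∈ C := hCc.sInf_mem ⟨x, hxC⟩
  have hbC : b ∈ C := hCc.sSup_mem ⟨x, hxC⟩
  have hmem : ∀ t ∈ C, t ∈ Icc (0 : ℝ) 4 ∧ η t ≤ 0 := fun t ht => by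
    have := hCL ht
    rwa [hL] at this
  have hpos : ∀ t ∈ C, 0 < t ∧ t < 4 := by
    intro t ht
    obtain ⟨h1, h2⟩ := hmem t ht
    constructor
    · refine lt_of_le_of_ne h1.1 ?_
      rintro rfl; linarith
    · refine lt_of_le_of_ne h1.2 ?_
      rintro rfl; linarith
  -- Around a point with negative value the component contains an interval, so such a point is not
  -- an end of the component.
  have hext : ∀ t ∈ C, η t < 0 → ∃ ε > 0, Icc (t - ε) (t + ε) ⊆ C := by
    intro t ht hneg
    have hev : ∀ᶠ s in 𝓝 t, η s < 0 ∧ s ∈ Ioo (0 : ℝ) 4 :=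
      (hη.continuousAt.eventually (gt_mem_nhds hneg)).and (Ioo_mem_nhds (hpos t ht).1 (hpos t ht).2)
    obtain ⟨ε, hε, hb⟩ := Metric.nhds_basis_closedBall.eventually_iff.1 hev
    rw [Real.closedBall_eq_Icc] at hb
    refine ⟨ε, hε, ?_⟩
    have h1 : Icc (t - ε) (t + ε) ⊆ L := fun s hs => by
      rw [hL]
      exact ⟨Ioo_subset_Icc_self (hb hs).2, (hb hs).1.le⟩
    have h2 := isPreconnected_Icc.subset_connectedComponentIn
      (show t ∈ Icc (t - ε) (t + ε) from ⟨by linarith, by linarith⟩) h1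
    exact h2.trans (connectedComponentIn_eq ht).symm.subset
  have hηa : η a = 0 := by
    refine le_antisymm (hmem a haC).2 (not_lt.1 fun hneg => ?_)
    obtain ⟨ε, hε, hsub⟩ := hext a haC hneg
    have := hsub (show a - ε ∈ Icc (a - ε) (a + ε) from ⟨le_rfl, by linarith⟩)
    have := csInf_le hCc.bddBelow this
    linarith
  have hηb : η b = 0 := by
    refine le_antisymm (hmem b hbC).2 (not_lt.1 fun hneg => ?_)
    obtain ⟨ε, hε, hsub⟩ := hext b hbC hneg
    have := hsub (show b + ε ∈ Icc (b - ε) (b + ε) from ⟨by linarith, le_rfl⟩)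
    have := le_csSup hCc.bddAbove this
    linarith
  -- A one-point component would be isolated in `L`, but its point is a zero and hence a limit of
  -- negative values.
  have hab : a < b := by
    refine lt_of_le_of_ne (csInf_le hCc.bddBelow hbC) fun hab => ?_
    obtain ⟨U, hU, hLU⟩ := hCo
    have haU : a ∈ U := (hLU.symm.subset haC).2
    obtain ⟨s, hsU, hs4, hs⟩ := mem_closure_iff.1 (hz a (hpos a haC) hηa).1 U hU haU
    have hsC : s ∈ C := hLU.subset ⟨by rw [hL]; exact ⟨hs4, hs.le⟩, hsU⟩
    rw [hCI, ← hab, Icc_self] at hsC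
    rw [mem_singleton_iff.1 hsC, hηa] at hs
    exact lt_irrefl _ hs
  refine ⟨a, b, (hpos a haC).1, hab, (hpos b hbC).2, hCI, hηa, hηb, fun t ht => ?_⟩
  have htC : t ∈ C := by rw [hCI]; exact Ioo_subset_Icc_self ht
  -- A zero inside the interval would be a limit of points with positive values, which cannot lie in
  -- the component.
  refine lt_of_le_of_ne (hmem t htC).2 fun h => ?_
  obtain ⟨s, hsU, -, hs⟩ := mem_closure_iff.1 (hz t (hpos t htC) h).2 _ isOpen_Ioo ht
  have hsC : s ∈ C := by rw [hCI]; exact Ioo_subset_Icc_self hsU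
  exact absurd hs (not_lt.2 (hmem s hsC).2)

end Components

end

noncomputable section

/-! ### Piecewise linear homeomorphisms of the plane -/

section Fan

/-- `a < b` are consecutive elements of `T`. -/
def Consec (T : Finset ℝ) (a b : ℝ) : Prop := a ∈ T ∧ b ∈ T ∧ a < b ∧ ∀ t ∈ T, t ∉ Ioo a b

/-- A finite set of parameters in `[0, 4]` that contains the corners of the `ℓ¹` circle. -/
def IsNodeSet (T : Finset ℝ) : Prop :=
  (∀ t ∈ T, t ∈ Icc (0 : ℝ) 4) ∧ ∀ k : ℕ, k ≤ 4 → (k : ℝ) ∈ T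

variable {T : Finset ℝ}

lemma IsNodeSet.zero_mem (hT : IsNodeSet T) : (0 : ℝ) ∈ T := by simpa using hT.2 0 (by norm_num)

lemma IsNodeSet.four_mem (hT : IsNodeSet T) : (4 : ℝ) ∈ T := by simpa using hT.2 4 le_rfl

lemma IsNodeSet.exists_consec (hT : IsNodeSet T) {t : ℝ} (ht : t ∈ Icc (0 : ℝ) 4) :
    ∃ a b, Consec T a b ∧ t ∈ Icc a b := by
  have hmax : ∀ c : ℝ, 0 < c → c ∈ T → ∃ a, Consec T a c := by
    intro c hc hcT
    obtain ⟨a, ha, hmax⟩ := (T.filter (· < c)).exists_maximal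
      ⟨0, Finset.mem_filter.2 ⟨hT.zero_mem, hc⟩⟩
    obtain ⟨haT, hac⟩ := Finset.mem_filter.1 ha
    refine ⟨a, haT, hcT, hac, fun s hs hsI => ?_⟩
    exact absurd hsI.1 (not_lt.2 (hmax (Finset.mem_filter.2 ⟨hs, hsI.2⟩) hsI.1.le))
  rcases ht.1.eq_or_lt with rfl | h0
  · obtain ⟨b, hb, hmin⟩ := (T.filter ((0 : ℝ) < ·)).exists_minimal
      ⟨4, Finset.mem_filter.2 ⟨hT.four_mem, by norm_num⟩⟩
    obtain ⟨hbT, hb0⟩ := Finset.mem_filter.1 hb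
    refine ⟨0, b, ⟨hT.zero_mem, hbT, hb0, fun s hs hsI => ?_⟩, le_rfl, hb0.le⟩
    exact absurd hsI.2 (not_lt.2 (hmin (Finset.mem_filter.2 ⟨hs, hsI.1⟩) hsI.2.le))
  · obtain ⟨b, hb, hmin⟩ := (T.filter (t ≤ ·)).exists_minimal
      ⟨4, Finset.mem_filter.2 ⟨hT.four_mem, ht.2⟩⟩
    obtain ⟨hbT, htb⟩ := Finset.mem_filter.1 hb
    obtain ⟨a, ha⟩ := hmax b (h0.trans_le htb) hbT
    refine ⟨a, b, ha, ?_, htb⟩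
    by_contra hlt
    have := hmin (Finset.mem_filter.2 ⟨ha.1, (not_le.1 hlt).le⟩) ha.2.2.1.le
    exact absurd ha.2.2.1 (not_lt.2 this)

/-- The corners of the circle are nodes, so no integer lies strictly between consecutive nodes. -/
lemma IsNodeSet.sameSide (hT : IsNodeSet T) {a b : ℝ} (h : Consec T a b) : SameSide a b := by
  obtain ⟨ha, hb, hab, hn⟩ := h
  have ha4 := hT.1 a ha
  have hb4 := hT.1 b hb
  have hfl := Nat.floor_le ha4.1
  have hfl' := Nat.lt_floor_add_one a
  have hk : ⌊a⌋₊ < 4 := (Nat.floor_lt ha4.1).2 (by push_cast; linarith [hb4.2])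
  refine ⟨⌊a⌋₊, hk, ⟨hfl, hfl'.le⟩, by linarith, ?_⟩
  by_contra hlt
  refine hn _ (hT.2 (⌊a⌋₊ + 1) hk) ?_
  push_cast
  exact ⟨hfl', not_le.1 hlt⟩

lemma Consec.eq_of_mem {a b a' b' t : ℝ} (h : Consec T a b) (h' : Consec T a' b')
    (ht : t ∈ Ioo a b) (ht' : t ∈ Ioo a' b') : a = a' ∧ b = b' := by
  obtain ⟨ha, hb, -, hn⟩ := h
  obtain ⟨ha', hb', -, hn'⟩ := h'
  constructor
  · rcases lt_trichotomy a a' with hlt | heq | hlt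
    · exact absurd ⟨hlt, ht'.1.trans ht.2⟩ (hn a' ha')
    · exact heq
    · exact absurd ⟨hlt, ht.1.trans ht'.2⟩ (hn' a ha)
  · rcases lt_trichotomy b b' with hlt | heq | hlt
    · exact absurd ⟨ht'.1.trans ht.2, hlt⟩ (hn' b hb)
    · exact heq
    · exact absurd ⟨ht.1.trans ht'.2, hlt⟩ (hn b' hb')

open Classical in
/-- Piecewise linear interpolation. -/
lemma exists_interpolation (T : Finset ℝ) (F : ℝ → Fin 2 → ℝ) : ∃ G : ℝ → Fin 2 → ℝ,
    ∀ a b, Consec T a b → ∀ l ∈ Icc (0 : ℝ) 1,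
      G ((1 - l) * a + l * b) = (1 - l) • F a + l • F b := by
  refine ⟨fun t => if t ∈ T then F t else if h : ∃ p : ℝ × ℝ, Consec T p.1 p.2 ∧ t ∈ Ioo p.1 p.2
    then (h.choose.2 - h.choose.1)⁻¹ • ((h.choose.2 - t) • F h.choose.1 +
      (t - h.choose.1) • F h.choose.2) else 0, fun a b hab l hl => ?_⟩
  have hlt := hab.2.2.1
  rcases hl.1.eq_or_lt with rfl | h0
  · simp [hab.1]
  rcases hl.2.eq_or_lt with rfl | h1
  · simp [hab.2.1]
  have hmem : (1 - l) * a + l * b ∈ Ioo a b := ⟨by nlinarith, by nlinarith⟩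
  have hex : ∃ p : ℝ × ℝ, Consec T p.1 p.2 ∧ (1 - l) * a + l * b ∈ Ioo p.1 p.2 :=
    ⟨(a, b), hab, hmem⟩
  beta_reduce
  rw [if_neg (fun h => hab.2.2.2 _ h hmem), dif_pos hex]
  obtain ⟨h2, h3⟩ := hex.choose_spec
  obtain ⟨e1, e2⟩ := hab.eq_of_mem h2 hmem h3
  rw [← e1, ← e2]
  have hd : b - a ≠ 0 := (sub_pos.2 hlt).ne'
  have e3 : b - ((1 - l) * a + l * b) = (b - a) * (1 - l) := by ring
  have e4 : (1 - l) * a + l * b - a = (b - a) * l := by ring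
  rw [e3, e4, ← smul_smul, ← smul_smul, ← smul_add, smul_smul, inv_mul_cancel₀ hd, one_smul]

lemma IsNodeSet.continuousOn (hT : IsNodeSet T) {F G : ℝ → Fin 2 → ℝ}
    (hG : ∀ a b, Consec T a b → ∀ l ∈ Icc (0 : ℝ) 1,
      G ((1 - l) * a + l * b) = (1 - l) • F a + l • F b) : ContinuousOn G (Icc 0 4) := by
  have hsub : Icc (0 : ℝ) 4 ⊆ ⋃ p : {p : T × T // Consec T p.1 p.2}, Icc (p.1.1 : ℝ) p.1.2 := by
    intro t ht
    obtain ⟨a, b, hab, ht'⟩ := hT.exists_consec ht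
    exact mem_iUnion.2 ⟨⟨(⟨a, hab.1⟩, ⟨b, hab.2.1⟩), hab⟩, ht'⟩
  refine ((locallyFinite_of_finite _).continuousOn_iUnion (fun _ => isClosed_Icc) ?_).mono hsub
  rintro ⟨⟨a, b⟩, hab⟩
  have hd : 0 < (b : ℝ) - a := sub_pos.2 hab.2.2.1
  have hc : Continuous fun t : ℝ => (1 - (t - a) / (b - a)) • F a + ((t - a) / (b - a)) • F b := by
    fun_prop
  refine hc.continuousOn.congr fun t ht => ?_
  have h1 : (t - a) / (b - a) ∈ Icc (0 : ℝ) 1 :=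
    ⟨div_nonneg (by linarith [ht.1]) hd.le, (div_le_one hd).2 (by linarith [ht.2])⟩
  refine Eq.trans ?_ (hG a b hab _ h1)
  congr 1
  field_simp
  ring

/-- Every point of the plane lies in a sector spanned by consecutive nodes. -/
lemma IsNodeSet.exists_sector (hT : IsNodeSet T) (y : Fin 2 → ℝ) : ∃ a b, Consec T a b ∧
    ∃ α β : ℝ, 0 ≤ α ∧ 0 ≤ β ∧ y = α • dia a + β • dia b := by
  rcases eq_or_ne y 0 with rfl | hy
  · obtain ⟨a, b, hab, -⟩ := hT.exists_consec (t := 0) ⟨le_rfl, by norm_num⟩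
    exact ⟨a, b, hab, 0, 0, le_rfl, le_rfl, by simp⟩
  obtain ⟨h1, h2⟩ := ang_mem_and_dia_ang (nrm1_inv_smul hy)
  set t := ang ((nrm1 y)⁻¹ • y)
  obtain ⟨a, b, hab, ht⟩ := hT.exists_consec ⟨h1.1, h1.2.le⟩
  have hd : 0 < b - a := sub_pos.2 hab.2.2.1
  have hN := nrm1_pos hy
  have e1 : dia t = ((b - t) / (b - a)) • dia a + ((t - a) / (b - a)) • dia b := by
    rw [← dia_combo (hT.sameSide hab) (div_nonneg (by linarith [ht.2]) hd.le)
      (div_nonneg (by linarith [ht.1]) hd.le) (by field_simp; ring)]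
    congr 1
    field_simp
    ring
  have hy' : y = nrm1 y • dia t := by
    rw [h2, smul_smul, mul_inv_cancel₀ hN.ne', one_smul]
  refine ⟨a, b, hab, nrm1 y * ((b - t) / (b - a)), nrm1 y * ((t - a) / (b - a)),
    mul_nonneg hN.le (div_nonneg (by linarith [ht.2]) hd.le),
    mul_nonneg hN.le (div_nonneg (by linarith [ht.1]) hd.le), ?_⟩
  rw [← smul_smul, ← smul_smul, ← smul_add, ← e1, ← hy']

lemma sector_eq_smul_dia {a b : ℝ} (hs : SameSide a b) {α β : ℝ} (hα : 0 ≤ α) (hβ : 0 ≤ β)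
    (h0 : 0 < α + β) : α • dia a + β • dia b =
      (α + β) • dia ((1 - β / (α + β)) * a + β / (α + β) * b) := by
  have h1 : 1 - β / (α + β) = α / (α + β) := by field_simp; ring
  rw [dia_combo hs (by rw [h1]; positivity) (by positivity) (by ring), h1, smul_add, smul_smul,
    smul_smul, mul_div_cancel₀ _ h0.ne', mul_div_cancel₀ _ h0.ne']

/-- A homogeneous function that is affine on a segment of the circle is linear on the sector over
this segment. -/
lemma PosHom.apply_sector {h : (Fin 2 → ℝ) → ℝ} (hh : PosHom h) {a b : ℝ} (hs : SameSide a b)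
    (haff : ∀ l ∈ Icc (0 : ℝ) 1,
      h (dia ((1 - l) * a + l * b)) = (1 - l) * h (dia a) + l * h (dia b))
    {α β : ℝ} (hα : 0 ≤ α) (hβ : 0 ≤ β) :
    h (α • dia a + β • dia b) = α * h (dia a) + β * h (dia b) := by
  rcases (add_nonneg hα hβ).eq_or_lt with h0 | h0
  · have h1 : α = 0 := by linarith
    have h2 : β = 0 := by linarith
    simp [h1, h2, hh.map_zero]
  · rw [sector_eq_smul_dia hs hα hβ h0, hh _ h0.le,
      haff _ ⟨by positivity, (div_le_one h0).2 (by linarith)⟩]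
    field_simp
    ring

/-- The homogeneous extension of the interpolation of `τ`. -/
lemma IsNodeSet.exists_fanMap (hT : IsNodeSet T) {τ : ℝ → Fin 2 → ℝ} (hτ : τ 0 = τ 4) :
    ∃ ψ : (Fin 2 → ℝ) → (Fin 2 → ℝ), Continuous ψ ∧ ∀ a b, Consec T a b → ∀ α β : ℝ, 0 ≤ α →
      0 ≤ β → ψ (α • dia a + β • dia b) = α • τ a + β • τ b := by
  obtain ⟨G, hG⟩ := exists_interpolation T τ
  have hGc := hT.continuousOn hG
  have hG0 : G 0 = τ 0 := by
    obtain ⟨a, b, hab, ht⟩ := hT.exists_consec (t := 0) ⟨le_rfl, by norm_num⟩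
    have : a = 0 := le_antisymm ht.1 (hT.1 a hab.1).1
    subst this
    simpa using hG _ b hab 0 (by simp)
  have hG4 : G 4 = τ 4 := by
    obtain ⟨a, b, hab, ht⟩ := hT.exists_consec (t := 4) ⟨by norm_num, le_rfl⟩
    have : b = 4 := le_antisymm (hT.1 b hab.2.1).2 ht.2
    subst this
    simpa using hG a _ hab 1 (by simp)
  have hang : ∀ t ∈ Icc (0 : ℝ) 4, G (ang (dia t)) = G t := by
    intro t ht
    rcases ht.2.eq_or_lt with rfl | hlt
    · rw [dia_four, ang_dia ⟨le_rfl, by norm_num⟩, hG0, hG4, hτ]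
    · rw [ang_dia ⟨ht.1, hlt⟩]
  -- `ang` jumps at `![1, 0]`. Continuity descends along the quotient map from `[0, 4]` to the
  -- circle because `G` agrees at the two ends.
  have hcirc : Continuous fun y : {y : Fin 2 → ℝ // nrm1 y = 1} => G (ang y) := by
    let π : Icc (0 : ℝ) 4 → {y : Fin 2 → ℝ // nrm1 y = 1} := fun t => ⟨dia t, nrm1_dia t.2⟩
    have hπ : Continuous π := by
      have : Continuous fun t : Icc (0 : ℝ) 4 => dia t := by fun_prop
      exact Continuous.subtype_mk this _
    have hs : Function.Surjective π := fun y =>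
      ⟨⟨ang y, (ang_mem_and_dia_ang y.2).1.1, (ang_mem_and_dia_ang y.2).1.2.le⟩,
        Subtype.ext (ang_mem_and_dia_ang y.2).2⟩
    rw [(hπ.isClosedMap.isQuotientMap hπ hs).continuous_iff]
    have : Continuous fun t : Icc (0 : ℝ) 4 => G t :=
      continuousOn_iff_continuous_domRestrict.1 hGc
    exact this.congr fun t => (hang t t.2).symm
  refine ⟨fun y => nrm1 y • G (ang ((nrm1 y)⁻¹ • y)), ?_, ?_⟩
  · obtain ⟨B, hB⟩ := (isCompact_Icc.image_of_continuousOn hGc).isBounded.exists_norm_le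
    rw [continuous_iff_continuousAt]
    intro y
    rcases eq_or_ne y 0 with rfl | hy
    · have hbd : ∀ y : Fin 2 → ℝ, ‖nrm1 y • G (ang ((nrm1 y)⁻¹ • y))‖ ≤ nrm1 y * B := by
        intro y
        rcases eq_or_ne y 0 with rfl | hy
        · simp [nrm1]
        · rw [norm_smul, Real.norm_of_nonneg (nrm1_nonneg y)]
          have := (ang_mem_and_dia_ang (nrm1_inv_smul hy)).1
          exact mul_le_mul_of_nonneg_left (hB _ ⟨_, ⟨this.1, this.2.le⟩, rfl⟩) (nrm1_nonneg y)
      have hlim : Filter.Tendsto (fun y => nrm1 y * B) (𝓝 0) (𝓝 0) := by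
        have : Continuous fun y => nrm1 y * B := by fun_prop
        simpa [nrm1] using this.tendsto 0
      have := squeeze_zero_norm hbd hlim
      simpa [ContinuousAt, nrm1] using this
    · have hopen : IsOpen {y : Fin 2 → ℝ | y ≠ 0} := isOpen_ne
      refine ContinuousOn.continuousAt (s := {y | y ≠ 0}) ?_ (hopen.mem_nhds hy)
      rw [continuousOn_iff_continuous_domRestrict]
      have h1 : Continuous fun y : {y : Fin 2 → ℝ | y ≠ 0} => (nrm1 y.1)⁻¹ :=
        Continuous.inv₀ (by fun_prop) fun y => (nrm1_pos y.2).ne'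
      have h2 : Continuous fun y : {y : Fin 2 → ℝ | y ≠ 0} =>
          (⟨(nrm1 y.1)⁻¹ • y.1, nrm1_inv_smul y.2⟩ : {y : Fin 2 → ℝ // nrm1 y = 1}) :=
        Continuous.subtype_mk (h1.smul continuous_subtype_val) _
      have h3 : Continuous fun y : {y : Fin 2 → ℝ | y ≠ 0} => nrm1 y.1 := by fun_prop
      exact h3.smul (hcirc.comp h2)
  · intro a b hab α β hα hβ
    rcases (add_nonneg hα hβ).eq_or_lt with h0 | h0
    · have h1 : α = 0 := by linarith
      have h2 : β = 0 := by linarith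
      simp [h1, h2, nrm1]
    · have hl : β / (α + β) ∈ Icc (0 : ℝ) 1 := ⟨by positivity, (div_le_one h0).2 (by linarith)⟩
      have ha := hT.1 a hab.1
      have hb := hT.1 b hab.2.1
      have ht : (1 - β / (α + β)) * a + β / (α + β) * b ∈ Icc (0 : ℝ) 4 :=
        convex_Icc _ _ ha hb (by linarith [hl.2]) hl.1 (by ring)
      beta_reduce
      rw [sector_eq_smul_dia (hT.sameSide hab) hα hβ h0, nrm1_smul, nrm1_dia ht, mul_one,
        abs_of_pos h0, smul_smul, inv_mul_cancel₀ h0.ne', one_smul, hang _ ht, hG a b hab _ hl,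
        smul_add, smul_smul, smul_smul, mul_div_cancel₀ _ h0.ne']
      congr 2
      field_simp
      ring

/-- The piecewise linear homeomorphism of the plane that maps the nodes of `T` to positive
multiples of the nodes of `φ '' T`. -/
lemma IsNodeSet.exists_fanHomeo {φ : ℝ ≃o ℝ} (hT : IsNodeSet T) (hU : IsNodeSet (T.image φ))
    (h0 : φ 0 = 0) (h4 : φ 4 = 4) {ρ : ℝ → ℝ} (hρ : ∀ t, 0 < ρ t) (hρ04 : ρ 0 = ρ 4) :
    ∃ ψ : (Fin 2 → ℝ) ≃ₜ (Fin 2 → ℝ), ∀ a b, Consec T a b → ∀ α β : ℝ, 0 ≤ α → 0 ≤ β →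
      ψ (α • dia a + β • dia b) = (α * ρ a) • dia (φ a) + (β * ρ b) • dia (φ b) := by
  have h0' : φ.symm 0 = 0 := by rw [OrderIso.symm_apply_eq, h0]
  have h4' : φ.symm 4 = 4 := by rw [OrderIso.symm_apply_eq, h4]
  obtain ⟨ψ, hψc, hψ⟩ := hT.exists_fanMap (τ := fun t => ρ t • dia (φ t))
    (by rw [h0, h4, hρ04, dia_four])
  -- The inverse is the fan map of the inverse data on the image nodes: the ray over `φ t` returns
  -- to the ray over `t`, with the reciprocal factor.
  obtain ⟨ψ', hψc', hψ'⟩ := hU.exists_fanMap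
    (τ := fun u => (ρ (φ.symm u))⁻¹ • dia (φ.symm u))
    (by rw [h0', h4', hρ04, dia_four])
  have himg : ∀ a b, Consec T a b → Consec (T.image φ) (φ a) (φ b) := by
    rintro a b ⟨ha, hb, hab, hn⟩
    refine ⟨Finset.mem_image_of_mem _ ha, Finset.mem_image_of_mem _ hb, φ.lt_iff_lt.2 hab, ?_⟩
    intro u hu huI
    obtain ⟨t, ht, rfl⟩ := Finset.mem_image.1 hu
    exact hn t ht ⟨φ.lt_iff_lt.1 huI.1, φ.lt_iff_lt.1 huI.2⟩
  have himg' : ∀ a b, Consec (T.image φ) a b → Consec T (φ.symm a) (φ.symm b) := by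
    rintro a b ⟨ha, hb, hab, hn⟩
    obtain ⟨a, haT, rfl⟩ := Finset.mem_image.1 ha
    obtain ⟨b, hbT, rfl⟩ := Finset.mem_image.1 hb
    rw [φ.symm_apply_apply, φ.symm_apply_apply]
    refine ⟨haT, hbT, φ.lt_iff_lt.1 hab, fun t ht htI => ?_⟩
    exact hn (φ t) (Finset.mem_image_of_mem _ ht) ⟨φ.lt_iff_lt.2 htI.1, φ.lt_iff_lt.2 htI.2⟩
  refine ⟨⟨⟨ψ, ψ', fun y => ?_, fun z => ?_⟩, hψc, hψc'⟩, fun a b hab α β hα hβ => ?_⟩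
  · obtain ⟨a, b, hab, α, β, hα, hβ, rfl⟩ := hT.exists_sector y
    rw [hψ a b hab α β hα hβ, smul_smul, smul_smul, hψ' _ _ (himg a b hab) _ _
      (mul_nonneg hα (hρ a).le) (mul_nonneg hβ (hρ b).le), φ.symm_apply_apply, φ.symm_apply_apply,
      smul_smul, smul_smul, mul_assoc, mul_assoc, mul_inv_cancel₀ (hρ a).ne',
      mul_inv_cancel₀ (hρ b).ne', mul_one, mul_one]
  · obtain ⟨a, b, hab, α, β, hα, hβ, rfl⟩ := hU.exists_sector z
    rw [hψ' a b hab α β hα hβ, smul_smul, smul_smul, hψ _ _ (himg' a b hab) _ _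
      (mul_nonneg hα (inv_pos.2 (hρ _)).le) (mul_nonneg hβ (inv_pos.2 (hρ _)).le),
      φ.apply_symm_apply, φ.apply_symm_apply,
      smul_smul, smul_smul, mul_assoc, mul_assoc, inv_mul_cancel₀ (hρ _).ne',
      inv_mul_cancel₀ (hρ _).ne', mul_one, mul_one]
  · change ψ _ = _
    rw [hψ a b hab α β hα hβ, smul_smul, smul_smul]

end Fan

end

noncomputable section

/-! ### Normal forms -/

/-- An order isomorphism can be modified to the right of a point. -/
lemma exists_orderIso_extend (φ : ℝ ≃o ℝ) {p x y : ℝ} (hpx : p < x) (hy : φ p < y) :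
    ∃ φ' : ℝ ≃o ℝ, (∀ t ≤ p, φ' t = φ t) ∧ φ' x = y := by
  set q := φ p
  have hx : 0 < φ x - q := sub_pos.2 (φ.lt_iff_lt.2 hpx)
  set k := (y - q) / (φ x - q) with hk
  have hk0 : 0 < k := div_pos (sub_pos.2 hy) hx
  set E : ℝ → ℝ := fun u => if u ≤ q then u else q + k * (u - q) with hE
  have hmono : StrictMono E := by
    intro u w huw
    simp only [hE]
    split_ifs with h1 h2 h2
    · exact huw
    · push Not at h2
      nlinarith [mul_pos hk0 (sub_pos.2 h2)]
    · linarith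
    · nlinarith
  have hsurj : Function.Surjective E := by
    intro w
    rcases le_or_gt w q with h | h
    · exact ⟨w, by simp [hE, h]⟩
    · have h1 : 0 < (w - q) / k := div_pos (sub_pos.2 h) hk0
      refine ⟨q + (w - q) / k, ?_⟩
      simp only [hE]
      rw [if_neg (by linarith), add_sub_cancel_left, mul_div_cancel₀ _ hk0.ne']
      ring
  refine ⟨φ.trans (hmono.orderIsoOfSurjective E hsurj), fun t ht => ?_, ?_⟩
  · change E (φ t) = φ t
    simp only [hE]
    rw [if_pos (φ.le_iff_le.2 ht)]
  · change E (φ x) = y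
    simp only [hE]
    rw [if_neg (by linarith), hk, div_mul_cancel₀ _ hx.ne']
    ring

/-- The targets 1 and 3 are the parameters of the zeros of the first coordinate on the circle. -/
lemma exists_orderIso_two {a b : ℝ} (ha : 0 < a) (hab : a < b) (hb : b < 4) :
    ∃ φ : ℝ ≃o ℝ, φ 0 = 0 ∧ φ a = 1 ∧ φ b = 3 ∧ φ 4 = 4 := by
  obtain ⟨φ₁, h1, h1'⟩ := exists_orderIso_extend (OrderIso.refl ℝ) (y := 1) ha (by simp)
  obtain ⟨φ₂, h2, h2'⟩ := exists_orderIso_extend φ₁ (y := 3) hab (by rw [h1']; norm_num)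
  obtain ⟨φ₃, h3, h3'⟩ := exists_orderIso_extend φ₂ (y := 4) hb (by rw [h2']; norm_num)
  refine ⟨φ₃, ?_, ?_, ?_, h3'⟩
  · rw [h3 0 (by linarith), h2 0 ha.le, h1 0 le_rfl]; rfl
  · rw [h3 a hab.le, h2 a le_rfl, h1']
  · rw [h3 b le_rfl, h2']

/-- The targets are the midpoints of the four sides, where `|y 0| = |y 1|`, that is, the zeros of
the standard saddle. -/
lemma exists_orderIso_four {a b c d : ℝ} (ha : 0 < a) (hab : a < b) (hbc : b < c) (hcd : c < d)
    (hd : d < 4) : ∃ φ : ℝ ≃o ℝ, φ 0 = 0 ∧ φ a = 1 / 2 ∧ φ b = 3 / 2 ∧ φ c = 5 / 2 ∧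
      φ d = 7 / 2 ∧ φ 4 = 4 := by
  obtain ⟨φ₁, h1, h1'⟩ := exists_orderIso_extend (OrderIso.refl ℝ) (y := 1 / 2) ha (by simp)
  obtain ⟨φ₂, h2, h2'⟩ := exists_orderIso_extend φ₁ (y := 3 / 2) hab (by rw [h1']; norm_num)
  obtain ⟨φ₃, h3, h3'⟩ := exists_orderIso_extend φ₂ (y := 5 / 2) hbc (by rw [h2']; norm_num)
  obtain ⟨φ₄, h4, h4'⟩ := exists_orderIso_extend φ₃ (y := 7 / 2) hcd (by rw [h3']; norm_num)
  obtain ⟨φ₅, h5, h5'⟩ := exists_orderIso_extend φ₄ (y := 4) hd (by rw [h4']; norm_num)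
  refine ⟨φ₅, ?_, ?_, ?_, ?_, ?_, h5'⟩
  · rw [h5 0 (by linarith), h4 0 (by linarith), h3 0 (by linarith), h2 0 ha.le, h1 0 le_rfl]; rfl
  · rw [h5 a (by linarith), h4 a (by linarith), h3 a hab.le, h2 a le_rfl, h1']
  · rw [h5 b (by linarith), h4 b hbc.le, h3 b le_rfl, h2']
  · rw [h5 c hcd.le, h4 c le_rfl, h3']
  · rw [h5 d le_rfl, h4']

/-- `h` is affine along each side of the `ℓ¹` circle. -/
def SideAffine (h : (Fin 2 → ℝ) → ℝ) : Prop :=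
  ∀ s t, SameSide s t → ∀ l ∈ Icc (0 : ℝ) 1,
    h (dia ((1 - l) * s + l * t)) = (1 - l) * h (dia s) + l * h (dia t)

lemma sideAffine_apply (i : Fin 2) : SideAffine fun y => y i := by
  intro s t hst l hl
  rw [dia_combo hst (by linarith [hl.2]) hl.1 (by ring)]
  simp

lemma sideAffine_abs (i : Fin 2) : SideAffine fun y => |y i| := by
  intro s t hst l hl
  have hl' : 0 ≤ 1 - l := by linarith [hl.2]
  have hsgn : (0 ≤ dia s i ∧ 0 ≤ dia t i) ∨ (dia s i ≤ 0 ∧ dia t i ≤ 0) := by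
    obtain ⟨k, hk, hs, ht⟩ := hst
    interval_cases k <;> norm_num at hs ht
    · rw [dia_of_mem_zero hs, dia_of_mem_zero ht]
      fin_cases i <;> simp <;> grind
    · rw [dia_of_mem_one hs, dia_of_mem_one ht]
      fin_cases i <;> simp <;> grind
    · rw [dia_of_mem_two hs, dia_of_mem_two ht]
      fin_cases i <;> simp <;> grind
    · rw [dia_of_mem_three hs, dia_of_mem_three ht]
      fin_cases i <;> simp <;> grind
  rw [dia_combo hst hl' hl.1 (by ring)]
  simp only [Pi.add_apply, Pi.smul_apply, smul_eq_mul]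
  rcases hsgn with ⟨h1, h2⟩ | ⟨h1, h2⟩
  · rw [abs_of_nonneg h1, abs_of_nonneg h2,
      abs_of_nonneg (add_nonneg (mul_nonneg hl' h1) (mul_nonneg hl.1 h2))]
  · rw [abs_of_nonpos h1, abs_of_nonpos h2, abs_of_nonpos (add_nonpos
      (mul_nonpos_of_nonneg_of_nonpos hl' h1) (mul_nonpos_of_nonneg_of_nonpos hl.1 h2))]
    ring

lemma SideAffine.add {g h : (Fin 2 → ℝ) → ℝ} (hg : SideAffine g) (hh : SideAffine h) :
    SideAffine fun y => g y + h y := by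
  intro s t hst l hl
  simp only [hg s t hst l hl, hh s t hst l hl]
  ring

lemma SideAffine.neg {h : (Fin 2 → ℝ) → ℝ} (hh : SideAffine h) : SideAffine fun y => -h y := by
  intro s t hst l hl
  simp only [hh s t hst l hl]
  ring

/-- A piecewise linear change of coordinates that transforms `h` into `h₀`. -/
structure IsNormalForm (ψ : (Fin 2 → ℝ) ≃ₜ (Fin 2 → ℝ)) (h h₀ : (Fin 2 → ℝ) → ℝ) : Prop where
  map_zero : ψ 0 = 0
  comp_eq : ∀ y, h₀ (ψ y) = h y
  exists_sectors : ∃ (J : Type) (_ : Finite J) (l₁ l₂ : J → ((Fin 2 → ℝ) →ᵃ[ℝ] ℝ))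
    (L : J → ((Fin 2 → ℝ) →ᵃ[ℝ] (Fin 2 → ℝ))), (∀ y, ∃ j, l₁ j y ≤ 0 ∧ l₂ j y ≤ 0) ∧
    ∀ j y, l₁ j y ≤ 0 → l₂ j y ≤ 0 → ψ y = L j y

/-- `det2` as a linear map in its second argument. -/
def detL (z : Fin 2 → ℝ) : (Fin 2 → ℝ) →ₗ[ℝ] ℝ where
  toFun y := det2 z y
  map_add' y w := by simp [det2]; ring
  map_smul' c y := by simp [det2]; ring

lemma det2_cramer (u w y : Fin 2 → ℝ) :
    det2 u w • y = det2 y w • u + det2 u y • w := by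
  ext i; fin_cases i <;> simp [det2] <;> ring

/-- The ray over a node `t` goes to the ray over `φ t`, stretched by `h / h₀`, which is positive
because the signs agree. So `h₀ ∘ ψ` and `h` coincide on the rays over the nodes, and both are
linear on the sectors between them. -/
theorem exists_normalForm {h h₀ : (Fin 2 → ℝ) → ℝ} (hc : Continuous h) (hh : PosHom h)
    (hPL : LocallyPL h) (hh₀ : PosHom h₀) (hs₀ : SideAffine h₀) {φ : ℝ ≃o ℝ} (h0 : φ 0 = 0)
    (h4 : φ 4 = 4) (hsign : ∀ t ∈ Icc (0 : ℝ) 4, (h (dia t) = 0 ∧ h₀ (dia (φ t)) = 0) ∨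
      0 < h (dia t) * h₀ (dia (φ t))) : ∃ ψ, IsNormalForm ψ h h₀ := by
  classical
  obtain ⟨T₁, hT₁⟩ := hPL.exists_nodes hh hc
  set N : Finset ℝ := (Finset.range 5).image (fun k : ℕ => (k : ℝ)) with hN
  have hNm : ∀ k : ℕ, k ≤ 4 → (k : ℝ) ∈ N := fun k hk =>
    Finset.mem_image_of_mem _ (Finset.mem_range.2 (by omega))
  have hk4 : ∀ k : ℕ, k ≤ 4 → (k : ℝ) ∈ Icc (0 : ℝ) 4 := fun k hk =>
    ⟨Nat.cast_nonneg _, by exact_mod_cast hk⟩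
  have hφI : ∀ t ∈ Icc (0 : ℝ) 4, φ t ∈ Icc (0 : ℝ) 4 := fun t ht =>
    ⟨h0 ▸ φ.le_iff_le.2 ht.1, h4 ▸ φ.le_iff_le.2 ht.2⟩
  have hφI' : ∀ t ∈ Icc (0 : ℝ) 4, φ.symm t ∈ Icc (0 : ℝ) 4 := fun t ht =>
    ⟨by rw [OrderIso.le_symm_apply, h0]; exact ht.1, by
      rw [OrderIso.symm_apply_le, h4]; exact ht.2⟩
  -- The nodes comprise the breakpoints of `h`, the corners, and the preimages of the corners under
  -- `φ`, so that the image of `T` is a node set as well.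
  set T : Finset ℝ := (T₁ ∪ N ∪ N.image φ.symm).filter (· ∈ Icc (0 : ℝ) 4) with hTdef
  have hT : IsNodeSet T := by
    refine ⟨fun t ht => (Finset.mem_filter.1 ht).2, fun k hk => Finset.mem_filter.2 ⟨?_, hk4 k hk⟩⟩
    exact Finset.mem_union_left _ (Finset.mem_union_right _ (hNm k hk))
  have hU : IsNodeSet (T.image φ) := by
    refine ⟨fun u hu => ?_, fun k hk => ?_⟩
    · obtain ⟨t, ht, rfl⟩ := Finset.mem_image.1 hu
      exact hφI t (hT.1 t ht)
    · refine Finset.mem_image.2 ⟨φ.symm k, Finset.mem_filter.2 ⟨?_, hφI' _ (hk4 k hk)⟩,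
        φ.apply_symm_apply _⟩
      exact Finset.mem_union_right _ (Finset.mem_image_of_mem _ (hNm k hk))
  -- At a common zero any positive factor would do.
  set ρ : ℝ → ℝ := fun t => if t ∈ Icc (0 : ℝ) 4 ∧ h (dia t) ≠ 0 then
    h (dia t) / h₀ (dia (φ t)) else 1 with hρdef
  have hρ : ∀ t, 0 < ρ t := by
    intro t
    simp only [hρdef]
    split_ifs with ht
    · rcases hsign t ht.1 with h1 | h1
      · exact absurd h1.1 ht.2
      · rcases pos_and_pos_or_neg_and_neg_of_mul_pos h1 with h2 | h2
        · exact div_pos h2.1 h2.2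
        · exact div_pos_of_neg_of_neg h2.1 h2.2
    · exact one_pos
  have hρh : ∀ t ∈ Icc (0 : ℝ) 4, ρ t * h₀ (dia (φ t)) = h (dia t) := by
    intro t ht
    simp only [hρdef]
    rcases hsign t ht with h1 | h1
    · rw [h1.1, h1.2, mul_zero]
    · rw [if_pos ⟨ht, left_ne_zero_of_mul h1.ne'⟩,
        div_mul_cancel₀ _ (right_ne_zero_of_mul h1.ne')]
  have hρ04 : ρ 0 = ρ 4 := by
    have m0 : (0 : ℝ) ∈ Icc (0 : ℝ) 4 := by norm_num
    have m4 : (4 : ℝ) ∈ Icc (0 : ℝ) 4 := by norm_num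
    simp only [hρdef, m0, m4, true_and, h0, h4, dia_four]
  obtain ⟨ψ, hψ⟩ := hT.exists_fanHomeo hU h0 h4 hρ hρ04
  have himg : ∀ a b, Consec T a b → Consec (T.image φ) (φ a) (φ b) := by
    rintro a b ⟨ha, hb, hab, hn⟩
    refine ⟨Finset.mem_image_of_mem _ ha, Finset.mem_image_of_mem _ hb, φ.lt_iff_lt.2 hab, ?_⟩
    intro u hu huI
    obtain ⟨t, ht, rfl⟩ := Finset.mem_image.1 hu
    exact hn t ht ⟨φ.lt_iff_lt.1 huI.1, φ.lt_iff_lt.1 huI.2⟩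
  -- The sector between consecutive nodes is cut out by the determinants with its two boundary rays,
  -- and Cramer's rule provides the linear map that `ψ` equals on it.
  refine ⟨ψ, ?_, ?_, {p : T × T // Consec T p.1 p.2}, inferInstance,
    fun p => (-(detL (dia p.1.1))).toAffineMap, fun p => (detL (dia p.1.2)).toAffineMap,
    fun p => (((p.1.2 : ℝ) - p.1.1)⁻¹ •
      ((-(detL (dia p.1.2))).smulRight (ρ p.1.1 • dia (φ p.1.1)) +
        (detL (dia p.1.1)).smulRight (ρ p.1.2 • dia (φ p.1.2)))).toAffineMap, ?_, ?_⟩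
  · obtain ⟨a, b, hab, -⟩ := hT.exists_consec (t := 0) ⟨le_rfl, by norm_num⟩
    simpa using hψ a b hab 0 0 le_rfl le_rfl
  · intro y
    obtain ⟨a, b, hab, α, β, hα, hβ, rfl⟩ := hT.exists_sector y
    have ha := hT.1 a hab.1
    have hb := hT.1 b hab.2.1
    rw [hψ a b hab α β hα hβ, hh₀.apply_sector (hU.sameSide (himg a b hab))
      (hs₀ _ _ (hU.sameSide (himg a b hab))) (mul_nonneg hα (hρ a).le) (mul_nonneg hβ (hρ b).le),
      hh.apply_sector (hT.sameSide hab) (hT₁ a b ha.1 hab.2.2.1 hb.2 fun t ht htI => ?_) hα hβ,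
      mul_assoc, mul_assoc, hρh a ha, hρh b hb]
    refine hab.2.2.2 t (Finset.mem_filter.2 ⟨?_, ha.1.trans htI.1.le, htI.2.le.trans hb.2⟩) htI
    exact Finset.mem_union_left _ (Finset.mem_union_left _ ht)
  · intro y
    obtain ⟨a, b, hab, α, β, hα, hβ, rfl⟩ := hT.exists_sector y
    have hd := det2_dia (hT.sameSide hab)
    have hlt := sub_pos.2 hab.2.2.1
    refine ⟨⟨(⟨a, hab.1⟩, ⟨b, hab.2.1⟩), hab⟩, ?_, ?_⟩
    · change -(det2 (dia a) (α • dia a + β • dia b)) ≤ 0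
      have : det2 (dia a) (α • dia a + β • dia b) = β * det2 (dia a) (dia b) := by
        simp [det2]; ring
      rw [this, hd]
      nlinarith [mul_nonneg hβ hlt.le]
    · change det2 (dia b) (α • dia a + β • dia b) ≤ 0
      have : det2 (dia b) (α • dia a + β • dia b) = -(α * det2 (dia a) (dia b)) := by
        simp [det2]; ring
      rw [this, hd]
      nlinarith [mul_nonneg hα hlt.le]
  · rintro ⟨⟨⟨a, haT⟩, ⟨b, hbT⟩⟩, hab⟩ y h1 h2
    change -(det2 (dia a) y) ≤ 0 at h1
    change det2 (dia b) y ≤ 0 at h2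
    change ψ y = (b - a)⁻¹ • ((-(det2 (dia b) y)) • (ρ a • dia (φ a)) +
      det2 (dia a) y • (ρ b • dia (φ b)))
    have hab' : Consec T a b := hab
    have hd := det2_dia (hT.sameSide hab')
    have hlt : 0 < b - a := sub_pos.2 hab'.2.2.1
    have hcr := det2_cramer (dia a) (dia b) y
    have hsw : det2 y (dia b) = -(det2 (dia b) y) := by simp [det2]; ring
    rw [hd, hsw] at hcr
    have hy : y = ((b - a)⁻¹ * -(det2 (dia b) y)) • dia a + ((b - a)⁻¹ * det2 (dia a) y) • dia b := by
      rw [← smul_smul, ← smul_smul, ← smul_add, ← hcr, smul_smul, inv_mul_cancel₀ hlt.ne', one_smul]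
    conv_lhs => rw [hy]
    rw [hψ a b hab' _ _ (mul_nonneg (inv_pos.2 hlt).le (by linarith))
      (mul_nonneg (inv_pos.2 hlt).le (by linarith))]
    module

variable {M : Type u} [TopologicalSpace M] {K : PolytopalComplex M} {v : M}

/-- A normal form of the conical model gives a chart in which the function has this form. -/
lemma IsNormalForm.exists_chart {ψ : (Fin 2 → ℝ) ≃ₜ (Fin 2 → ℝ)} {h h₀ : (Fin 2 → ℝ) → ℝ}
    (hψ : IsNormalForm ψ h h₀) {e : OpenPartialHomeomorph M (Fin 2 → ℝ)} (he : K.IsPLChart e)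
    {f : M → ℝ} (H : IsConical e h f v) :
    ∃ e' : OpenPartialHomeomorph M (Fin 2 → ℝ), K.IsPLChart e' ∧ v ∈ e'.source ∧ e' v = 0 ∧
      ∀ y ∈ e'.source, f y = f v + h₀ (e' y) := by
  obtain ⟨U, hU, hUo, hvU⟩ := eventually_nhds_iff.1 H.eventually_eq
  obtain ⟨J, _, l₁, l₂, L, hcov, hL⟩ := hψ.exists_sectors
  refine ⟨(e.restrOpen U hUo).transHomeomorph ψ, fun c => ?_, ⟨H.mem_source, hvU⟩, ?_, ?_⟩
  · exact (he c).comp_sectors (ψ := ψ) (fun x hx => ⟨hx.1, hx.2.1⟩) l₁ l₂ L hcov hL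
  · change ψ (e v) = 0
    rw [H.map_eq_zero, hψ.map_zero]
  · intro y hy
    change f y = f v + h₀ (ψ (e y))
    rw [hψ.comp_eq]
    exact hU y hy.2

end

noncomputable section

/-! ### Multiplicities -/

section Multiplicity

variable {𝔽 : Type u} [Field 𝔽] {M : Type u} [TopologicalSpace M] {f : M → ℝ} {v : M}

/-- The homology at `v` is concentrated in degree `i`, where it has rank `m`. -/
def HasLevelRank (𝔽 : Type u) [Field 𝔽] (f : M → ℝ) (v : M) (i m : ℕ) : Prop :=
  ∀ k, Module.rank 𝔽 (levelHomology 𝔽 f v k) = if k = i then (m : Cardinal) else 0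

variable {i m : ℕ}

lemma HasLevelRank.isHCriticalOfIndex_iff (H : HasLevelRank 𝔽 f v i m) (j : ℕ) :
    IsHCriticalOfIndex 𝔽 f v j ↔ j = i ∧ m ≠ 0 := by
  rw [IsHCriticalOfIndex, ← rank_pos_iff_nontrivial (R := 𝔽), H j]
  split_ifs with h
  · simp [h, Nat.pos_iff_ne_zero]
  · simp [h]

lemma HasLevelRank.isHCritical_iff (H : HasLevelRank 𝔽 f v i m) : IsHCritical 𝔽 f v ↔ m ≠ 0 := by
  simp only [IsHCritical, H.isHCriticalOfIndex_iff]
  exact ⟨fun ⟨_, _, h⟩ => h, fun h => ⟨i, rfl, h⟩⟩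

lemma HasLevelRank.isHRegular_iff (H : HasLevelRank 𝔽 f v i m) : IsHRegular 𝔽 f v ↔ m = 0 := by
  have : IsHRegular 𝔽 f v ↔ ¬ IsHCritical 𝔽 f v := by
    simp only [IsHRegular, IsHCritical, IsHCriticalOfIndex, not_exists, not_nontrivial_iff_subsingleton]
  rw [this, H.isHCritical_iff, not_not]

lemma HasLevelRank.criticalMultiplicity_eq (H : HasLevelRank 𝔽 f v i m) :
    criticalMultiplicity 𝔽 f v i = m := by
  rw [criticalMultiplicity, H i, if_pos rfl]
  simp

lemma HasLevelRank.totalMultiplicity_eq (H : HasLevelRank 𝔽 f v i m) :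
    totalMultiplicity 𝔽 f v = m := by
  have hinj : Function.Injective (DirectSum.lof 𝔽 ℕ (fun k => levelHomology 𝔽 f v k) i) :=
    DirectSum.of_injective (β := fun k => levelHomology 𝔽 f v k) i
  have hsurj : Function.Surjective (DirectSum.lof 𝔽 ℕ (fun k => levelHomology 𝔽 f v k) i) := by
    intro x
    refine ⟨x i, ?_⟩
    ext j
    rcases eq_or_ne i j with rfl | hij
    · exact DirectSum.of_eq_same (β := fun k => levelHomology 𝔽 f v k) i (x i)
    · have : Subsingleton (levelHomology 𝔽 f v j) := by
        rw [← rank_zero_iff (R := 𝔽), H j, if_neg (Ne.symm hij)]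
      exact Subsingleton.elim _ _
  rw [totalMultiplicity, ← (LinearEquiv.ofBijective _ ⟨hinj, hsurj⟩).rank_eq, H i, if_pos rfl]
  simp

end Multiplicity

section Extrema

variable {M : Type u} [TopologicalSpace M] {e : OpenPartialHomeomorph M (Fin 2 → ℝ)}
  {h : (Fin 2 → ℝ) → ℝ} {f : M → ℝ} {v : M}

lemma IsConical.isLocalMin (H : IsConical e h f v) (hh : ∀ y, 0 ≤ h y) : IsLocalMin f v := by
  filter_upwards [H.eventually_eq] with x hx
  rw [hx]
  linarith [hh (e x)]

lemma IsConical.isLocalMax (H : IsConical e h f v) (hh : ∀ y, h y ≤ 0) : IsLocalMax f v := by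
  filter_upwards [H.eventually_eq] with x hx
  rw [hx]
  linarith [hh (e x)]

/-- Each ray from the origin reaches into every neighbourhood of `v`, so a single value of `h`
already shows that `v` is not a local extremum of the corresponding kind. -/
lemma IsConical.exists_of_eventually (H : IsConical e h f v) {P : M → Prop}
    (hP : ∀ᶠ x in 𝓝 v, P x) (y : Fin 2 → ℝ) :
    ∃ x, P x ∧ ∃ s : ℝ, 0 < s ∧ f x = f v + s * h y := by
  have hsymm0 : e.symm 0 = v := by rw [← H.map_eq_zero, e.left_inv H.mem_source]
  have h0t : (0 : Fin 2 → ℝ) ∈ e.target := H.map_eq_zero ▸ e.map_source H.mem_source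
  have htend : Filter.Tendsto e.symm (𝓝 0) (𝓝 v) := by
    have := e.continuousAt_symm h0t
    rwa [ContinuousAt, hsymm0] at this
  have htend2 : Filter.Tendsto (fun s : ℝ => s • y) (𝓝[>] 0) (𝓝 0) := by
    have : Continuous fun s : ℝ => s • y := by fun_prop
    simpa using (this.tendsto 0).mono_left nhdsWithin_le_nhds
  obtain ⟨s, ⟨h3, h4, h5⟩, hs⟩ := ((htend2.eventually ((e.open_target.eventually_mem h0t).and
    (htend.eventually (H.eventually_eq.and hP)))).and self_mem_nhdsWithin).exists
  have hs : 0 < s := hs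
  rw [e.right_inv h3, H.posHom _ hs.le] at h4
  exact ⟨_, h5, s, hs, h4⟩

lemma IsConical.not_isLocalMin (H : IsConical e h f v) {y : Fin 2 → ℝ} (hy : h y < 0) :
    ¬ IsLocalMin f v := fun hmin => by
  obtain ⟨x, hx, s, hs, hfx⟩ := H.exists_of_eventually hmin y
  nlinarith

lemma IsConical.not_isLocalMax (H : IsConical e h f v) {y : Fin 2 → ℝ} (hy : 0 < h y) :
    ¬ IsLocalMax f v := fun hmax => by
  obtain ⟨x, hx, s, hs, hfx⟩ := H.exists_of_eventually hmax y
  nlinarith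

variable [T1Space M] (𝔽 : Type u) [Field 𝔽]

lemma IsConical.hasLevelRank_of_pos (H : IsConical e h f v) (hpos : ∀ y ≠ 0, 0 < h y) :
    HasLevelRank 𝔽 f v 0 1 := fun k => by rw [H.rank_of_pos 𝔽 hpos, Nat.cast_one]

lemma IsConical.hasLevelRank_of_neg (H : IsConical e h f v) (hneg : ∀ y ≠ 0, h y < 0) :
    HasLevelRank 𝔽 f v 2 1 := fun k => by rw [H.rank_of_neg 𝔽 hneg, Nat.cast_one]

end Extrema

/-! ### The indefinite case -/

section Indefinite

variable {h : (Fin 2 → ℝ) → ℝ}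

/-- The sign changes at the zeros of `h` other than the origin. -/
def ChangesSign (h : (Fin 2 → ℝ) → ℝ) : Prop :=
  ∀ y ≠ 0, h y = 0 → y ∈ closure {y | h y < 0} ∧ y ∈ closure {y | 0 < h y}

lemma ChangesSign.lowerArc (hz : ChangesSign h) (hh : PosHom h) {t : ℝ}
    (ht : t ∈ Ioo (0 : ℝ) 4) (h0 : h (dia t) = 0) :
    t ∈ closure {s ∈ Icc (0 : ℝ) 4 | h (dia s) < 0} ∧
      t ∈ closure {s ∈ Icc (0 : ℝ) 4 | 0 < h (dia s)} := by
  obtain ⟨h1, h2⟩ := hz _ (dia_ne_zero (Ioo_subset_Icc_self ht)) h0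
  have hne : ∀ y, h y ≠ 0 → y ≠ 0 := by
    rintro y hy rfl
    exact hy hh.map_zero
  constructor
  · refine mem_closure_of_zero hh ht (S := Iio 0) (fun c hc x hx => mul_neg_of_pos_of_neg hc hx)
      (closure_mono ?_ h1)
    exact fun y hy => ⟨hne y (ne_of_lt hy), hy⟩
  · refine mem_closure_of_zero hh ht (S := Ioi 0) (fun c hc x hx => mul_pos hc hx)
      (closure_mono ?_ h2)
    exact fun y hy => ⟨hne y (ne_of_gt hy), hy⟩

lemma LocallyPL.finite_components (hPL : LocallyPL h) (hh : PosHom h) :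
    Finite (_root_.ConnectedComponents (lowerArc h)) := by
  obtain ⟨J, _, I, hI, hI4, hlin, hcov⟩ := hPL.exists_cover hh
  refine finite_connectedComponents_of_cover (C := fun j => {t ∈ I j | h (dia t) ≤ 0}) ?_ ?_ ?_
  · rintro j s ⟨hs, hs'⟩ t ⟨ht, ht'⟩ a b ha hb hab
    refine ⟨hI j hs ht ha hb hab, ?_⟩
    simp only [smul_eq_mul]
    rw [hlin j s hs t ht a b ha hb hab]
    nlinarith
  · exact fun j t ht => ⟨hI4 j ht.1, ht.2⟩
  · intro t ht
    obtain ⟨j, hj⟩ := mem_iUnion.1 (hcov ht.1)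
    exact mem_iUnion.2 ⟨j, hj, ht.2⟩

lemma lowerArc_nonempty (hh : PosHom h) (hneg : ∃ y, h y < 0) : (lowerArc h).Nonempty := by
  obtain ⟨y, hy⟩ := hneg
  have hy0 : y ≠ 0 := by
    rintro rfl
    rw [hh.map_zero] at hy
    exact lt_irrefl _ hy
  obtain ⟨h1, h2⟩ := ang_mem_and_dia_ang (nrm1_inv_smul hy0)
  refine ⟨_, ⟨h1.1, h1.2.le⟩, ?_⟩
  rw [h2, hh _ (inv_nonneg.2 (nrm1_nonneg y))]
  exact mul_nonpos_of_nonneg_of_nonpos (inv_nonneg.2 (nrm1_nonneg y)) hy.le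

lemma exists_arc (hc : Continuous h) (hh : PosHom h) (hPL : LocallyPL h) (hz : ChangesSign h)
    (h0 : 0 < h ![1, 0]) {x : ℝ} (hx : x ∈ lowerArc h) :
    ∃ a b, 0 < a ∧ a < b ∧ b < 4 ∧ connectedComponentIn (lowerArc h) x = Icc a b ∧
      h (dia a) = 0 ∧ h (dia b) = 0 ∧ ∀ t ∈ Ioo a b, h (dia t) < 0 := by
  have := hPL.finite_components hh
  exact exists_component_eq_Icc (L := lowerArc h) (η := fun t => h (dia t)) (hc.comp continuous_dia)
    (by rw [dia_zero]; exact h0) (by rw [dia_four, dia_zero]; exact h0) rfl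
    (fun t ht ht0 => hz.lowerArc hh ht ht0) hx

lemma pos_of_notMem {t : ℝ} (ht : t ∈ Icc (0 : ℝ) 4) (h' : t ∉ lowerArc h) : 0 < h (dia t) := by
  by_contra hle
  exact h' ⟨ht, not_lt.1 hle⟩

/-- If the lower part of the circle is connected then `h` is equivalent to a coordinate. -/
theorem exists_normalForm_of_card_one (hc : Continuous h) (hh : PosHom h) (hPL : LocallyPL h)
    (hz : ChangesSign h) (h0 : 0 < h ![1, 0])
    (hcard : Nat.card (_root_.ConnectedComponents (lowerArc h)) = 1) :
    ∃ ψ, IsNormalForm ψ h fun y => y 0 := by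
  obtain ⟨hsub, ⟨x⟩⟩ := Nat.card_eq_one_iff_unique.1 hcard
  obtain ⟨x, rfl⟩ := ConnectedComponents.surjective_coe x
  obtain ⟨a, b, ha, hab, hb, hC, hηa, hηb, hneg⟩ := exists_arc hc hh hPL hz h0 x.2
  have hL : ∀ t ∈ lowerArc h, t ∈ Icc a b := fun t ht => by
    rw [← hC]
    exact connectedComponents_mk_eq.1 (hsub.elim (x : _root_.ConnectedComponents (lowerArc h))
      (⟨t, ht⟩ : lowerArc h))
  obtain ⟨φ, h0', hφa, hφb, h4⟩ := exists_orderIso_two ha hab hb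
  refine exists_normalForm hc hh hPL (fun c _ y => by simp) (sideAffine_apply 0) h0' h4
    fun t ht => ?_
  -- The first coordinate of `dia s` is `|s - 2| - 1`, which is negative exactly for `1 < s < 3`. By
  -- the choice of `φ` this matches the arc from `a` to `b`.
  change (_ ∧ |φ t - 2| - 1 = 0) ∨ 0 < _ * (|φ t - 2| - 1)
  rcases lt_trichotomy t a with hta | rfl | hta
  · right
    have h1 : φ t < 1 := hφa ▸ φ.lt_iff_lt.2 hta
    refine mul_pos (pos_of_notMem ht fun h => absurd (hL t h).1 (not_le.2 hta)) ?_
    have := neg_le_abs (φ t - 2)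
    linarith
  · left
    exact ⟨hηa, by rw [hφa]; norm_num⟩
  rcases lt_trichotomy t b with htb | rfl | htb
  · right
    have h1 : 1 < φ t := hφa ▸ φ.lt_iff_lt.2 hta
    have h2 : φ t < 3 := hφb ▸ φ.lt_iff_lt.2 htb
    refine mul_pos_of_neg_of_neg (hneg t ⟨hta, htb⟩) ?_
    have : |φ t - 2| < 1 := abs_lt.2 ⟨by linarith, by linarith⟩
    linarith
  · left
    exact ⟨hηb, by rw [hφb]; norm_num⟩
  · right
    have h1 : 3 < φ t := hφb ▸ φ.lt_iff_lt.2 htb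
    refine mul_pos (pos_of_notMem ht fun h => absurd (hL t h).2 (not_le.2 htb)) ?_
    have := le_abs_self (φ t - 2)
    linarith

lemma abs_sub_abs_dia {s : ℝ} (hs : s ∈ Icc (0 : ℝ) 4) :
    (s ≤ 1 ∧ |dia s 0| - |dia s 1| = 1 - 2 * s) ∨
    (1 ≤ s ∧ s ≤ 2 ∧ |dia s 0| - |dia s 1| = 2 * s - 3) ∨
    (2 ≤ s ∧ s ≤ 3 ∧ |dia s 0| - |dia s 1| = 5 - 2 * s) ∨
    (3 ≤ s ∧ |dia s 0| - |dia s 1| = 2 * s - 7) := by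
  rcases exists_side hs with h | h | h | h
  · refine .inl ⟨h.2, ?_⟩
    rw [dia_of_mem_zero h]
    simp only [Matrix.cons_val_zero, Matrix.cons_val_one]
    rw [abs_of_nonneg (by linarith [h.2]), abs_of_nonneg h.1]
    ring
  · refine .inr (.inl ⟨h.1, h.2, ?_⟩)
    rw [dia_of_mem_one h]
    simp only [Matrix.cons_val_zero, Matrix.cons_val_one]
    rw [abs_of_nonpos (by linarith [h.1]), abs_of_nonneg (by linarith [h.2])]
    ring
  · refine .inr (.inr (.inl ⟨h.1, h.2, ?_⟩))
    rw [dia_of_mem_two h]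
    simp only [Matrix.cons_val_zero, Matrix.cons_val_one]
    rw [abs_of_nonpos (by linarith [h.2]), abs_of_nonpos (by linarith [h.1])]
    ring
  · refine .inr (.inr (.inr ⟨h.1, ?_⟩))
    rw [dia_of_mem_three h]
    simp only [Matrix.cons_val_zero, Matrix.cons_val_one]
    rw [abs_of_nonneg (by linarith [h.1]), abs_of_nonpos (by linarith [h.2])]
    ring

/-- If the lower part of the circle has two components then `h` is equivalent to the standard
saddle. -/
theorem exists_normalForm_of_card_two (hc : Continuous h) (hh : PosHom h) (hPL : LocallyPL h)
    (hz : ChangesSign h) (h0 : 0 < h ![1, 0])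
    (hcard : Nat.card (_root_.ConnectedComponents (lowerArc h)) = 2) :
    ∃ ψ, IsNormalForm ψ h fun y => |y 0| - |y 1| := by
  obtain ⟨x, y, hxy, huniv⟩ := Nat.card_eq_two_iff.1 hcard
  obtain ⟨x, rfl⟩ := ConnectedComponents.surjective_coe x
  obtain ⟨y, rfl⟩ := ConnectedComponents.surjective_coe y
  obtain ⟨a, b, ha, hab, hb, hC, hηa, hηb, hneg⟩ := exists_arc hc hh hPL hz h0 x.2
  obtain ⟨c, d, hc0, hcd, hd, hC', hηc, hηd, hneg'⟩ := exists_arc hc hh hPL hz h0 y.2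
  have hL : ∀ t ∈ lowerArc h, t ∈ Icc a b ∨ t ∈ Icc c d := fun t ht => by
    have : ((⟨t, ht⟩ : lowerArc h) : _root_.ConnectedComponents (lowerArc h)) ∈
      ({(x : _root_.ConnectedComponents (lowerArc h)), (y : _root_.ConnectedComponents _)} :
        Set _) := huniv ▸ mem_univ _
    rcases this with h1 | h1
    · left; rw [← hC]; exact connectedComponents_mk_eq.1 h1.symm
    · right; rw [← hC']; exact connectedComponents_mk_eq.1 (Eq.symm h1)
  have hdisj : ∀ t, t ∈ Icc a b → t ∉ Icc c d := by
    intro t h1 h2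
    rw [← hC] at h1
    rw [← hC'] at h2
    refine hxy (connectedComponents_mk_eq.2 ?_)
    rw [connectedComponentIn_eq h1, ← connectedComponentIn_eq h2]
    exact mem_connectedComponentIn y.2
  -- The two arcs are disjoint intervals, so one precedes the other, and the argument is carried out
  -- once for ordered arcs.
  have key : ∀ a b c d : ℝ, 0 < a → a < b → b < c → c < d → d < 4 → h (dia a) = 0 →
      h (dia b) = 0 → h (dia c) = 0 → h (dia d) = 0 → (∀ t ∈ Ioo a b, h (dia t) < 0) →
      (∀ t ∈ Ioo c d, h (dia t) < 0) → (∀ t ∈ lowerArc h, t ∈ Icc a b ∨ t ∈ Icc c d) →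
      ∃ ψ, IsNormalForm ψ h fun y => |y 0| - |y 1| := by
    intro a b c d ha hab hbc hcd hd hηa hηb hηc hηd hneg hneg' hL
    obtain ⟨φ, h0', hφa, hφb, hφc, hφd, h4⟩ := exists_orderIso_four ha hab hbc hcd hd
    have hsA : SideAffine fun y => |y 0| - |y 1| := by
      simpa only [sub_eq_add_neg] using (sideAffine_abs 0).add (sideAffine_abs 1).neg
    refine exists_normalForm hc hh hPL (fun r hr y => ?_) hsA h0' h4 fun t ht => ?_
    · simp only [Pi.smul_apply, smul_eq_mul, abs_mul, abs_of_nonneg hr]; ring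
    have hs : φ t ∈ Icc (0 : ℝ) 4 := ⟨h0' ▸ φ.le_iff_le.2 ht.1, h4 ▸ φ.le_iff_le.2 ht.2⟩
    have hval := abs_sub_abs_dia hs
    rcases lt_trichotomy t a with hta | rfl | hta
    · right
      have h1 : φ t < 1 / 2 := hφa ▸ φ.lt_iff_lt.2 hta
      refine mul_pos (pos_of_notMem ht fun h => ?_) ?_
      · rcases hL t h with h | h <;> linarith [h.1]
      · rcases hval with ⟨_, e⟩ | ⟨_, _, e⟩ | ⟨_, _, e⟩ | ⟨_, e⟩ <;> linarith
    · left
      refine ⟨hηa, ?_⟩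
      rcases hval with ⟨_, e⟩ | ⟨_, _, e⟩ | ⟨_, _, e⟩ | ⟨_, e⟩ <;> linarith
    rcases lt_trichotomy t b with htb | rfl | htb
    · right
      have h1 : 1 / 2 < φ t := hφa ▸ φ.lt_iff_lt.2 hta
      have h2 : φ t < 3 / 2 := hφb ▸ φ.lt_iff_lt.2 htb
      refine mul_pos_of_neg_of_neg (hneg t ⟨hta, htb⟩) ?_
      rcases hval with ⟨_, e⟩ | ⟨_, _, e⟩ | ⟨_, _, e⟩ | ⟨_, e⟩ <;> linarith
    · left
      refine ⟨hηb, ?_⟩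
      rcases hval with ⟨_, e⟩ | ⟨_, _, e⟩ | ⟨_, _, e⟩ | ⟨_, e⟩ <;> linarith
    rcases lt_trichotomy t c with htc | rfl | htc
    · right
      have h1 : 3 / 2 < φ t := hφb ▸ φ.lt_iff_lt.2 htb
      have h2 : φ t < 5 / 2 := hφc ▸ φ.lt_iff_lt.2 htc
      refine mul_pos (pos_of_notMem ht fun h => ?_) ?_
      · rcases hL t h with h | h <;> linarith [h.1, h.2]
      · rcases hval with ⟨_, e⟩ | ⟨_, _, e⟩ | ⟨_, _, e⟩ | ⟨_, e⟩ <;> linarith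
    · left
      refine ⟨hηc, ?_⟩
      rcases hval with ⟨_, e⟩ | ⟨_, _, e⟩ | ⟨_, _, e⟩ | ⟨_, e⟩ <;> linarith
    rcases lt_trichotomy t d with htd | rfl | htd
    · right
      have h1 : 5 / 2 < φ t := hφc ▸ φ.lt_iff_lt.2 htc
      have h2 : φ t < 7 / 2 := hφd ▸ φ.lt_iff_lt.2 htd
      refine mul_pos_of_neg_of_neg (hneg' t ⟨htc, htd⟩) ?_
      rcases hval with ⟨_, e⟩ | ⟨_, _, e⟩ | ⟨_, _, e⟩ | ⟨_, e⟩ <;> linarith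
    · left
      refine ⟨hηd, ?_⟩
      rcases hval with ⟨_, e⟩ | ⟨_, _, e⟩ | ⟨_, _, e⟩ | ⟨_, e⟩ <;> linarith
    · right
      have h1 : 7 / 2 < φ t := hφd ▸ φ.lt_iff_lt.2 htd
      refine mul_pos (pos_of_notMem ht fun h => ?_) ?_
      · rcases hL t h with h | h <;> linarith [h.2]
      · rcases hval with ⟨_, e⟩ | ⟨_, _, e⟩ | ⟨_, _, e⟩ | ⟨_, e⟩ <;> linarith
  rcases lt_or_ge b c with hbc | hbc
  · exact key a b c d ha hab hbc hcd hd hηa hηb hηc hηd hneg hneg' hL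
  · rcases lt_or_ge d a with hda | hda
    · exact key c d a b hc0 hcd hda hab hb hηc hηd hηa hηb hneg' hneg fun t ht => (hL t ht).symm
    · exfalso
      rcases le_total a c with h1 | h1
      · exact hdisj c ⟨h1, hbc⟩ ⟨le_rfl, hcd.le⟩
      · exact hdisj a ⟨le_rfl, hab.le⟩ ⟨h1, hda⟩

/-- The definite normal form. -/
theorem exists_normalForm_of_pos (hc : Continuous h) (hh : PosHom h) (hPL : LocallyPL h)
    (hpos : ∀ y ≠ 0, 0 < h y) : ∃ ψ, IsNormalForm ψ h fun y => |y 0| + |y 1| := by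
  refine exists_normalForm hc hh hPL (fun r hr y => ?_) ((sideAffine_abs 0).add (sideAffine_abs 1))
    (φ := OrderIso.refl ℝ) rfl rfl fun t ht => .inr ?_
  · simp only [Pi.smul_apply, smul_eq_mul, abs_mul, abs_of_nonneg hr]; ring
  · exact mul_pos (hpos _ (dia_ne_zero ht)) (nrm1_pos (dia_ne_zero ht))

theorem exists_normalForm_of_neg (hc : Continuous h) (hh : PosHom h) (hPL : LocallyPL h)
    (hneg : ∀ y ≠ 0, h y < 0) : ∃ ψ, IsNormalForm ψ h fun y => -(|y 0| + |y 1|) := by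
  refine exists_normalForm hc hh hPL (fun r hr y => ?_)
    ((sideAffine_abs 0).add (sideAffine_abs 1)).neg
    (φ := OrderIso.refl ℝ) rfl rfl fun t ht => .inr ?_
  · simp only [Pi.smul_apply, smul_eq_mul, abs_mul, abs_of_nonneg hr]; ring
  · exact mul_pos_of_neg_of_neg (hneg _ (dia_ne_zero ht))
      (neg_neg_of_pos (nrm1_pos (dia_ne_zero ht)))

end Indefinite

end

/-! ### Homology of the normal forms and classification of the vertices -/

noncomputable section

open scoped ContinuousMap

lemma card_connectedComponents_congr {X Y : Type*} [TopologicalSpace X] [TopologicalSpace Y]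
    (φ : X ≃ₜ Y) : Nat.card (_root_.ConnectedComponents X) =
      Nat.card (_root_.ConnectedComponents Y) := by
  refine Nat.card_congr ⟨φ.continuous.connectedComponentsMap,
    φ.symm.continuous.connectedComponentsMap, fun x => ?_, fun y => ?_⟩
  · obtain ⟨x, rfl⟩ := ConnectedComponents.surjective_coe x
    exact congrArg _ (φ.symm_apply_apply x)
  · obtain ⟨y, rfl⟩ := ConnectedComponents.surjective_coe y
    exact congrArg _ (φ.apply_symm_apply y)

/-- In the indefinite case the homology is concentrated in degree one, where its rank is one less
than the number of components of the lower part of the circle. -/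
lemma IsConical.hasLevelRank_of_indefinite {M : Type u} [TopologicalSpace M] [T1Space M]
    {e : OpenPartialHomeomorph M (Fin 2 → ℝ)} {h : (Fin 2 → ℝ) → ℝ} {f : M → ℝ} {v : M}
    (𝔽 : Type u) [Field 𝔽] (H : IsConical e h f v) (hPL : LocallyPL h) (h0 : 0 < h ![1, 0])
    (hneg : ∃ y, h y < 0) : 1 ≤ Nat.card (_root_.ConnectedComponents (lowerArc h)) ∧
      HasLevelRank 𝔽 f v 1 (Nat.card (_root_.ConnectedComponents (lowerArc h)) - 1) := by
  have := hPL.finite_components H.posHom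
  obtain ⟨x, hx⟩ := lowerArc_nonempty H.posHom hneg
  have : Nonempty (_root_.ConnectedComponents (lowerArc h)) := ⟨((⟨x, hx⟩ : lowerArc h) : _)⟩
  refine ⟨Nat.card_pos, fun k => ?_⟩
  exact H.rank_of_discrete 𝔽
    ((lowerArcHomeo H.continuous h0).symm.toHomotopyEquiv.trans homotopyEquivComponents) k

/-- The lower part of the circle for a coordinate function is contractible. -/
def lowerCircleCoord (i : Fin 2) : lowerCircle (fun y => y i) ≃ₕ Unit where
  toFun := ⟨fun _ => (), continuous_const⟩
  invFun := ⟨fun _ => ⟨Pi.single i (-1), by fin_cases i <;> simp [nrm1], by simp⟩,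
    continuous_const⟩
  left_inv := ⟨{
    -- The straight path from minus the `i`-th basis vector stays on the `ℓ¹` circle: both `i`-th
    -- coordinates are nonpositive and the other coordinate starts at zero, so the norms add up.
    toFun := fun q => ⟨(1 - q.1.1) • Pi.single i (-1) + q.1.1 • q.2.1, by
      have h0 := q.1.2.1
      have h1 := q.1.2.2
      have h2 : nrm1 q.2.1 = 1 := q.2.2.1
      have h3 : q.2.1 i ≤ 0 := q.2.2.2
      generalize q.1.1 = t at *
      generalize q.2.1 = y at *
      have h4 := mul_nonpos_of_nonneg_of_nonpos h0 h3
      unfold nrm1 at h2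
      constructor
      · fin_cases i
        · simp only [nrm1, Pi.add_apply, Pi.smul_apply, smul_eq_mul, Pi.single_apply] at *
          norm_num at *
          rw [abs_of_nonneg h0, abs_of_nonpos (by linarith)]
          rw [abs_of_nonpos h3] at h2
          linear_combination t * h2
        · simp only [nrm1, Pi.add_apply, Pi.smul_apply, smul_eq_mul, Pi.single_apply] at *
          norm_num at *
          have h5 : t - 1 + t * y 1 ≤ 0 := by linarith
          rw [abs_of_nonneg h0, abs_of_nonpos h5]
          rw [abs_of_nonpos h3] at h2
          linear_combination t * h2
      · simp only [Pi.add_apply, Pi.smul_apply, smul_eq_mul, Pi.single_eq_same]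
        linarith⟩
    continuous_toFun := by fun_prop
    map_zero_left := fun y => by apply Subtype.ext; simp
    map_one_left := fun y => by apply Subtype.ext; simp }⟩
  right_inv := by
    convert ContinuousMap.Homotopic.refl _
    exact Subsingleton.elim _ _

/-- The standard saddle. -/
def saddleForm (y : Fin 2 → ℝ) : ℝ := -|y 0| + |y 1|

lemma abs_pos_of_saddle {y : Fin 2 → ℝ} (hy : y ∈ lowerCircle saddleForm) : 0 < |y 0| := by
  have h1 : |y 0| + |y 1| = 1 := hy.1
  have h2 : -|y 0| + |y 1| ≤ 0 := hy.2
  linarith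

/-- The lower part of the circle for the standard saddle has two contractible components. -/
def lowerCircleSaddle : lowerCircle saddleForm ≃ₕ ({1, -1} : Set ℝ) where
  toFun := ⟨fun y => ⟨|y.1 0|⁻¹ * y.1 0, by
      have h := abs_pos_of_saddle y.2
      rcases abs_cases (y.1 0) with ⟨h1, -⟩ | ⟨h1, -⟩
      · rw [h1] at h ⊢
        left; exact inv_mul_cancel₀ h.ne'
      · right
        rw [h1] at h ⊢
        rw [mem_singleton_iff, inv_neg, neg_mul, inv_mul_cancel₀ (by linarith)]⟩, by
    have h0 : Continuous fun y : lowerCircle saddleForm => y.1 0 :=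
      (continuous_apply 0).comp continuous_subtype_val
    exact Continuous.subtype_mk
      ((h0.abs.inv₀ fun y => (abs_pos_of_saddle y.2).ne').mul h0) _⟩
  invFun := ⟨fun s => ⟨![s, 0], by
      rcases s.2 with h | h
      · constructor <;> simp [saddleForm, nrm1, h]
      · rw [mem_singleton_iff] at h
        constructor <;> simp [saddleForm, nrm1, h]⟩, by
    have : Continuous fun s : ({1, -1} : Set ℝ) => (![s.1, 0] : Fin 2 → ℝ) := by
      refine continuous_pi fun i => ?_
      fin_cases i <;> simp <;> fun_prop
    exact Continuous.subtype_mk this _⟩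
  left_inv := ⟨{
    -- The straight path from the point `![±1, 0]` with the sign of the first coordinate. The
    -- absolute value of this coordinate is `(1 - t) + t * |y 0|` along the path, so the norm
    -- remains one.
    toFun := fun q => ⟨![((1 - q.1.1) * |q.2.1 0|⁻¹ + q.1.1) * q.2.1 0, q.1.1 * q.2.1 1], by
      have hp := abs_pos_of_saddle q.2.2
      have h0 := q.1.2.1
      have h1 := q.1.2.2
      have h2 : |q.2.1 0| + |q.2.1 1| = 1 := q.2.2.1
      have h3 : -|q.2.1 0| + |q.2.1 1| ≤ 0 := q.2.2.2
      generalize q.1.1 = t at *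
      generalize q.2.1 = y at *
      have e : |((1 - t) * |y 0|⁻¹ + t) * y 0| = (1 - t) + t * |y 0| := by
        have : 0 ≤ (1 - t) * |y 0|⁻¹ + t :=
          add_nonneg (mul_nonneg (by linarith) (inv_nonneg.2 hp.le)) h0
        rw [abs_mul, abs_of_nonneg this, add_mul, mul_assoc, inv_mul_cancel₀ hp.ne', mul_one]
      constructor
      · simp only [nrm1, Matrix.cons_val_zero, Matrix.cons_val_one]
        rw [e, abs_mul, abs_of_nonneg h0]
        linear_combination t * h2
      · simp only [saddleForm, Matrix.cons_val_zero, Matrix.cons_val_one]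
        rw [e, abs_mul, abs_of_nonneg h0]
        nlinarith⟩
    continuous_toFun := by
      have ht : Continuous fun q : unitInterval × lowerCircle saddleForm => (q.1 : ℝ) :=
        continuous_subtype_val.comp continuous_fst
      have hc (i : Fin 2) : Continuous fun q : unitInterval × lowerCircle saddleForm => q.2.1 i :=
        (continuous_apply i).comp (continuous_subtype_val.comp continuous_snd)
      have h1 := (hc 0).abs.inv₀ fun q => (abs_pos_of_saddle q.2.2).ne'
      refine Continuous.subtype_mk (continuous_pi fun i => ?_) _
      fin_cases i
      · exact (((continuous_const.sub ht).mul h1).add ht).mul (hc 0)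
      · exact ht.mul (hc 1)
    map_zero_left := fun y => by
      apply Subtype.ext
      ext i; fin_cases i <;> simp
    map_one_left := fun y => by
      apply Subtype.ext
      ext i; fin_cases i <;> simp }⟩
  right_inv := by
    convert ContinuousMap.Homotopic.refl _
    ext s
    rcases s.2 with h | h
    · simp [h]
    · rw [mem_singleton_iff] at h
      simp [h]

namespace PolytopalComplex

variable {M : Type u} [TopologicalSpace M] {K : PolytopalComplex M} {f : M → ℝ} {v : M}

lemma isConical_of_source {e : OpenPartialHomeomorph M (Fin 2 → ℝ)} {h : (Fin 2 → ℝ) → ℝ}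
    (hv : v ∈ e.source) (hv0 : e v = 0) (hc : Continuous h) (hh : PosHom h)
    (hfe : ∀ y ∈ e.source, f y = f v + h (e y)) : IsConical e h f v :=
  ⟨hv, hv0, hc, hh, Filter.eventually_of_mem (e.open_source.mem_nhds hv) hfe⟩

/-- For a coordinate function the lower part of the circle is contractible, the case of one
component. This is what excludes saddles among the strongly regular vertices of a PL Morse function.
-/
lemma IsStronglyRegular.hasLevelRank [T1Space M] (𝔽 : Type u) [Field 𝔽]
    (h : K.IsStronglyRegular 2 f v) : HasLevelRank 𝔽 f v 1 0 := by
  obtain ⟨e, -, hv, hv0, i, hfe⟩ := h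
  have H : IsConical e (fun y => y i) f v := isConical_of_source hv hv0 (by fun_prop)
    (fun c _ y => by simp) hfe
  intro k
  simpa using H.rank_of_discrete 𝔽 (lowerCircleCoord i) k

lemma IsNondegenerateCritical.hasLevelRank [T1Space M] (𝔽 : Type u) [Field 𝔽]
    (h : K.IsNondegenerateCritical 2 f v 1) : HasLevelRank 𝔽 f v 1 1 := by
  obtain ⟨-, e, -, hv, hv0, hfe⟩ := h
  have H : IsConical e saddleForm f v := isConical_of_source hv hv0
    (by unfold saddleForm; fun_prop)
    (fun c hc y => by simp [saddleForm, abs_mul, abs_of_nonneg hc]; ring)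
    (fun y hy => by simpa [Fin.sum_univ_two, saddleForm] using hfe y hy)
  intro k
  have hcard : Nat.card ({1, -1} : Set ℝ) = 2 := by
    rw [Nat.card_coe_set_eq, Set.ncard_pair (by norm_num)]
  have : Nonempty ({1, -1} : Set ℝ) := ⟨⟨1, by simp⟩⟩
  rw [H.rank_of_discrete 𝔽 lowerCircleSaddle k, hcard]

lemma IsNondegenerateCritical.isLocalMin (h : K.IsNondegenerateCritical 2 f v 0) :
    IsLocalMin f v := by
  obtain ⟨-, e, -, hv, hv0, hfe⟩ := h
  filter_upwards [e.open_source.mem_nhds hv] with y hy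
  rw [hfe y hy]
  simp only [Fin.sum_univ_two, not_lt_zero, if_false]
  have := abs_nonneg (e y 0)
  have := abs_nonneg (e y 1)
  linarith

lemma IsNondegenerateCritical.isLocalMax (h : K.IsNondegenerateCritical 2 f v 2) :
    IsLocalMax f v := by
  obtain ⟨-, e, -, hv, hv0, hfe⟩ := h
  filter_upwards [e.open_source.mem_nhds hv] with y hy
  rw [hfe y hy]
  simp only [Fin.sum_univ_two, Fin.val_zero, Fin.val_one]
  norm_num
  have := abs_nonneg (e y 0)
  have := abs_nonneg (e y 1)
  linarith

/-- The three possible types of a vertex. -/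
theorem vertex_trichotomy [T2Space M] (hM : K.IsPLManifold 2) (hf : K.IsGenericPL f)
    (hvK : v ∈ K.vertices) (𝔽 : Type u) [Field 𝔽] :
    (IsLocalMin f v ∧ HasLevelRank 𝔽 f v 0 1 ∧ K.IsNondegenerateCritical 2 f v 0) ∨
    (IsLocalMax f v ∧ HasLevelRank 𝔽 f v 2 1 ∧ K.IsNondegenerateCritical 2 f v 2) ∨
    (¬ IsLocalMin f v ∧ ¬ IsLocalMax f v ∧ ∃ r : ℕ, 1 ≤ r ∧
      Nat.card (_root_.ConnectedComponents (K.lowerLink f v)) = r ∧ HasLevelRank 𝔽 f v 1 (r - 1) ∧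
      (r = 1 → K.IsStronglyRegular 2 f v) ∧ (r = 2 → K.IsNondegenerateCritical 2 f v 1)) := by
  obtain ⟨e, h, he, H, hPL, ⟨hlk⟩, hz, hpos | hneg | ⟨h0, hneg⟩⟩ := hM.exists_vertex_model hf hvK
  · obtain ⟨ψ, hψ⟩ := exists_normalForm_of_pos H.continuous H.posHom hPL hpos
    obtain ⟨e', he', hv', hv0', hfe⟩ := hψ.exists_chart he H
    refine .inl ⟨H.isLocalMin fun y => ?_, H.hasLevelRank_of_pos 𝔽 hpos, by norm_num, e', he',
      hv', hv0', fun y hy => ?_⟩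
    · rcases eq_or_ne y 0 with rfl | hy
      · exact H.posHom.map_zero.ge
      · exact (hpos y hy).le
    · rw [hfe y hy]
      simp [Fin.sum_univ_two]
  · obtain ⟨ψ, hψ⟩ := exists_normalForm_of_neg H.continuous H.posHom hPL hneg
    obtain ⟨e', he', hv', hv0', hfe⟩ := hψ.exists_chart he H
    refine .inr (.inl ⟨H.isLocalMax fun y => ?_, H.hasLevelRank_of_neg 𝔽 hneg, by norm_num, e',
      he', hv', hv0', fun y hy => ?_⟩)
    · rcases eq_or_ne y 0 with rfl | hy
      · exact H.posHom.map_zero.le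
      · exact (hneg y hy).le
    · rw [hfe y hy]
      simp [Fin.sum_univ_two]
      ring
  · obtain ⟨hr, hrank⟩ := H.hasLevelRank_of_indefinite 𝔽 hPL h0 hneg
    obtain ⟨w, hw⟩ := id hneg
    refine .inr (.inr ⟨H.not_isLocalMin hw, H.not_isLocalMax h0, _, hr,
      card_connectedComponents_congr (hlk.trans (lowerArcHomeo H.continuous h0).symm), hrank,
      fun hr1 => ?_, fun hr2 => ?_⟩)
    · obtain ⟨ψ, hψ⟩ := exists_normalForm_of_card_one H.continuous H.posHom hPL hz h0 hr1
      obtain ⟨e', he', hv', hv0', hfe⟩ := hψ.exists_chart he H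
      exact ⟨e', he', hv', hv0', 0, hfe⟩
    · obtain ⟨ψ, hψ⟩ := exists_normalForm_of_card_two H.continuous H.posHom hPL hz h0 hr2
      obtain ⟨e', he', hv', hv0', hfe⟩ := hψ.exists_chart he H
      -- The normal form obtained is `|y 0| - |y 1|`, whereas index one asks for the negative sign
      -- at the first coordinate. A quarter turn exchanges the coordinates up to sign.
      have hu : (![0, 1] : Fin 2 → ℝ) ≠ 0 := fun h => by simpa using congrFun h 1
      refine ⟨by norm_num, e'.transHomeomorph
        (planeRotation ![0, 1] hu).toContinuousLinearEquiv.toHomeomorph,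
        he'.trans_affine _ (planeRotation ![0, 1] hu).toLinearMap.toAffineMap fun y => rfl, hv', ?_,
        fun y hy => ?_⟩
      · change planeRotation ![0, 1] hu (e' v) = 0
        rw [hv0', map_zero]
      · rw [hfe y hy]
        have h1 : planeRotation ![0, 1] hu (e' y) = ![e' y 1, -(e' y 0)] := by
          ext i; fin_cases i <;> simp [planeRotation]
        change _ = f v + ∑ i : Fin 2, if (i : ℕ) < 1 then
          -|planeRotation ![0, 1] hu (e' y) i| else |planeRotation ![0, 1] hu (e' y) i|
        rw [h1]
        simp [Fin.sum_univ_two]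
        ring

end PolytopalComplex

end

/-! ### The main theorem -/

theorem mainTheorem3 {M : Type u} [TopologicalSpace M] [T2Space M]
    (K : PolytopalComplex M) (hM : K.IsPLManifold 2)
    (f : M → ℝ) (hf : K.IsGenericPL f) (𝔽 : Type u) [Field 𝔽] :
    (∀ v ∈ K.vertices, IsHCritical 𝔽 f v →
      (IsLocalMin f v ∧ (∀ j, IsHCriticalOfIndex 𝔽 f v j ↔ j = 0) ∧
        criticalMultiplicity 𝔽 f v 0 = 1) ∨
      (IsLocalMax f v ∧ (∀ j, IsHCriticalOfIndex 𝔽 f v j ↔ j = 2) ∧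
        criticalMultiplicity 𝔽 f v 2 = 1) ∨
      (IsSaddle 𝔽 f v ∧ (∀ j, IsHCriticalOfIndex 𝔽 f v j ↔ j = 1) ∧
        ∃ r : ℕ, 2 ≤ r ∧ Nat.card (ConnectedComponents (K.lowerLink f v)) = r ∧
          criticalMultiplicity 𝔽 f v 1 = (r - 1 : ℕ))) ∧
    (∀ v ∈ K.vertices, IsHRegular 𝔽 f v → K.IsStronglyRegular 2 f v) ∧
    (∀ v ∈ K.vertices, IsSaddle 𝔽 f v → totalMultiplicity 𝔽 f v = 1 →
      K.IsNondegenerateCritical 2 f v 1) ∧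
    (K.IsPLMorse 2 f ↔
      ∀ v ∈ K.vertices, IsSaddle 𝔽 f v → totalMultiplicity 𝔽 f v = 1) := by
  have hsaddle : ∀ v ∈ K.vertices, IsSaddle 𝔽 f v → totalMultiplicity 𝔽 f v = 1 →
      K.IsNondegenerateCritical 2 f v 1 := by
    rintro v hv ⟨-, hmin, hmax⟩ htot
    rcases PolytopalComplex.vertex_trichotomy hM hf hv 𝔽 with ⟨h, -⟩ | ⟨h, -⟩ | ⟨-, -, r, hr, -, H, -, h2⟩
    · exact absurd h hmin
    · exact absurd h hmax
    · rw [H.totalMultiplicity_eq] at htot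
      have : r - 1 = 1 := by exact_mod_cast htot
      exact h2 (by omega)
  refine ⟨fun v hv hcrit => ?_, fun v hv hreg => ?_, hsaddle, fun hMorse v hv hs => ?_,
    fun htot => ⟨hf, fun v hv => ?_⟩⟩
  · rcases PolytopalComplex.vertex_trichotomy hM hf hv 𝔽 with
      ⟨h, H, -⟩ | ⟨h, H, -⟩ | ⟨hmin, hmax, r, hr, hcard, H, -⟩
    · exact .inl ⟨h, fun j => by simp [H.isHCriticalOfIndex_iff],
        by simpa using H.criticalMultiplicity_eq⟩
    · exact .inr (.inl ⟨h, fun j => by simp [H.isHCriticalOfIndex_iff],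
        by simpa using H.criticalMultiplicity_eq⟩)
    · have hr1 := H.isHCritical_iff.1 hcrit
      exact .inr (.inr ⟨⟨hcrit, hmin, hmax⟩, fun j => by simp [H.isHCriticalOfIndex_iff, hr1],
        r, by omega, hcard, H.criticalMultiplicity_eq⟩)
  · rcases PolytopalComplex.vertex_trichotomy hM hf hv 𝔽 with
      ⟨-, H, -⟩ | ⟨-, H, -⟩ | ⟨-, -, r, hr, -, H, h1, -⟩
    · exact absurd (H.isHRegular_iff.1 hreg) one_ne_zero
    · exact absurd (H.isHRegular_iff.1 hreg) one_ne_zero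
    · have := H.isHRegular_iff.1 hreg
      exact h1 (by omega)
  · obtain ⟨hcrit, hmin, hmax⟩ := hs
    -- Indices 0 and 2 are local extrema and strongly regular vertices are not H-critical, so a
    -- saddle of a PL Morse function has index one, where the total rank is one.
    rcases hMorse.2 v hv with ⟨k, hk⟩ | hreg
    · have hk2 := hk.1
      interval_cases k
      · exact absurd hk.isLocalMin hmin
      · simpa using (hk.hasLevelRank 𝔽).totalMultiplicity_eq
      · exact absurd hk.isLocalMax hmax
    · exact absurd rfl ((hreg.hasLevelRank 𝔽).isHCritical_iff.1 hcrit)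
  · rcases PolytopalComplex.vertex_trichotomy hM hf hv 𝔽 with
      ⟨-, -, h⟩ | ⟨-, -, h⟩ | ⟨hmin, hmax, r, hr, -, H, h1, -⟩
    · exact .inl ⟨0, h⟩
    · exact .inl ⟨2, h⟩
    -- One component means strongly regular. With more components the vertex is a saddle, and the
    -- assumption on its multiplicity applies.
    · rcases hr.eq_or_lt with hr1 | hr1
      · exact .inr (h1 hr1.symm)
      · have hs : IsSaddle 𝔽 f v := ⟨H.isHCritical_iff.2 (by omega), hmin, hmax⟩
        exact .inl ⟨1, hsaddle v hv hs (htot v hv hs)⟩
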